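/- Let $B\subset\mathbb{R}^2$ be the open unit disk, $(R,\theta)$ plane polar coordinates, $e_R=(\cos\theta,\sin\theta)$, $e_\theta=(-\sin\theta,\cos\theta)$. Let $N\ge 2$ be an integer, $a\in(N^2-N,\,N^2+N)$ and $\nu>0$. For $x\in B\setminus\{0\}$ and $\xi\in\mathbb{R}^{2\times2}$ put $$f(x,\xi)=\nu\left[a(e_R^T\xi e_R)^2+(e_R^T\xi e_\theta)^2+a(e_\theta^T\xi e_R)^2+(e_\theta^T\xi e_\theta)^2\right],$$ $$M(x)=a(e_R\otimes e_R)(e_R\otimes e_R)+(e_R\otimes e_\theta)(e_R\otimes e_\theta)+a(e_\theta\otimes e_R)(e_\theta\otimes e_R)+(e_\theta\otimes e_\theta)(e_\theta\otimes e_\theta),$$ where $((p\otimes q)(r\otimes s))_{ijkl}=p_iq_jr_ks_l$ and $M\xi\cdot\xi=\sum_{i,j,k,l}M_{ijkl}\xi_{ij}\xi_{kl}$. Let $E(u)=\int_B f(x,\nabla u)\,dx$ with $(\nabla u)_{ij}=\partial_ju_i$, let $u_N=\frac{R}{\sqrt N}(\cos N\theta,\sin N\theta)$ be the $N$-covering map,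 let $g$ be its trace on $\partial B$, and let $$\mathcal{A}^g=\{u\in W^{1,2}(B,\mathbb{R}^2):\ \det\nabla u=1\text{ a.e. in }B,\ u|_{\partial B}=g\},$$ where $u|_{\partial B}=g$ means $u-u_N\in W^{1,2}_0(B,\mathbb{R}^2)$. A map $u\in W^{1,2}(B,\mathbb{R}^2)$ is a stationary point of $E$ if it has a pressure, that is, a function $\lambda\in W^{1,1}(B)$ with $\operatorname{div}\left(\nabla_\xi f(x,\nabla u)+2\lambda\,\mathrm{cof}\,\nabla u\right)=0$ in $\mathcal{D}'(B)$. Then: (i) $M\in L^\infty(B,\mathbb{R}^{16})$ is symmetric ($M_{ijkl}=M_{klij}$), and for all $x\in B\setminus\{0\}$ and $\xi\in\mathbb{R}^{2\times 2}$ one has $f(x,\xi)=\nu M(x)\xi\cdot\xi\ge\nu|\xi|^2$; in particular $f$ is uniformly convex: $\xi\mapsto f(x,\xi)-\nu|\xi|^2$ is convex. (ii) $x\mapsto M(x)$ is discontinuous at $0$, and so is $x\mapsto f(x,\xi)$ for every $\xi$ that is not a scalar multiple of an orthogonal matrix, whatever values are given to them at $0$. (iii) $M\in W^{1,q}(B,\mathbb{R}^{16})$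 and $f(\cdot,\xi)\in W^{1,q}(B)$ for all $1\le q<2$ and all $\xi\in\mathbb{R}^{2\times2}$, while $M\notin W^{1,2}(B,\mathbb{R}^{16})$, and $f(\cdot,\xi)\notin W^{1,2}(B)$ for every $\xi$ that is not a scalar multiple of an orthogonal matrix. (iv) $u_N\in C^{0,1}(B,\mathbb{R}^2)\setminus C^1(B,\mathbb{R}^2)$ is a stationary point of $E$; its pressures are exactly the functions $\lambda=c+\nu\left(N-\frac aN\right)\ln R$ a.e. in $B$, with $c\in\mathbb{R}$, and these belong to $W^{1,q}(B)$ for all $1\le q<2$. (v) $u_N$ is the unique global minimizer of $E$ in $\mathcal{A}^g$ (up to equality a.e.). (vi) The minimum energy is $\min_{v\in\mathcal{A}^g}E(v)=\nu\pi\left(N+\frac aN\right)$. -/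

import Mathlib

open MeasureTheory Set Filter Topology
open scoped ENNReal ContDiff

noncomputable section

namespace NCover

/-- The Euclidean plane. -/
abbrev Plane : Type := EuclideanSpace ℝ (Fin 2)

/-- Real `2 × 2` matrices. -/
abbrev Mat : Type := Matrix (Fin 2) (Fin 2) ℝ

/-- The open unit disk. -/
def disk : Set Plane := Metric.ball 0 1

/-- Lebesgue measure on the unit disk. -/
def diskMeasure : Measure Plane := volume.restrict disk

/-! ### Weak derivatives and Sobolev spaces on the disk -/

/-- The classical partial derivative `∂ⱼ φ`. -/
def partialDeriv (j : Fin 2) (φ : Plane → ℝ) (x : Plane) : ℝ :=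
  fderiv ℝ φ x (EuclideanSpace.single j 1)

/-- `φ ∈ C_c^∞(B)`. -/
def IsTest (φ : Plane → ℝ) : Prop :=
  ContDiff ℝ ∞ φ ∧ HasCompactSupport φ ∧ tsupport φ ⊆ disk

/-- `v` is the weak partial derivative `∂ⱼ w` on the disk. -/
def IsWeakPartial (j : Fin 2) (w v : Plane → ℝ) : Prop :=
  LocallyIntegrableOn w disk ∧ LocallyIntegrableOn v disk ∧
    ∀ φ : Plane → ℝ, IsTest φ →
      ∫ x in disk, w x * partialDeriv j φ x = -∫ x in disk, v x * φ x

open Classical in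
/-- A representative of the weak partial derivative `∂ⱼ w` (unique up to null sets of the disk)
where there is one, and `0` otherwise. -/
def weakPartial (j : Fin 2) (w : Plane → ℝ) : Plane → ℝ :=
  if h : ∃ v, IsWeakPartial j w v then h.choose else 0

/-- The Sobolev space `W^{1,p}(B)` of real functions on the disk. -/
def MemSobolev (p : ℝ≥0∞) (w : Plane → ℝ) : Prop :=
  MemLp w p diskMeasure ∧ ∀ j, ∃ v, IsWeakPartial j w v ∧ MemLp v p diskMeasure

/-- `W_0^{1,2}(B)`, the closure of `C_c^∞(B)` in `W^{1,2}(B)`. -/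
def MemSobolevZero (w : Plane → ℝ) : Prop :=
  MemSobolev 2 w ∧ ∀ ε : ℝ≥0∞, 0 < ε → ∃ φ, IsTest φ ∧
    eLpNorm (fun x => w x - φ x) 2 diskMeasure < ε ∧
    ∀ j, eLpNorm (fun x => weakPartial j w x - partialDeriv j φ x) 2 diskMeasure < ε

/-- The weak gradient of a planar map, `(∇u)ᵢⱼ = ∂ⱼ uᵢ`. -/
def weakGrad (u : Plane → Plane) (x : Plane) : Mat :=
  Matrix.of fun i j => weakPartial j (fun y => u y i) x

/-- The classical gradient of a planar map, `(∇η)ᵢⱼ = ∂ⱼ ηᵢ`. -/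
def grad (η : Plane → Plane) (x : Plane) : Mat :=
  Matrix.of fun i j => partialDeriv j (fun y => η y i) x

/-! ### The variational problem -/

/-- The inner product `A · B` of matrices. -/
def frob (A B : Mat) : ℝ := ∑ i, ∑ j, A i j * B i j

/-- The cofactor matrix. -/
def cof (A : Mat) : Mat := !![A 1 1, -A 1 0; -A 0 1, A 0 0]

/-- The energy `E(u) = ∫_B f(x, ∇u) dx`. -/
def energy (f : Plane → Mat → ℝ) (u : Plane → Plane) : ℝ :=
  ∫ x in disk, f x (weakGrad u x)

/-- The class `A^g`, where `g` is the trace of `u₀`: the maps `u ∈ W^{1,2}(B, ℝ²)` with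
`det ∇u = 1` a.e. and with the same boundary values as `u₀`, that is, `u - u₀ ∈ W_0^{1,2}`. -/
def admissible (u₀ : Plane → Plane) : Set (Plane → Plane) :=
  {u | (∀ i, MemSobolev 2 (fun x => u x i)) ∧
    (∀ᵐ x ∂diskMeasure, (weakGrad u x).det = 1) ∧
    ∀ i, MemSobolevZero (fun x => u x i - u₀ x i)}

/-- `u` is a global minimizer of `F` in the class `A`. -/
def IsGlobalMin (F : (Plane → Plane) → ℝ) (A : Set (Plane → Plane)) (u : Plane → Plane) : Prop :=
  u ∈ A ∧ ∀ v ∈ A, F u ≤ F v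

/-- `∇_ξ f(x, ξ)`, the matrix of the partial derivatives of `f` in the entries of `ξ`. -/
def gradXi (f : Plane → Mat → ℝ) (x : Plane) (ξ : Mat) : Mat :=
  Matrix.of fun i j => deriv (fun t : ℝ => f x (ξ + t • Matrix.single i j (1 : ℝ))) 0

/-- `η ∈ C_c^∞(B, ℝ²)`. -/
def IsTestMap (η : Plane → Plane) : Prop :=
  ContDiff ℝ ∞ η ∧ HasCompactSupport η ∧ tsupport η ⊆ disk

/-- `l` is a pressure for `u ∈ W^{1,2}(B, ℝ²)`: it belongs to `W^{1,1}(B)` and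
`div (∇_ξ f(x, ∇u) + 2 l cof ∇u) = 0` in the sense of distributions on `B`. -/
def IsPressure (f : Plane → Mat → ℝ) (u : Plane → Plane) (l : Plane → ℝ) : Prop :=
  (∀ i, MemSobolev 2 (fun x => u x i)) ∧ MemSobolev 1 l ∧
    ∀ η : Plane → Plane, IsTestMap η →
      ∫ x in disk,
        frob (gradXi f x (weakGrad u x) + (2 * l x) • cof (weakGrad u x)) (grad η x) = 0

/-- `u` is a stationary point of the energy with integrand `f`. -/
def IsStationary (f : Plane → Mat → ℝ) (u : Plane → Plane) : Prop :=
  ∃ l, IsPressure f u l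

/-! ### The integrand and the covering map -/

/-- `e_R(θ) = (cos θ, sin θ)`. -/
def eR (θ : ℝ) : Fin 2 → ℝ := ![Real.cos θ, Real.sin θ]

/-- `e_θ(θ) = (-sin θ, cos θ)`. -/
def eT (θ : ℝ) : Fin 2 → ℝ := ![-Real.sin θ, Real.cos θ]

/-- The polar angle of a point of the plane. -/
def angle (x : Plane) : ℝ := Complex.arg ⟨x 0, x 1⟩

/-- The number `pᵀ ξ q`. -/
def bil (p : Fin 2 → ℝ) (ξ : Mat) (q : Fin 2 → ℝ) : ℝ := ∑ i, ∑ j, p i * ξ i j * q j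

/-- The integrand `f(x, ξ)`, meant for `x ≠ 0`. -/
def integrand (ν a : ℝ) (x : Plane) (ξ : Mat) : ℝ :=
  ν * (a * bil (eR (angle x)) ξ (eR (angle x)) ^ 2
    + bil (eR (angle x)) ξ (eT (angle x)) ^ 2
    + a * bil (eT (angle x)) ξ (eR (angle x)) ^ 2
    + bil (eT (angle x)) ξ (eT (angle x)) ^ 2)

/-- The fourth-order tensor `(p ⊗ q)(p ⊗ q)`. -/
def sqTensor (p q : Fin 2 → ℝ) (i j k l : Fin 2) : ℝ := (p i * q j) * (p k * q l)

/-- The coefficient tensor `M(x)`, meant for `x ≠ 0`. -/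
def coeff (a : ℝ) (x : Plane) (i j k l : Fin 2) : ℝ :=
  a * sqTensor (eR (angle x)) (eR (angle x)) i j k l
    + sqTensor (eR (angle x)) (eT (angle x)) i j k l
    + a * sqTensor (eT (angle x)) (eR (angle x)) i j k l
    + sqTensor (eT (angle x)) (eT (angle x)) i j k l

/-- The quadratic form `T ξ · ξ` of a fourth-order tensor. -/
def quadForm (T : Fin 2 → Fin 2 → Fin 2 → Fin 2 → ℝ) (ξ : Mat) : ℝ :=
  ∑ i, ∑ j, ∑ k, ∑ l, T i j k l * ξ i j * ξ k l

/-- The `N`-covering map `u_N(R, θ) = (R / √N) e_R(N θ)`. -/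
def coverMap (N : ℕ) (x : Plane) : Plane :=
  WithLp.toLp 2 ((‖x‖ / √(N : ℝ)) • eR (N * angle x))

/-- `ξ` is a multiple of an orthogonal matrix, that is, `ξᵀ ξ` is a multiple of the identity. -/
def IsConformal (ξ : Mat) : Prop := ∃ c : ℝ, ξ.transpose * ξ = c • (1 : Mat)

end NCover

end

open MeasureTheory Set Filter Topology
open scoped ENNReal ContDiff

noncomputable section

namespace NCover

/-! Minimality. Write an admissible map as $v=u_N+w$ with $w\in W^{1,2}_0$. The integrand is a
quadratic form in $\xi$, so $E(v)=E(u_N)+E(w)+\int\nabla_\xi f(x,\nabla u_N)\cdot\nabla w$. With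
$K=N-a/N$, the logarithmic pressure $\lambda=\nu K\ln R$ turns the last term into
$-2\int\lambda\,\mathrm{cof}\,\nabla u_N\cdot\nabla w$. Since $\det\nabla v=\det\nabla u_N=1$,
expanding the determinant gives $\mathrm{cof}\,\nabla u_N\cdot\nabla w=-\det\nabla w$. Hence
$E(v)-E(u_N)=E(w)+2\nu K\int\ln R\,\det\nabla w$.

The weighted determinant costs only angular energy. Integration by parts moves the derivative onto
the radial function $\ln R$ and leaves $-\int w_1R^{-1}\partial_\tau w_2$, where $\partial_\tau$ is
the derivative along $e_\theta$. Subtracting the mean of $w_1$ on each circle and using Wirtinger's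
inequality there yields $2|\int\ln R\,\det\nabla w|\le\int|\partial_\tau w|^2$
(`two_mul_abs_integral_log_mul_weakJac_le`). The excess is therefore at least
$\nu\int(a|\partial_Rw|^2+(1-|K|)|\partial_\tau w|^2)$, and $|K|<1$ is exactly the condition
$N^2-N<a<N^2+N$. So the excess controls $\int|\nabla w|^2$ (`energy_ge`), which gives minimality and
uniqueness together.

Pressures. In the frames $e_R(N\theta),e_\theta(N\theta)$ and $e_R,e_\theta$, the stationarity field
has two radial coefficients $A,B$, and its divergence vanishes when $A'+A/R=NB/R$; this fixes the
factor of $\ln R$. Two pressures differ by $m$ with $\operatorname{div}(m\,\mathrm{cof}\,\nabla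
u_N)=0$. Testing with $\varphi\,\partial_ku_N$ gives $\int m\,\partial_k\varphi=0$ because
$\det\nabla u_N$ is constant, so $m$ is constant (`pressure_sub_const`).

Coefficients. The entries of $M$ and the functions $f(\cdot,\xi)$ are of the form
$c+\alpha\cos^2\theta+\beta\cos\theta\sin\theta$. Such a function is constant on rays and its
gradient is homogeneous of degree $-1$, which lies in $L^q$ near the origin for $q<2$, and for $q=2$
only if it vanishes. -/

/-! ### Gradients in coordinates -/

/-- The linear form with coefficients `d`. -/
def gradForm (d : Fin 2 → ℝ) : Plane →L[ℝ] ℝ :=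
  d 0 • EuclideanSpace.proj 0 + d 1 • EuclideanSpace.proj 1

/-- `f` is differentiable at `x` with gradient `d`. -/
def HasGrad (f : Plane → ℝ) (d : Fin 2 → ℝ) (x : Plane) : Prop :=
  HasFDerivAt f (gradForm d) x

lemma gradForm_apply (d : Fin 2 → ℝ) (y : Plane) : gradForm d y = d 0 * y 0 + d 1 * y 1 := by
  simp [gradForm]

lemma gradForm_single (d : Fin 2 → ℝ) (j : Fin 2) :
    gradForm d (EuclideanSpace.single j 1) = d j := by
  fin_cases j <;> simp [gradForm_apply]

lemma hasGrad_of_hasFDerivAt {f : Plane → ℝ} {L : Plane →L[ℝ] ℝ} {x : Plane} {d : Fin 2 → ℝ}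
    (h : HasFDerivAt f L x) (hd : ∀ y, L y = gradForm d y) : HasGrad f d x := by
  have : L = gradForm d := ContinuousLinearMap.ext hd
  unfold HasGrad
  rwa [← this]

namespace HasGrad

variable {f g : Plane → ℝ} {d e : Fin 2 → ℝ} {x : Plane}

lemma congr_grad (h : HasGrad f d x) (hd : ∀ j, d j = e j) : HasGrad f e x := by
  rwa [← funext hd]

lemma partialDeriv_eq (h : HasGrad f d x) (j : Fin 2) : partialDeriv j f x = d j := by
  rw [partialDeriv, HasFDerivAt.fderiv h, gradForm_single]

lemma add (hf : HasGrad f d x) (hg : HasGrad g e x) :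
    HasGrad (fun y => f y + g y) (fun j => d j + e j) x :=
  hasGrad_of_hasFDerivAt (HasFDerivAt.add hf hg) fun y => by
    simp [gradForm_apply]; ring

lemma mul (hf : HasGrad f d x) (hg : HasGrad g e x) :
    HasGrad (fun y => f y * g y) (fun j => f x * e j + g x * d j) x :=
  hasGrad_of_hasFDerivAt (HasFDerivAt.mul hf hg) fun y => by
    simp [gradForm_apply]; ring

lemma const_mul (hf : HasGrad f d x) (c : ℝ) :
    HasGrad (fun y => c * f y) (fun j => c * d j) x :=
  hasGrad_of_hasFDerivAt (HasFDerivAt.const_mul hf c) fun y => by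
    simp [gradForm_apply]; ring

lemma neg (hf : HasGrad f d x) : HasGrad (fun y => -f y) (fun j => -d j) x :=
  hasGrad_of_hasFDerivAt (HasFDerivAt.neg hf) fun y => by
    simp [gradForm_apply]; ring

lemma comp {h : ℝ → ℝ} {h' : ℝ} (hf : HasGrad f d x) (hh : HasDerivAt h h' (f x)) :
    HasGrad (fun y => h (f y)) (fun j => h' * d j) x :=
  hasGrad_of_hasFDerivAt (hh.comp_hasFDerivAt x hf) fun y => by
    simp [gradForm_apply]; ring

end HasGrad

lemma hasGrad_const (c : ℝ) (x : Plane) : HasGrad (fun _ => c) (fun _ => 0) x :=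
  hasGrad_of_hasFDerivAt (hasFDerivAt_const c x) fun y => by simp [gradForm_apply]

lemma hasGrad_coord (k : Fin 2) (x : Plane) :
    HasGrad (fun y => y k) (fun j => if j = k then 1 else 0) x :=
  hasGrad_of_hasFDerivAt (EuclideanSpace.proj (𝕜 := ℝ) k).hasFDerivAt fun y => by
    fin_cases k <;> simp [gradForm_apply]

lemma hasGrad_norm {x : Plane} (hx : x ≠ 0) : HasGrad (fun y => ‖y‖) (fun j => x j / ‖x‖) x := by
  have h := (hasStrictFDerivAt_norm_sq x).hasFDerivAt.sqrt (by simpa using hx)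
  have h' : HasFDerivAt (fun y : Plane => ‖y‖) ((1 / (2 * √(‖x‖ ^ 2))) • (2 : ℕ) • innerSL ℝ x) x := by
    refine h.congr_of_eventuallyEq (Eventually.of_forall fun y => ?_)
    simp
  refine hasGrad_of_hasFDerivAt h' fun y => ?_
  have : ‖x‖ ≠ 0 := by simpa using hx
  simp [gradForm_apply, PiLp.inner_apply]
  field_simp

/-- A differentiable function has the gradient formed by its partial derivatives. -/
lemma hasGrad_partialDeriv {f : Plane → ℝ} {x : Plane} (h : DifferentiableAt ℝ f x) :
    HasGrad f (fun j => partialDeriv j f x) x :=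
  hasGrad_of_hasFDerivAt h.hasFDerivAt fun y => by
    have : y = y 0 • EuclideanSpace.single 0 (1 : ℝ) + y 1 • EuclideanSpace.single 1 (1 : ℝ) := by
      ext j; fin_cases j <;> simp
    rw [gradForm_apply]
    conv_lhs => rw [this]
    simp [partialDeriv, mul_comm]

lemma norm_sq_plane (x : Plane) : ‖x‖ ^ 2 = x 0 ^ 2 + x 1 ^ 2 := by
  simp [EuclideanSpace.norm_sq_eq]

lemma norm_complex_eq (x : Plane) : ‖(⟨x 0, x 1⟩ : ℂ)‖ = ‖x‖ := by
  rw [← sq_eq_sq₀ (norm_nonneg _) (norm_nonneg _), norm_sq_plane, Complex.sq_norm,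
    Complex.normSq_mk]
  ring

lemma abs_coord_le_norm (x : Plane) (j : Fin 2) : |x j| ≤ ‖x‖ := by
  simpa using PiLp.norm_apply_le x j

/-! ### The polar frame -/

/-- The angle itself jumps across the negative axis. All calculus below therefore goes through
$e_R=x/|x|$, which is smooth off the origin. -/
lemma eR_angle {x : Plane} (hx : x ≠ 0) (j : Fin 2) : eR (angle x) j = x j / ‖x‖ := by
  have h0 : (⟨x 0, x 1⟩ : ℂ) ≠ 0 := by
    intro h
    have := norm_complex_eq x
    rw [h] at this
    exact hx (by simpa using this.symm)
  fin_cases j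
  · simp [eR, angle, Complex.cos_arg h0, norm_complex_eq]
  · simp [eR, angle, Complex.sin_arg, norm_complex_eq]

lemma eR_sq (t : ℝ) : eR t 0 ^ 2 + eR t 1 ^ 2 = 1 := by simp [eR]

lemma eT_zero (t : ℝ) : eT t 0 = -eR t 1 := by simp [eT, eR]

lemma eT_one (t : ℝ) : eT t 1 = eR t 0 := by simp [eT, eR]

lemma abs_eR_le (t : ℝ) (j : Fin 2) : |eR t j| ≤ 1 := by
  fin_cases j
  · simpa [eR] using Real.abs_cos_le_one t
  · simpa [eR] using Real.abs_sin_le_one t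

lemma abs_eT_le (t : ℝ) (j : Fin 2) : |eT t j| ≤ 1 := by
  fin_cases j
  · simpa [eT] using Real.abs_sin_le_one t
  · simpa [eT] using Real.abs_cos_le_one t

/-- Both sides vanish at the origin, so the identity needs no exception there. -/
lemma norm_smul_eR_angle (x : Plane) (j : Fin 2) : ‖x‖ * eR (angle x) j = x j := by
  by_cases hx : x = 0
  · simp [hx]
  · rw [eR_angle hx]
    have : ‖x‖ ≠ 0 := by simpa using hx
    field_simp

lemma hasGrad_eR_angle {x : Plane} (hx : x ≠ 0) (k : Fin 2) :
    HasGrad (fun y => eR (angle y) k) (fun j => eT (angle x) k * eT (angle x) j / ‖x‖) x := by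
  have hn : ‖x‖ ≠ 0 := by simpa using hx
  have h1 : HasGrad (fun y => y k * ‖y‖⁻¹)
      (fun j => x k * (-(‖x‖ ^ 2)⁻¹ * (x j / ‖x‖)) + ‖x‖⁻¹ * (if j = k then 1 else 0)) x :=
    (hasGrad_coord k x).mul ((hasGrad_norm hx).comp (hasDerivAt_inv hn))
  have h2 : HasGrad (fun y => eR (angle y) k)
      (fun j => x k * (-(‖x‖ ^ 2)⁻¹ * (x j / ‖x‖)) + ‖x‖⁻¹ * (if j = k then 1 else 0)) x := by
    refine HasFDerivAt.congr_of_eventuallyEq h1 ?_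
    filter_upwards [isOpen_ne.mem_nhds hx] with y hy
    rw [eR_angle hy, div_eq_mul_inv]
  refine h2.congr_grad fun j => ?_
  have hs := norm_sq_plane x
  fin_cases k <;> fin_cases j <;>
    simp [eT_zero, eT_one, eR_angle hx] <;> field_simp <;> linarith

lemma eR_add_one (n : ℕ) (t : ℝ) (k : Fin 2) :
    eR ((n + 1 : ℕ) * t) k = eR (n * t) k * eR t 0 + eT (n * t) k * eR t 1 := by
  have : ((n + 1 : ℕ) : ℝ) * t = n * t + t := by push_cast; ring
  rw [this]
  fin_cases k
  · simp [eR, eT, Real.cos_add]; ring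
  · simp [eR, eT, Real.sin_add]

lemma eT_add_one (n : ℕ) (t : ℝ) (k : Fin 2) :
    eT ((n + 1 : ℕ) * t) k = eT (n * t) k * eR t 0 - eR (n * t) k * eR t 1 := by
  have : ((n + 1 : ℕ) : ℝ) * t = n * t + t := by push_cast; ring
  rw [this]
  fin_cases k
  · simp [eR, eT, Real.sin_add]; ring
  · simp [eR, eT, Real.cos_add]

/-- Induction on $n$ by the addition formulas keeps the branch cut of the angle out of sight: each
step multiplies by $e_R(\theta)$, which is differentiable off the origin. -/
lemma hasGrad_eR_eT_mul_angle {x : Plane} (hx : x ≠ 0) (n : ℕ) :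
    (∀ k, HasGrad (fun y => eR (n * angle y) k)
      (fun j => n * eT (n * angle x) k * eT (angle x) j / ‖x‖) x) ∧
    ∀ k, HasGrad (fun y => eT (n * angle y) k)
      (fun j => -(n * eR (n * angle x) k * eT (angle x) j / ‖x‖)) x := by
  have hn : ‖x‖ ≠ 0 := by simpa using hx
  induction n with
  | zero =>
    constructor <;> intro k
    · simpa using hasGrad_const (eR 0 k) x
    · simpa using hasGrad_const (eT 0 k) x
  | succ n ih =>
    constructor <;> intro k
    · simp only [eR_add_one]
      refine (((ih.1 k).mul (hasGrad_eR_angle hx 0)).add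
        ((ih.2 k).mul (hasGrad_eR_angle hx 1))).congr_grad fun j => ?_
      rw [eT_add_one, eT_zero, eT_one]
      push_cast
      field_simp
      ring
    · simp only [eT_add_one, sub_eq_add_neg]
      refine (((ih.2 k).mul (hasGrad_eR_angle hx 0)).add
        ((ih.1 k).mul (hasGrad_eR_angle hx 1)).neg).congr_grad fun j => ?_
      rw [eR_add_one, eT_zero, eT_one]
      push_cast
      field_simp
      ring

lemma hasGrad_eT_angle {x : Plane} (hx : x ≠ 0) (k : Fin 2) :
    HasGrad (fun y => eT (angle y) k) (fun j => -(eR (angle x) k * eT (angle x) j / ‖x‖)) x := by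
  simpa using (hasGrad_eR_eT_mul_angle hx 1).2 k

lemma contDiffAt_eR_angle {x : Plane} (hx : x ≠ 0) (k : Fin 2) :
    ContDiffAt ℝ ∞ (fun y => eR (angle y) k) x := by
  have h1 : ContDiffAt ℝ ∞ (fun y : Plane => y k / ‖y‖) x :=
    (EuclideanSpace.proj (𝕜 := ℝ) k).contDiff.contDiffAt.div (contDiffAt_norm ℝ hx) (by simpa using hx)
  refine h1.congr_of_eventuallyEq ?_
  filter_upwards [isOpen_ne.mem_nhds hx] with y hy
  rw [eR_angle hy]

lemma contDiffAt_eR_eT_mul_angle {x : Plane} (hx : x ≠ 0) (n : ℕ) :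
    (∀ k, ContDiffAt ℝ ∞ (fun y => eR (n * angle y) k) x) ∧
    ∀ k, ContDiffAt ℝ ∞ (fun y => eT (n * angle y) k) x := by
  induction n with
  | zero => constructor <;> intro k <;> simpa using contDiffAt_const
  | succ n ih =>
    constructor <;> intro k
    · simp only [eR_add_one]
      exact ((ih.1 k).mul (contDiffAt_eR_angle hx 0)).add
        ((ih.2 k).mul (contDiffAt_eR_angle hx 1))
    · simp only [eT_add_one]
      exact ((ih.2 k).mul (contDiffAt_eR_angle hx 0)).sub
        ((ih.1 k).mul (contDiffAt_eR_angle hx 1))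

lemma contDiffAt_eT_angle {x : Plane} (hx : x ≠ 0) (k : Fin 2) :
    ContDiffAt ℝ ∞ (fun y => eT (angle y) k) x := by
  simpa using (contDiffAt_eR_eT_mul_angle hx 1).2 k

@[fun_prop]
lemma measurable_angle : Measurable angle := by
  have : angle = fun x : Plane => Complex.arg ((x 0 : ℂ) + (x 1 : ℂ) * Complex.I) := by
    funext x
    rw [angle, ← Complex.mk_eq_add_mul_I]
  rw [this]
  fun_prop

@[fun_prop]
lemma measurable_eR {α : Type*} [MeasurableSpace α] {f : α → ℝ} (hf : Measurable f) (k : Fin 2) :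
    Measurable fun t => eR (f t) k := by
  fin_cases k <;> simp [eR] <;> fun_prop

@[fun_prop]
lemma measurable_eT {α : Type*} [MeasurableSpace α] {f : α → ℝ} (hf : Measurable f) (k : Fin 2) :
    Measurable fun t => eT (f t) k := by
  fin_cases k <;> simp [eT] <;> fun_prop

/-! ### The gradient of the covering map -/

/-- The classical gradient of `u_N` off the origin. -/
def coverGrad (N : ℕ) (x : Plane) : Mat :=
  Matrix.of fun i j => (eR (N * angle x) i * eR (angle x) j
    + N * (eT (N * angle x) i * eT (angle x) j)) / √N

lemma coverGrad_apply (N : ℕ) (x : Plane) (i j : Fin 2) :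
    coverGrad N x i j = (eR (N * angle x) i * eR (angle x) j
      + N * (eT (N * angle x) i * eT (angle x) j)) / √N := rfl

lemma coverMap_apply (N : ℕ) (x : Plane) (i : Fin 2) :
    coverMap N x i = ‖x‖ / √N * eR (N * angle x) i := by
  simp [coverMap]

lemma hasGrad_coverMap (N : ℕ) {x : Plane} (hx : x ≠ 0) (i : Fin 2) :
    HasGrad (fun y => coverMap N y i) (coverGrad N x i) x := by
  have hn : ‖x‖ ≠ 0 := by simpa using hx
  have h := ((hasGrad_norm hx).mul ((hasGrad_eR_eT_mul_angle hx N).1 i)).const_mul (1 / √(N : ℝ))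
  have h2 : (fun y => coverMap N y i) = fun y => 1 / √(N : ℝ) * (‖y‖ * eR (N * angle y) i) := by
    funext y
    rw [coverMap_apply]; ring
  rw [h2]
  refine h.congr_grad fun j => ?_
  rw [coverGrad_apply, eR_angle hx]
  field_simp
  ring

lemma abs_coverGrad_le (N : ℕ) (x : Plane) (i j : Fin 2) :
    |coverGrad N x i j| ≤ (1 + N) / √N := by
  rw [coverGrad_apply, abs_div, abs_of_nonneg (Real.sqrt_nonneg _)]
  gcongr
  refine (abs_add_le _ _).trans ?_
  rw [abs_mul, abs_mul, abs_mul, Nat.abs_cast]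
  have h1 := abs_eR_le (N * angle x) i
  have h2 := abs_eR_le (angle x) j
  have h3 := abs_eT_le (N * angle x) i
  have h4 := abs_eT_le (angle x) j
  have h5 := mul_le_one₀ h1 (abs_nonneg _) h2
  have h6 := mul_le_one₀ h3 (abs_nonneg _) h4
  have : (N : ℝ) * (|eT (N * angle x) i| * |eT (angle x) j|) ≤ N * 1 := by gcongr
  linarith

@[fun_prop]
lemma measurable_coverGrad (N : ℕ) (i j : Fin 2) : Measurable fun x => coverGrad N x i j := by
  simp only [coverGrad_apply]
  fun_prop

lemma det_coverGrad {N : ℕ} (hN : N ≠ 0) (x : Plane) : (coverGrad N x).det = 1 := by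
  have h0 : (N : ℝ) ≠ 0 := by exact_mod_cast hN
  have key : ∀ p q c s : ℝ, p ^ 2 + q ^ 2 = 1 → c ^ 2 + s ^ 2 = 1 →
      (p * c + N * (-q * -s)) * (q * s + N * (p * c))
        - (p * s + N * (-q * c)) * (q * c + N * (p * -s)) = N := by
    intro p q c s e1 e2
    linear_combination (N : ℝ) * (c ^ 2 + s ^ 2) * e1 + (N : ℝ) * e2
  rw [Matrix.det_fin_two]
  simp only [coverGrad_apply, eT_zero, eT_one]
  rw [div_mul_div_comm, div_mul_div_comm, ← sub_div, Real.mul_self_sqrt (Nat.cast_nonneg N),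
    div_eq_one_iff_eq h0]
  exact key _ _ _ _ (eR_sq _) (eR_sq _)

lemma cof_coverGrad (N : ℕ) (x : Plane) (i j : Fin 2) :
    cof (coverGrad N x) i j = (N * (eR (N * angle x) i * eR (angle x) j)
      + eT (N * angle x) i * eT (angle x) j) / √N := by
  fin_cases i <;> fin_cases j <;> simp [cof, coverGrad_apply, eT_zero, eT_one] <;> ring

/-! ### The integrand -/

/-- The row vectors enter only through an orthonormal basis, so the four squares combine into $a|\xi
e_R|^2+|\xi e_\theta|^2$, which is $(a-1)|\xi e_R|^2+|\xi|^2$. -/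
lemma integrand_eq (ν a : ℝ) (x : Plane) (ξ : Mat) :
    integrand ν a x ξ = ν * ((a - 1) * ((ξ 0 0 * eR (angle x) 0 + ξ 0 1 * eR (angle x) 1) ^ 2
      + (ξ 1 0 * eR (angle x) 0 + ξ 1 1 * eR (angle x) 1) ^ 2) + frob ξ ξ) := by
  have e := eR_sq (angle x)
  set c := eR (angle x) 0
  set s := eR (angle x) 1
  simp only [integrand, bil, frob, Fin.sum_univ_two, eT_zero, eT_one]
  have h1 : ∀ p q r t : ℝ, (c * p * c + c * q * s + (s * r * c + s * t * s)) ^ 2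
      + (-s * p * c + -s * q * s + (c * r * c + c * t * s)) ^ 2
      = (c ^ 2 + s ^ 2) * ((p * c + q * s) ^ 2 + (r * c + t * s) ^ 2) := by intros; ring
  have h2 : ∀ p q r t : ℝ, (c * p * -s + c * q * c + (s * r * -s + s * t * c)) ^ 2
      + (-s * p * -s + -s * q * c + (c * r * -s + c * t * c)) ^ 2
      = (c ^ 2 + s ^ 2) * ((c ^ 2 + s ^ 2) * (p ^ 2 + q ^ 2 + r ^ 2 + t ^ 2)
        - ((p * c + q * s) ^ 2 + (r * c + t * s) ^ 2)) := by intros; ring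
  have h1' := h1 (ξ 0 0) (ξ 0 1) (ξ 1 0) (ξ 1 1)
  have h2' := h2 (ξ 0 0) (ξ 0 1) (ξ 1 0) (ξ 1 1)
  rw [e] at h1' h2'
  linear_combination ν * a * h1' + ν * h2'

lemma frame_complete (t : ℝ) (i k : Fin 2) :
    eR t i * eR t k + eT t i * eT t k = if i = k then 1 else 0 := by
  have e := eR_sq t
  fin_cases i <;> fin_cases k <;> simp [eT_zero, eT_one] <;> linarith

lemma coeff_eq (a : ℝ) (x : Plane) (i j k l : Fin 2) :
    coeff a x i j k l = (if i = k then 1 else 0) *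
      ((if j = l then 1 else 0) + (a - 1) * (eR (angle x) j * eR (angle x) l)) := by
  rw [← frame_complete (angle x) i k, ← frame_complete (angle x) j l]
  simp only [coeff, sqTensor]
  ring

lemma gradXi_integrand (ν a : ℝ) (x : Plane) (ξ : Mat) (i j : Fin 2) :
    gradXi (integrand ν a) x ξ i j = 2 * ν * ((a - 1) *
      ((ξ i 0 * eR (angle x) 0 + ξ i 1 * eR (angle x) 1) * eR (angle x) j) + ξ i j) := by
  -- Along a coordinate direction the integrand is a quadratic polynomial in the increment, and its
  -- derivative at 0 is the linear coefficient.
  have key : ∀ b0 b1 b2 : ℝ, HasDerivAt (fun t : ℝ => b0 + b1 * t + b2 * t ^ 2) b1 0 := by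
    intro b0 b1 b2
    have h := (((hasDerivAt_id (0 : ℝ)).const_mul b1).const_add b0).add
      (((hasDerivAt_id (0 : ℝ)).pow 2).const_mul b2)
    convert! h using 1
    simp
  have e : ∀ w : ℝ, eR (angle x) j = w → gradXi (integrand ν a) x ξ i j =
      2 * ν * ((a - 1) * ((ξ i 0 * eR (angle x) 0 + ξ i 1 * eR (angle x) 1) * w) + ξ i j) := by
    intro w hw
    rw [gradXi, Matrix.of_apply]
    refine HasDerivAt.deriv (f := fun t : ℝ => integrand ν a x (ξ + t • Matrix.single i j 1)) ?_
    convert! key (integrand ν a x ξ) _ (ν * ((a - 1) * w ^ 2 + 1)) using 1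
    funext t
    rw [integrand_eq, integrand_eq, ← hw]
    fin_cases i <;> fin_cases j <;> simp [frob, Fin.sum_univ_two, Matrix.single] <;> ring
  exact e _ rfl

/-! ### Test functions -/

lemma measurableSet_disk : MeasurableSet disk := measurableSet_ball

lemma isOpen_disk : IsOpen disk := Metric.isOpen_ball

instance : IsFiniteMeasure diskMeasure := by
  refine ⟨?_⟩
  rw [diskMeasure, Measure.restrict_apply_univ]
  exact Metric.isBounded_ball.measure_lt_top

lemma ae_diskMeasure_mem : ∀ᵐ x ∂diskMeasure, x ∈ disk := ae_restrict_mem measurableSet_disk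

lemma ae_diskMeasure_ne_zero : ∀ᵐ x ∂diskMeasure, x ≠ 0 :=
  ae_restrict_of_ae (Measure.ae_ne volume 0)

lemma norm_lt_one_of_mem_disk {x : Plane} (hx : x ∈ disk) : ‖x‖ < 1 := by
  simpa [disk] using hx

/-- An integrable function on an open set, multiplied by a continuous function with compact support
inside that set. -/
lemma integrable_mul_of_tsupport_subset {U : Set Plane} {w ψ : Plane → ℝ}
    (hw : LocallyIntegrableOn w U) (hψ : Continuous ψ) (hc : HasCompactSupport ψ)
    (hU : tsupport ψ ⊆ U) : Integrable (fun x => w x * ψ x) := by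
  have h1 : IntegrableOn w (tsupport ψ) := hw.integrableOn_compact_subset hU hc
  have h2 : IntegrableOn (fun x => w x * ψ x) (tsupport ψ) := by
    obtain ⟨C, hC⟩ := hψ.bounded_above_of_compact_support hc
    exact h1.mul_bdd (c := C) hψ.aestronglyMeasurable (Eventually.of_forall hC)
  refine h2.integrable_of_forall_notMem_eq_zero fun x hx => ?_
  rw [image_eq_zero_of_notMem_tsupport hx, mul_zero]

lemma setIntegral_disk_eq {f : Plane → ℝ} (h : ∀ x, x ∉ disk → f x = 0) :
    ∫ x in disk, f x = ∫ x, f x :=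
  setIntegral_eq_integral_of_forall_compl_eq_zero h

namespace IsTest

variable {φ ψ : Plane → ℝ}

lemma eq_zero (h : IsTest φ) {x : Plane} (hx : x ∉ disk) : φ x = 0 :=
  image_eq_zero_of_notMem_tsupport fun hx' => hx (h.2.2 hx')

lemma differentiable (h : IsTest φ) : Differentiable ℝ φ := h.1.differentiable (by simp)

lemma hasGrad (h : IsTest φ) (x : Plane) : HasGrad φ (fun j => partialDeriv j φ x) x :=
  hasGrad_partialDeriv (h.differentiable x)

lemma tsupport_partialDeriv_subset (j : Fin 2) (φ : Plane → ℝ) :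
    tsupport (partialDeriv j φ) ⊆ tsupport φ :=
  tsupport_fderiv_apply_subset ℝ _

lemma partialDeriv (h : IsTest φ) (j : Fin 2) : IsTest (partialDeriv j φ) := by
  refine ⟨?_, ?_, (tsupport_partialDeriv_subset j φ).trans h.2.2⟩
  · exact (h.1.fderiv_right (m := ∞) (by simp)).clm_apply contDiff_const
  · exact h.2.1.mono' (subset_closure.trans (tsupport_partialDeriv_subset j φ))

lemma mul_left (h : IsTest φ) (hψ : ContDiff ℝ ∞ ψ) : IsTest (fun x => φ x * ψ x) :=
  ⟨h.1.mul hψ, h.2.1.mul_right, (tsupport_mul_subset_left).trans h.2.2⟩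

lemma integrable_mul {w : Plane → ℝ} (h : IsTest φ) (hw : LocallyIntegrableOn w disk) :
    Integrable (fun x => w x * φ x) :=
  integrable_mul_of_tsupport_subset hw h.1.continuous h.2.1 h.2.2

lemma setIntegral_mul (h : IsTest φ) (w : Plane → ℝ) :
    ∫ x in disk, w x * φ x = ∫ x, w x * φ x :=
  setIntegral_disk_eq fun x hx => by rw [h.eq_zero hx, mul_zero]

lemma memLp (h : IsTest φ) (p : ℝ≥0∞) : MemLp φ p diskMeasure :=
  (h.1.continuous.memLp_of_hasCompactSupport h.2.1).restrict _

lemma bounded (h : IsTest φ) : ∃ C, ∀ x, |φ x| ≤ C :=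
  h.1.continuous.bounded_above_of_compact_support h.2.1

end IsTest

/-! ### Weak derivatives of functions that are smooth off the origin -/

/-- If `g` and its partial derivative off the origin are integrable, then the latter has integral
zero. -/
lemma integral_partial_eq_zero (j : Fin 2) {g g' : Plane → ℝ} (hg : Integrable g)
    (hg' : Integrable g')
    (h : ∀ x ≠ 0, HasLineDerivAt ℝ g (g' x) x (EuclideanSpace.single j 1)) :
    ∫ x, g' x = 0 := by
  let e : ℝ × (Fin 1 → ℝ) ≃ᵐ Plane :=
    (MeasurableEquiv.piFinSuccAbove (fun _ => ℝ) j).symm.trans (MeasurableEquiv.toLp 2 _)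
  -- Fubini along lines parallel to the $j$-th axis: `e` separates coordinate $j$ from the remaining
  -- one.
  have he : MeasurePreserving e :=
    (PiLp.volume_preserving_toLp (Fin 2)).comp
      (volume_preserving_piFinSuccAbove (fun _ : Fin 2 => ℝ) j).symm
  have hes : ∀ t y, e (t, y) = WithLp.toLp 2 (j.insertNth t y) := fun t y => rfl
  have hadd : ∀ t s y, e (t, y) + s • EuclideanSpace.single j (1 : ℝ) = e (t + s, y) := by
    intro t s y
    ext i
    rw [hes, hes]
    refine j.succAboveCases ?_ (fun k => ?_) i <;> simp
  have hi : Integrable (fun p => g (e p)) := (he.integrable_comp_emb e.measurableEmbedding).2 hg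
  have hi' : Integrable (fun p => g' (e p)) := (he.integrable_comp_emb e.measurableEmbedding).2 hg'
  rw [← he.integral_comp e.measurableEmbedding, Measure.volume_eq_prod, integral_prod_symm _ hi']
  refine integral_eq_zero_of_ae ?_
  -- Only the line with remaining coordinate 0 meets the origin; on almost every other line the
  -- derivative exists everywhere and both functions are integrable.
  filter_upwards [hi.prod_left_ae, hi'.prod_left_ae, Measure.ae_ne volume (0 : Fin 1 → ℝ)]
    with y h1 h2 hy
  refine integral_eq_zero_of_hasDerivAt_of_integrable (f := fun t => g (e (t, y)))
    (fun t => ?_) h2 h1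
  have hne : e (t, y) ≠ 0 := by
    intro h0
    apply hy
    ext k
    have := congrArg (fun z : Plane => z (j.succAbove k)) h0
    rw [hes] at this
    simpa using this
  have h3 := h _ hne
  rw [HasLineDerivAt] at h3
  have h4 : HasDerivAt (fun s => g (e (t + s, y))) (g' (e (t, y))) (t - t) := by
    rw [sub_self]
    refine h3.congr_of_eventuallyEq (Eventually.of_forall fun s => ?_)
    simp only [hadd]
  simpa using h4.comp_sub_const t t

lemma HasGrad.hasLineDerivAt {f : Plane → ℝ} {d : Fin 2 → ℝ} {x : Plane} (h : HasGrad f d x)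
    (j : Fin 2) : HasLineDerivAt ℝ f (d j) x (EuclideanSpace.single j 1) := by
  have := HasFDerivAt.hasLineDerivAt h (EuclideanSpace.single j 1)
  rwa [gradForm_single] at this

/-- The product with a test function has an integrable classical derivative off the origin, whose
integral is zero. An isolated singularity at the origin creates no distribution there. -/
lemma isWeakPartial_of_hasGrad {w : Plane → ℝ} {d : Plane → Fin 2 → ℝ} (j : Fin 2)
    (h : ∀ x ≠ 0, HasGrad w (d x) x) (hw : LocallyIntegrableOn w disk)
    (hd : LocallyIntegrableOn (fun x => d x j) disk) : IsWeakPartial j w (fun x => d x j) := by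
  refine ⟨hw, hd, fun φ hφ => ?_⟩
  have i1 := (hφ.partialDeriv j).integrable_mul hw
  have i2 := hφ.integrable_mul hd
  have i3 := hφ.integrable_mul hw
  rw [hφ.setIntegral_mul, (hφ.partialDeriv j).setIntegral_mul, eq_neg_iff_add_eq_zero,
    ← integral_add i1 i2]
  refine integral_partial_eq_zero j i3 (i1.add i2) fun x hx => ?_
  have := ((h x hx).mul (hφ.hasGrad x)).hasLineDerivAt j
  convert this using 1
  ring

/-! ### Calculus of weak derivatives -/

namespace IsWeakPartial

variable {j : Fin 2} {w w' v v' : Plane → ℝ}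

lemma unique (h : IsWeakPartial j w v) (h' : IsWeakPartial j w v') : v =ᵐ[diskMeasure] v' := by
  have hs : LocallyIntegrableOn (fun x => v x - v' x) disk := h.2.1.sub h'.2.1
  have := isOpen_disk.ae_eq_zero_of_integral_contDiff_smul_eq_zero hs fun φ h1 h2 h3 => ?_
  · rw [EventuallyEq, diskMeasure, ae_restrict_iff' measurableSet_disk]
    filter_upwards [this] with x hx hx'
    exact sub_eq_zero.1 (hx hx')
  · have hφ : IsTest φ := ⟨h1, h2, h3⟩
    have e1 := h.2.2 φ hφ
    have e2 := h'.2.2 φ hφ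
    rw [hφ.setIntegral_mul] at e1 e2
    have : ∀ x, φ x • (v x - v' x) = v x * φ x - v' x * φ x := fun x => by
      simp only [smul_eq_mul]; ring
    simp only [this]
    rw [integral_sub (hφ.integrable_mul h.2.1) (hφ.integrable_mul h'.2.1)]
    linarith

lemma congr_ae (h : IsWeakPartial j w v) (hw : w =ᵐ[diskMeasure] w') (hv : v =ᵐ[diskMeasure] v') :
    IsWeakPartial j w' v' := by
  have aux : ∀ {f f' : Plane → ℝ}, LocallyIntegrableOn f disk → f =ᵐ[diskMeasure] f' →
      LocallyIntegrableOn f' disk := by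
    intro f f' hf hff' x hx
    obtain ⟨U, hU, hi⟩ := hf x hx
    refine ⟨U ∩ disk, inter_mem hU self_mem_nhdsWithin, ?_⟩
    refine (hi.mono_set inter_subset_left).congr_fun_ae ?_
    exact ae_restrict_of_ae_restrict_of_subset inter_subset_right hff'
  refine ⟨aux h.1 hw, aux h.2.1 hv, fun φ hφ => ?_⟩
  have e := h.2.2 φ hφ
  have e1 : ∫ x in disk, w x * NCover.partialDeriv j φ x
      = ∫ x in disk, w' x * NCover.partialDeriv j φ x :=
    integral_congr_ae (by filter_upwards [hw] with x hx; rw [hx])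
  have e2 : ∫ x in disk, v x * φ x = ∫ x in disk, v' x * φ x :=
    integral_congr_ae (by filter_upwards [hv] with x hx; rw [hx])
  rw [← e1, ← e2, e]

lemma add (h : IsWeakPartial j w v) (h' : IsWeakPartial j w' v') :
    IsWeakPartial j (fun x => w x + w' x) (fun x => v x + v' x) := by
  refine ⟨h.1.add h'.1, h.2.1.add h'.2.1, fun φ hφ => ?_⟩
  have hφ' := hφ.partialDeriv j
  have e1 := h.2.2 φ hφ
  have e2 := h'.2.2 φ hφ
  simp only [hφ.setIntegral_mul, hφ'.setIntegral_mul] at e1 e2 ⊢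
  simp only [add_mul]
  rw [integral_add (hφ.integrable_mul h.2.1) (hφ.integrable_mul h'.2.1),
    integral_add (hφ'.integrable_mul h.1) (hφ'.integrable_mul h'.1), e1, e2]
  ring

lemma const_mul (h : IsWeakPartial j w v) (c : ℝ) :
    IsWeakPartial j (fun x => c * w x) (fun x => c * v x) := by
  refine ⟨h.1.smul c, h.2.1.smul c, fun φ hφ => ?_⟩
  have e1 := h.2.2 φ hφ
  simp only [mul_assoc, integral_const_mul, e1]
  ring

lemma sub (h : IsWeakPartial j w v) (h' : IsWeakPartial j w' v') :
    IsWeakPartial j (fun x => w x - w' x) (fun x => v x - v' x) := by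
  have := h.add (h'.const_mul (-1))
  simpa [sub_eq_add_neg] using this

lemma weakPartial_ae_eq (h : IsWeakPartial j w v) : weakPartial j w =ᵐ[diskMeasure] v := by
  have hex : ∃ v, IsWeakPartial j w v := ⟨v, h⟩
  rw [weakPartial, dif_pos hex]
  exact hex.choose_spec.unique h

end IsWeakPartial

lemma MemLp.locallyIntegrableOn_disk {w : Plane → ℝ} {p : ℝ≥0∞} (hp : 1 ≤ p)
    (h : MemLp w p diskMeasure) : LocallyIntegrableOn w disk :=
  IntegrableOn.locallyIntegrableOn (h.integrable hp)

namespace MemSobolev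

variable {p : ℝ≥0∞} {w w' : Plane → ℝ}

lemma isWeakPartial (h : MemSobolev p w) (j : Fin 2) :
    IsWeakPartial j w (weakPartial j w) := by
  obtain ⟨v, hv, -⟩ := h.2 j
  exact hv.congr_ae ae_eq_rfl hv.weakPartial_ae_eq.symm

lemma memLp_weakPartial (h : MemSobolev p w) (j : Fin 2) :
    MemLp (weakPartial j w) p diskMeasure := by
  obtain ⟨v, hv, hv'⟩ := h.2 j
  exact hv'.ae_eq hv.weakPartial_ae_eq.symm

lemma congr_ae (h : MemSobolev p w) (hw : w =ᵐ[diskMeasure] w') : MemSobolev p w' := by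
  refine ⟨h.1.ae_eq hw, fun j => ?_⟩
  obtain ⟨v, hv, hv'⟩ := h.2 j
  exact ⟨v, hv.congr_ae hw ae_eq_rfl, hv'⟩

lemma add (h : MemSobolev p w) (h' : MemSobolev p w') : MemSobolev p (fun x => w x + w' x) :=
  ⟨h.1.add h'.1, fun j => ⟨_, (h.isWeakPartial j).add (h'.isWeakPartial j),
    (h.memLp_weakPartial j).add (h'.memLp_weakPartial j)⟩⟩

lemma const_mul (h : MemSobolev p w) (c : ℝ) : MemSobolev p (fun x => c * w x) :=
  ⟨h.1.const_mul c, fun j => ⟨_, (h.isWeakPartial j).const_mul c,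
    (h.memLp_weakPartial j).const_mul c⟩⟩

lemma sub (h : MemSobolev p w) (h' : MemSobolev p w') : MemSobolev p (fun x => w x - w' x) := by
  have := h.add (h'.const_mul (-1))
  simpa [sub_eq_add_neg] using this

end MemSobolev

lemma memSobolev_of_hasGrad {w : Plane → ℝ} {d : Plane → Fin 2 → ℝ} {p : ℝ≥0∞} (hp : 1 ≤ p)
    (h : ∀ x ≠ 0, HasGrad w (d x) x) (hw : MemLp w p diskMeasure)
    (hd : ∀ j, MemLp (fun x => d x j) p diskMeasure) : MemSobolev p w :=
  ⟨hw, fun j => ⟨_, isWeakPartial_of_hasGrad j h (MemLp.locallyIntegrableOn_disk hp hw)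
    (MemLp.locallyIntegrableOn_disk hp (hd j)), hd j⟩⟩

/-! ### Powers of the radius -/

/-- In polar coordinates this is the convergence of $\int_0^1r^{1-sq}\,dr$. -/
lemma memLp_norm_rpow {s : ℝ} {q : ℝ≥0∞} (hq0 : q ≠ 0) (hq : q ≠ ⊤) (hs : s * q.toReal < 2) :
    MemLp (fun x : Plane => ‖x‖ ^ (-s)) q diskMeasure := by
  have hm : Measurable (fun x : Plane => ‖x‖ ^ (-s)) := measurable_norm.pow_const _
  rw [← integrable_norm_rpow_iff hm.aestronglyMeasurable hq0 hq]
  have h1 : IntegrableOn (fun x : Plane => (fun r : ℝ => r ^ (-s * q.toReal)) ‖x‖)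
      (Metric.ball 0 1) := by
    refine (integrableOn_fun_norm_addHaar volume (f := fun r : ℝ => r ^ (-s * q.toReal))).2 ?_
    have h2 : IntegrableOn (fun y : ℝ => y ^ (1 - s * q.toReal)) (Ioo 0 1) :=
      (intervalIntegral.integrableOn_Ioo_rpow_iff one_pos).2 (by linarith)
    refine h2.congr_fun (fun y hy => ?_) measurableSet_Ioo
    have h0 : (0 : ℝ) < y := hy.1
    simp only [finrank_euclideanSpace, Fintype.card_fin, smul_eq_mul]
    rw [Real.rpow_sub h0, Real.rpow_one, neg_mul, Real.rpow_neg h0.le]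
    simp [div_eq_mul_inv]
  refine Integrable.congr h1 (Eventually.of_forall fun x => ?_)
  simp only [Real.norm_eq_abs, abs_of_nonneg (Real.rpow_nonneg (norm_nonneg x) _)]
  rw [← Real.rpow_mul (norm_nonneg x)]

lemma memLp_of_bounded {f : Plane → ℝ} {q : ℝ≥0∞} (hf : Measurable f) {C : ℝ}
    (h : ∀ x, |f x| ≤ C) : MemLp f q diskMeasure :=
  MemLp.of_bound hf.aestronglyMeasurable C (Eventually.of_forall h)

lemma memLp_of_le_norm_rpow {f : Plane → ℝ} {s : ℝ} {q : ℝ≥0∞} (hq0 : q ≠ 0) (hq : q ≠ ⊤)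
    (hs : s * q.toReal < 2) (hf : Measurable f) {C : ℝ}
    (h : ∀ x ∈ disk, x ≠ 0 → |f x| ≤ C * ‖x‖ ^ (-s)) : MemLp f q diskMeasure := by
  refine ((memLp_norm_rpow hq0 hq hs).const_mul C).mono' hf.aestronglyMeasurable ?_
  filter_upwards [ae_diskMeasure_mem, ae_diskMeasure_ne_zero] with x hx hx0
  exact h x hx hx0

/-- The exponent $1/2$ is small enough that $\ln R$ lies in $L^2$ and $R^{-1}\ln R$ in $L^1$. -/
lemma abs_log_norm_le {x : Plane} (hx : x ∈ disk) (hx0 : x ≠ 0) :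
    |Real.log ‖x‖| ≤ 2 * ‖x‖ ^ (-(1 / 2 : ℝ)) := by
  have h0 : 0 < ‖x‖ := by simpa using hx0
  have h1 : ‖x‖ ≤ 1 := (norm_lt_one_of_mem_disk hx).le
  have h := Real.abs_log_mul_self_rpow_lt ‖x‖ (1 / 2) h0 h1 (by norm_num)
  rw [abs_mul, abs_of_nonneg (Real.rpow_nonneg h0.le _)] at h
  rw [Real.rpow_neg h0.le, ← div_eq_mul_inv, le_div_iff₀ (Real.rpow_pos_of_pos h0 _)]
  norm_num at h ⊢
  exact h.le

lemma memLp_log_norm {q : ℝ≥0∞} (hq : q ≤ 2) :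
    MemLp (fun x : Plane => Real.log ‖x‖) q diskMeasure := by
  have h2 : MemLp (fun x : Plane => Real.log ‖x‖) 2 diskMeasure :=
    memLp_of_le_norm_rpow (s := 1 / 2) (by simp) (by simp) (by norm_num)
      (measurable_norm.log) fun x hx hx0 => abs_log_norm_le hx hx0
  exact h2.mono_exponent hq

/-! ### Functions with vanishing weak gradient -/

lemma continuousLinearMap_eq_zero {L : Plane →L[ℝ] ℝ}
    (h : ∀ j, L (EuclideanSpace.single j 1) = 0) : L = 0 := by
  ext y
  have : y = y 0 • EuclideanSpace.single 0 (1 : ℝ) + y 1 • EuclideanSpace.single 1 (1 : ℝ) := by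
    ext j; fin_cases j <;> simp
  rw [this, map_add, map_smul, map_smul, h, h]
  simp

open scoped Convolution in
open ContinuousLinearMap in
/-- The mollification of a function with vanishing weak gradient is constant on smaller disks. -/
lemma convolution_eq_of_weakPartial_eq_zero {m : Plane → ℝ} (hi : IntegrableOn m disk)
    (h : ∀ j, IsWeakPartial j m 0) (b : ContDiffBump (0 : Plane)) {x : Plane}
    (hx : ‖x‖ < 1 - b.rOut) :
    (b.normed volume ⋆[lsmul ℝ ℝ, volume] (disk.indicator m)) x
      = (b.normed volume ⋆[lsmul ℝ ℝ, volume] (disk.indicator m)) 0 := by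
  have hI : Integrable (disk.indicator m) := (integrable_indicator_iff measurableSet_disk).2 hi
  set f := b.normed (volume : Measure Plane) with hf
  have hfc : HasCompactSupport f := b.hasCompactSupport_normed
  have hfs : ContDiff ℝ ∞ f := b.contDiff_normed
  have hd : ∀ y, HasFDerivAt (f ⋆[lsmul ℝ ℝ, volume] (disk.indicator m))
      ((fderiv ℝ f ⋆[(lsmul ℝ ℝ).precompL Plane, volume] (disk.indicator m)) y) y := fun y =>
    hfc.hasFDerivAt_convolution_left _ (hfs.of_le (by simp)) hI.locallyIntegrable y
  have hzero : ∀ y ∈ Metric.ball (0 : Plane) (1 - b.rOut),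
      (fderiv ℝ f ⋆[(lsmul ℝ ℝ).precompL Plane, volume] (disk.indicator m)) y = 0 := by
    intro y hy
    refine continuousLinearMap_eq_zero fun j => ?_
    -- The derivative of the mollification at $y$ is a pairing of $m$ with a derivative of the
    -- reflected kernel. That kernel is an admissible test function because $|y|$ plus the outer
    -- radius is less than 1.
    have hψ : IsTest (fun z => f (y - z)) := by
      have hc : HasCompactSupport (fun z => f (y - z)) :=
        hfc.comp_homeomorph (Homeomorph.subLeft y)
      refine ⟨hfs.comp (contDiff_const.sub contDiff_id), hc, ?_⟩
      have : tsupport (fun z => f (y - z)) ⊆ Metric.closedBall y b.rOut := by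
        refine closure_minimal (fun z hz => ?_) Metric.isClosed_closedBall
        have : y - z ∈ Function.support f := hz
        rw [hf, b.support_normed_eq] at this
        have := (mem_ball_zero_iff.1 this).le
        rwa [mem_closedBall_iff_norm']
      refine this.trans fun z hz => ?_
      rw [mem_closedBall_iff_norm] at hz
      rw [mem_ball_zero_iff] at hy
      rw [disk, mem_ball_zero_iff]
      have := norm_add_le (z - y) y
      rw [sub_add_cancel] at this
      linarith
    have e := (h j).2.2 _ hψ
    have hp : ∀ z, partialDeriv j (fun z => f (y - z)) z
        = -(fderiv ℝ f (y - z) (EuclideanSpace.single j 1)) := by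
      intro z
      have h1 : HasFDerivAt (fun z => f (y - z)) ((fderiv ℝ f (y - z)).comp (-.id ℝ Plane)) z :=
        (hfs.differentiable (by simp) (y - z)).hasFDerivAt.comp z
          ((hasFDerivAt_id z).const_sub y)
      rw [partialDeriv, h1.fderiv]
      simp
    simp only [hp, Pi.zero_apply, zero_mul, integral_zero, neg_zero, mul_neg, integral_neg,
      neg_eq_zero] at e
    have hex : ConvolutionExistsAt (fderiv ℝ f) (disk.indicator m) y
        ((lsmul ℝ ℝ).precompL Plane) volume :=
      HasCompactSupport.convolutionExists_left _ (hfc.fderiv ℝ)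
        (hfs.continuous_fderiv (by simp)) hI.locallyIntegrable y
    rw [convolution_eq_swap, ContinuousLinearMap.integral_apply]
    · rw [← e, ← integral_indicator measurableSet_disk]
      refine integral_congr_ae (Eventually.of_forall fun z => ?_)
      by_cases hz : z ∈ disk
      · simp [hz, ContinuousLinearMap.precompL_apply, mul_comm]
      · simp [hz]
    · exact hex.integrable_swap
  refine Metric.isOpen_ball.is_const_of_fderiv_eq_zero
    ((convex_ball (0 : Plane) (1 - b.rOut)).isPreconnected)
    (fun y _ => (hd y).differentiableAt.differentiableWithinAt)
    (fun y hy => by rw [(hd y).fderiv, hzero y hy]; rfl)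
    (mem_ball_zero_iff.2 hx) (Metric.mem_ball_self ((norm_nonneg x).trans_lt hx))

open scoped Convolution in
-- Each mollification is constant on a disk whose radius tends to 1, with value its value at 0.
-- Almost everywhere these values converge to $m(x)$, so $m(x)$ is the limit of a sequence that does
-- not depend on $x$.
lemma ae_const_of_weakPartial_eq_zero {m : Plane → ℝ} (hi : IntegrableOn m disk)
    (h : ∀ j, IsWeakPartial j m 0) : ∃ c, ∀ᵐ x ∂diskMeasure, m x = c := by
  have hI : Integrable (disk.indicator m) := (integrable_indicator_iff measurableSet_disk).2 hi
  -- The ratio 2 of outer to inner radius stays fixed, as the almost everywhere convergence of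
  -- mollifications requires.
  let b : ℕ → ContDiffBump (0 : Plane) := fun n =>
    ⟨1 / ((n : ℝ) + 1), 2 / ((n : ℝ) + 1), by positivity, by gcongr; norm_num⟩
  have hb : Tendsto (fun n => (b n).rOut) atTop (𝓝 0) := by
    have := (tendsto_one_div_add_atTop_nhds_zero_nat (𝕜 := ℝ)).const_mul 2
    simpa [b, div_eq_mul_inv] using this
  have hlim := ContDiffBump.ae_convolution_tendsto_right_of_locallyIntegrable (μ := volume)
    (φ := b) (l := atTop) (K := 2) hb
    (Eventually.of_forall fun n => by simp [b, div_eq_mul_inv]) hI.locallyIntegrable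
  have hlim' : ∀ᵐ x ∂diskMeasure, Tendsto (fun n => ((b n).normed volume
      ⋆[ContinuousLinearMap.lsmul ℝ ℝ, volume] (disk.indicator m)) 0) atTop (𝓝 (m x)) := by
    filter_upwards [ae_restrict_of_ae hlim, ae_diskMeasure_mem] with x hx hxd
    rw [indicator_of_mem hxd] at hx
    refine hx.congr' ?_
    have h1 : ∀ᶠ n in atTop, (b n).rOut < 1 - ‖x‖ :=
      hb.eventually_lt_const (by linarith [norm_lt_one_of_mem_disk hxd])
    filter_upwards [h1] with n hn
    exact convolution_eq_of_weakPartial_eq_zero hi h (b n) (by linarith)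
  have : (ae diskMeasure).NeBot := by
    rw [ae_neBot, diskMeasure, Ne, Measure.restrict_eq_zero]
    exact (Metric.measure_ball_pos volume _ one_pos).ne'
  obtain ⟨x₀, hx₀⟩ := hlim'.exists
  exact ⟨m x₀, hlim'.mono fun x hx => tendsto_nhds_unique hx hx₀⟩

/-! ### Pointwise properties of the coefficients -/

/-- The functions `c + α cos² θ + β cos θ sin θ` of the polar angle. -/
def angular (c α β : ℝ) (x : Plane) : ℝ :=
  c + (α * (eR (angle x) 0 * eR (angle x) 0) + β * (eR (angle x) 0 * eR (angle x) 1))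

lemma integrand_eq_angular (ν a : ℝ) (x : Plane) (ξ : Mat) :
    integrand ν a x ξ = angular (ν * frob ξ ξ + ν * (a - 1) * (ξ 0 1 ^ 2 + ξ 1 1 ^ 2))
      (ν * (a - 1) * (ξ 0 0 ^ 2 + ξ 1 0 ^ 2 - (ξ 0 1 ^ 2 + ξ 1 1 ^ 2)))
      (2 * ν * (a - 1) * (ξ 0 0 * ξ 0 1 + ξ 1 0 * ξ 1 1)) x := by
  rw [integrand_eq, angular]
  linear_combination ν * (a - 1) * (ξ 0 1 ^ 2 + ξ 1 1 ^ 2) * eR_sq (angle x)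

/-- Eliminating $\sin^2\theta=1-\cos^2\theta$ brings every entry into the three-parameter family, so
one analysis serves $M$ and $f$ alike. -/
lemma exists_coeff_eq_angular (a : ℝ) (i j k l : Fin 2) :
    ∃ c α β, (fun x => coeff a x i j k l) = angular c α β := by
  by_cases hik : i = k
  · have : ∃ c α β, ∀ x, (if j = l then (1 : ℝ) else 0)
        + (a - 1) * (eR (angle x) j * eR (angle x) l) = angular c α β x := by
      fin_cases j <;> fin_cases l
      · exact ⟨1, a - 1, 0, fun x => by simp [angular]⟩
      · exact ⟨0, 0, a - 1, fun x => by simp [angular]⟩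
      · exact ⟨0, 0, a - 1, fun x => by simp [angular, mul_comm]⟩
      · refine ⟨a, 1 - a, 0, fun x => ?_⟩
        simp only [angular, Fin.mk_one, if_true]
        linear_combination (a - 1) * eR_sq (angle x)
    obtain ⟨c, α, β, h⟩ := this
    exact ⟨c, α, β, funext fun x => by rw [coeff_eq, if_pos hik, one_mul, h]⟩
  · exact ⟨0, 0, 0, funext fun x => by simp [coeff_eq, hik, angular]⟩

/-- The two conditions say that the columns of $\xi$ have equal length and are orthogonal. Up to
nonzero factors they are the coefficients of $\cos^2\theta$ and $\cos\theta\sin\theta$ in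
$f(\cdot,\xi)$. -/
lemma isConformal_of_eq {ξ : Mat} (h1 : ξ 0 0 ^ 2 + ξ 1 0 ^ 2 - (ξ 0 1 ^ 2 + ξ 1 1 ^ 2) = 0)
    (h2 : ξ 0 0 * ξ 0 1 + ξ 1 0 * ξ 1 1 = 0) : IsConformal ξ := by
  refine ⟨ξ 0 0 ^ 2 + ξ 1 0 ^ 2, ?_⟩
  ext i j
  fin_cases i <;> fin_cases j <;> simp [Matrix.mul_apply, Fin.sum_univ_two] <;> linarith

lemma not_isConformal_angular {ν a : ℝ} (hν : 0 < ν) (ha : 1 < a) {ξ : Mat}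
    (hξ : ¬ IsConformal ξ) :
    ¬ (ν * (a - 1) * (ξ 0 0 ^ 2 + ξ 1 0 ^ 2 - (ξ 0 1 ^ 2 + ξ 1 1 ^ 2)) = 0 ∧
      2 * ν * (a - 1) * (ξ 0 0 * ξ 0 1 + ξ 1 0 * ξ 1 1) = 0) := by
  rintro ⟨h1, h2⟩
  have h3 : ν * (a - 1) ≠ 0 := (mul_pos hν (by linarith)).ne'
  refine hξ (isConformal_of_eq ((mul_eq_zero.1 h1).resolve_left h3)
    ((mul_eq_zero.1 h2).resolve_left ?_))
  rw [mul_assoc]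
  exact mul_ne_zero two_ne_zero h3

lemma measurable_angular (c α β : ℝ) : Measurable (angular c α β) := by
  unfold angular
  fun_prop

lemma abs_angular_le (c α β : ℝ) (x : Plane) : |angular c α β x| ≤ |c| + (|α| + |β|) := by
  have h0 := abs_eR_le (angle x) 0
  have h1 := abs_eR_le (angle x) 1
  have aux : ∀ (p q r : ℝ), |q| ≤ 1 → |r| ≤ 1 → |p * (q * r)| ≤ |p| := fun p q r hq hr => by
    rw [abs_mul, abs_mul]
    exact mul_le_of_le_one_right (abs_nonneg _) (mul_le_one₀ hq (abs_nonneg _) hr)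
  refine (abs_add_le _ _).trans (add_le_add_right ((abs_add_le _ _).trans ?_) _)
  exact add_le_add (aux _ _ _ h0 h0) (aux _ _ _ h0 h1)

lemma quadForm_coeff (ν a : ℝ) (x : Plane) (ξ : Mat) :
    integrand ν a x ξ = ν * quadForm (coeff a x) ξ := by
  rw [integrand_eq]
  simp only [quadForm, coeff_eq, Fin.sum_univ_two, frob, if_true, zero_ne_one, one_ne_zero,
    if_false]
  ring

lemma frob_le_integrand {ν a : ℝ} (hν : 0 < ν) (ha : 1 < a) (x : Plane) (ξ : Mat) :
    ν * frob ξ ξ ≤ integrand ν a x ξ := by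
  rw [integrand_eq]
  have : 0 ≤ ν * ((a - 1) * ((ξ 0 0 * eR (angle x) 0 + ξ 0 1 * eR (angle x) 1) ^ 2
      + (ξ 1 0 * eR (angle x) 0 + ξ 1 1 * eR (angle x) 1) ^ 2)) :=
    mul_nonneg hν.le (mul_nonneg (by linarith) (by positivity))
  linarith

lemma convexOn_integrand_sub {ν a : ℝ} (hν : 0 < ν) (ha : 1 < a) (x : Plane) :
    ConvexOn ℝ univ (fun ξ : Mat => integrand ν a x ξ - ν * frob ξ ξ) := by
  refine ⟨convex_univ, fun ξ _ η _ s t hs ht hst => ?_⟩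
  obtain rfl : t = 1 - s := by linarith
  have hk : 0 ≤ ν * (a - 1) * (s * (1 - s)) := by
    have : 0 ≤ a - 1 := by linarith
    positivity
  -- The convexity defect of the square between $p$ and $q$ with weights $s,1-s$ is $s(1-s)(p-q)^2$;
  -- it is applied to the two components of $\xi e_R$ and $\eta e_R$.
  have key : ∀ p q : ℝ, 0 ≤ ν * (a - 1) * (s * (1 - s)) * (p - q) ^ 2 := fun p q => by positivity
  have k0 := key (ξ 0 0 * eR (angle x) 0 + ξ 0 1 * eR (angle x) 1)
    (η 0 0 * eR (angle x) 0 + η 0 1 * eR (angle x) 1)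
  have k1 := key (ξ 1 0 * eR (angle x) 0 + ξ 1 1 * eR (angle x) 1)
    (η 1 0 * eR (angle x) 0 + η 1 1 * eR (angle x) 1)
  simp only [integrand_eq, Matrix.add_apply, Matrix.smul_apply, smul_eq_mul]
  linarith

/-! ### Discontinuity at the origin -/

lemma tendsto_smul_nhdsNE_zero {p : Plane} (hp : p ≠ 0) :
    Tendsto (fun t : ℝ => t • p) (𝓝[>] 0) (𝓝[≠] 0) := by
  refine tendsto_nhdsWithin_iff.2 ⟨?_, ?_⟩
  · have : Tendsto (fun t : ℝ => t • p) (𝓝 0) (𝓝 ((0 : ℝ) • p)) :=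
      (continuous_id.smul continuous_const).tendsto 0
    rw [zero_smul] at this
    exact this.mono_left nhdsWithin_le_nhds
  · filter_upwards [self_mem_nhdsWithin] with t ht
    exact smul_ne_zero (ne_of_gt ht) hp

lemma eR_angle_smul {p : Plane} (hp : p ≠ 0) {t : ℝ} (ht : 0 < t) (j : Fin 2) :
    eR (angle (t • p)) j = eR (angle p) j := by
  rw [eR_angle hp, eR_angle (smul_ne_zero ht.ne' hp), norm_smul, Real.norm_of_nonneg ht.le]
  have : ‖p‖ ≠ 0 := by simpa using hp
  simp
  field_simp

lemma angular_smul (c α β : ℝ) {p : Plane} (hp : p ≠ 0) {t : ℝ} (ht : 0 < t) :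
    angular c α β (t • p) = angular c α β p := by
  simp only [angular, eR_angle_smul hp ht]

/-- The function is constant along the open ray through $p$, so a limit at the origin must be its
value at $p$. -/
lemma eq_of_tendsto_angular {c α β L : ℝ} (h : Tendsto (angular c α β) (𝓝[≠] 0) (𝓝 L))
    {p : Plane} (hp : p ≠ 0) : angular c α β p = L := by
  refine tendsto_nhds_unique ?_ (h.comp (tendsto_smul_nhdsNE_zero hp))
  refine tendsto_const_nhds.congr' ?_
  filter_upwards [self_mem_nhdsWithin] with t ht
  exact (angular_smul c α β hp ht).symm

/-- The point with coordinates `s`, `t`. -/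
def pt (s t : ℝ) : Plane := WithLp.toLp 2 ![s, t]

lemma pt_ne_zero {s t : ℝ} (h : s ≠ 0 ∨ t ≠ 0) : pt s t ≠ 0 := by
  intro h0
  have e0 := congrArg (fun z : Plane => z 0) h0
  have e1 := congrArg (fun z : Plane => z 1) h0
  simp [pt] at e0 e1
  tauto

lemma norm_pt_sq (s t : ℝ) : ‖pt s t‖ ^ 2 = s ^ 2 + t ^ 2 := by
  rw [norm_sq_plane]; simp [pt]

lemma eR_mul_eR_angle_pt {s t : ℝ} (h : s ≠ 0 ∨ t ≠ 0) (j k : Fin 2) :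
    eR (angle (pt s t)) j * eR (angle (pt s t)) k = pt s t j * pt s t k / (s ^ 2 + t ^ 2) := by
  rw [eR_angle (pt_ne_zero h), eR_angle (pt_ne_zero h), div_mul_div_comm, ← sq, norm_pt_sq]

/-- The rays through $(1,0)$, $(0,1)$ and $(1,1)$ carry the values $c+\alpha$, $c$ and
$c+(\alpha+\beta)/2$, which agree only if $\alpha=\beta=0$. -/
lemma not_tendsto_angular {c α β : ℝ} (h : ¬ (α = 0 ∧ β = 0)) :
    ¬ ∃ L, Tendsto (angular c α β) (𝓝[≠] 0) (𝓝 L) := by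
  rintro ⟨L, hL⟩
  have e1 := eq_of_tendsto_angular hL (pt_ne_zero (s := 1) (t := 0) (by norm_num))
  have e2 := eq_of_tendsto_angular hL (pt_ne_zero (s := 0) (t := 1) (by norm_num))
  have e3 := eq_of_tendsto_angular hL (pt_ne_zero (s := 1) (t := 1) (by norm_num))
  rw [angular, eR_mul_eR_angle_pt (by norm_num), eR_mul_eR_angle_pt (by norm_num)] at e1 e2 e3
  simp [pt] at e1 e2 e3
  apply h
  constructor <;> linarith

lemma not_tendsto_integrand {ν a : ℝ} (hν : 0 < ν) (ha : 1 < a) {ξ : Mat}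
    (hξ : ¬ IsConformal ξ) :
    ¬ ∃ c, Tendsto (fun x => integrand ν a x ξ) (𝓝[≠] 0) (𝓝 c) := by
  simp only [integrand_eq_angular]
  exact not_tendsto_angular (not_isConformal_angular hν ha hξ)

/-- This single entry, $1+(a-1)\cos^2\theta$, already witnesses both the discontinuity of $M$ and
its failure to be in $W^{1,2}$. -/
lemma coeff_zero_zero_zero_zero (a : ℝ) :
    (fun x => coeff a x 0 0 0 0) = angular 1 (a - 1) 0 := by
  funext x
  simp [coeff_eq, angular]

lemma not_tendsto_coeff {a : ℝ} (ha : 1 < a) : ¬ ∃ T, Tendsto (coeff a) (𝓝[≠] 0) (𝓝 T) := by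
  rintro ⟨T, hT⟩
  refine not_tendsto_angular (c := 1) (α := a - 1) (β := 0) (fun h => by linarith [h.1])
    ⟨T 0 0 0 0, ?_⟩
  rw [← coeff_zero_zero_zero_zero]
  have h1 := tendsto_pi_nhds.1 hT 0
  have h2 := tendsto_pi_nhds.1 h1 0
  have h3 := tendsto_pi_nhds.1 h2 0
  exact tendsto_pi_nhds.1 h3 0

/-! ### Sobolev regularity of the coefficients -/

/-- The derivative of `angular c α β` in the polar angle. -/
def angularDeriv (α β : ℝ) (x : Plane) : ℝ :=
  -2 * α * (eR (angle x) 0 * eR (angle x) 1)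
    + β * (eR (angle x) 0 * eR (angle x) 0 - eR (angle x) 1 * eR (angle x) 1)

lemma hasGrad_angular (c α β : ℝ) {x : Plane} (hx : x ≠ 0) :
    HasGrad (angular c α β) (fun j => angularDeriv α β x * (eT (angle x) j / ‖x‖)) x := by
  have h0 := hasGrad_eR_angle hx 0
  have h1 := hasGrad_eR_angle hx 1
  refine ((hasGrad_const c x).add (((h0.mul h0).const_mul α).add
    ((h0.mul h1).const_mul β))).congr_grad fun j => ?_
  simp only [angularDeriv, eT_zero, eT_one]
  ring

lemma measurable_angularDeriv (α β : ℝ) : Measurable (angularDeriv α β) := by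
  unfold angularDeriv
  fun_prop

lemma abs_angularDeriv_le (α β : ℝ) (x : Plane) : |angularDeriv α β x| ≤ 2 * |α| + |β| := by
  have h := eR_sq (angle x)
  have e1 : |2 * (eR (angle x) 0 * eR (angle x) 1)| ≤ 1 := by
    rw [abs_le]
    constructor <;> nlinarith [sq_nonneg (eR (angle x) 0 + eR (angle x) 1),
      sq_nonneg (eR (angle x) 0 - eR (angle x) 1)]
  have e2 : |eR (angle x) 0 * eR (angle x) 0 - eR (angle x) 1 * eR (angle x) 1| ≤ 1 := by
    rw [abs_le]
    constructor <;> nlinarith [sq_nonneg (eR (angle x) 0), sq_nonneg (eR (angle x) 1)]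
  have e3 : angularDeriv α β x = -α * (2 * (eR (angle x) 0 * eR (angle x) 1)) +
      β * (eR (angle x) 0 * eR (angle x) 0 - eR (angle x) 1 * eR (angle x) 1) := by
    rw [angularDeriv]; ring
  rw [e3]
  refine (abs_add_le _ _).trans ?_
  rw [abs_mul, abs_mul β, abs_neg]
  have := mul_le_of_le_one_right (abs_nonneg α) e1
  have := mul_le_of_le_one_right (abs_nonneg β) e2
  have := abs_nonneg α
  linarith

lemma memLp_div_norm {f : Plane → ℝ} {q : ℝ≥0∞} (hq0 : 1 ≤ q) (hq : q < 2) (hf : Measurable f)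
    {C : ℝ} (h : ∀ x, |f x| ≤ C) : MemLp (fun x => f x / ‖x‖) q diskMeasure := by
  have hq' : q ≠ ⊤ := (hq.trans (by simp)).ne
  refine memLp_of_le_norm_rpow (s := 1) (C := C) (zero_lt_one.trans_le hq0).ne' hq' ?_
    (hf.div measurable_norm) fun x _ _ => ?_
  · rw [one_mul]
    simpa using (ENNReal.toReal_lt_toReal hq' (by simp)).2 hq
  · rw [Real.rpow_neg_one, ← div_eq_mul_inv, abs_div, abs_norm]
    gcongr
    exact h x

lemma memSobolev_angular (c α β : ℝ) {q : ℝ≥0∞} (hq0 : 1 ≤ q) (hq : q < 2) :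
    MemSobolev q (angular c α β) := by
  refine memSobolev_of_hasGrad hq0 (fun x hx => hasGrad_angular c α β hx)
    (memLp_of_bounded (measurable_angular c α β) (abs_angular_le c α β)) fun j => ?_
  simp only [← mul_div_assoc]
  refine memLp_div_norm hq0 hq ((measurable_angularDeriv α β).mul (by fun_prop))
    (C := 2 * |α| + |β|) fun x => ?_
  rw [abs_mul]
  exact (mul_le_of_le_one_right (abs_nonneg _) (abs_eT_le _ _)).trans (abs_angularDeriv_le α β x)

/-- A function that is homogeneous of degree `-2` and integrable on the disk vanishes. -/
lemma eq_zero_of_integrableOn_of_homogeneous {H : Plane → ℝ} (h0 : ∀ x, 0 ≤ H x)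
    (hs : ∀ x, H ((2 : ℝ) • x) = H x / 4) (hc : ContinuousOn H {0}ᶜ) (hi : IntegrableOn H disk)
    {x : Plane} (h1 : 1 / 2 < ‖x‖) (h2 : ‖x‖ < 1) : H x = 0 := by
  set U : Set Plane := Metric.ball 0 1 \ Metric.closedBall 0 (1 / 2)
  have hU : IsOpen U := Metric.isOpen_ball.sdiff Metric.isClosed_closedBall
  have hsub : Metric.ball (0 : Plane) (1 / 2) ⊆ disk := Metric.ball_subset_ball (by norm_num)
  -- The substitution $y\mapsto2y$ divides $H$ by 4 and multiplies area by 4, so the disk and the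
  -- half disk carry the same integral. The annulus between them then carries none.
  have e1 : ∫ y in Metric.ball (0 : Plane) (1 / 2), H y = ∫ y in disk, H y := by
    have e := Measure.integral_comp_smul (volume : Measure Plane) (disk.indicator H) (2 : ℝ)
    rw [integral_indicator measurableSet_disk] at e
    have e' : (fun y : Plane => disk.indicator H ((2 : ℝ) • y))
        = (Metric.ball (0 : Plane) (1 / 2)).indicator (fun y => H y / 4) := by
      funext y
      have hiff : (2 : ℝ) • y ∈ disk ↔ y ∈ Metric.ball (0 : Plane) (1 / 2) := by
        rw [disk, mem_ball_zero_iff, mem_ball_zero_iff, norm_smul, Real.norm_of_nonneg two_pos.le]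
        constructor <;> intro h <;> linarith
      by_cases hy : y ∈ Metric.ball (0 : Plane) (1 / 2)
      · rw [indicator_of_mem hy, indicator_of_mem (hiff.2 hy), hs]
      · rw [indicator_of_notMem hy, indicator_of_notMem (fun h => hy (hiff.1 h))]
    rw [e', integral_indicator measurableSet_ball, integral_div] at e
    norm_num at e
    linarith
  have e2 : ∫ y in disk \ Metric.ball (0 : Plane) (1 / 2), H y = 0 := by
    rw [setIntegral_sdiff measurableSet_ball hi hsub, e1, sub_self]
  have e3 : H =ᵐ[volume.restrict (disk \ Metric.ball (0 : Plane) (1 / 2))] 0 :=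
    (setIntegral_eq_zero_iff_of_nonneg_ae (Eventually.of_forall h0)
      (hi.mono_set sdiff_subset)).1 e2
  have hUs : U ⊆ disk \ Metric.ball (0 : Plane) (1 / 2) :=
    sdiff_subset_sdiff_right Metric.ball_subset_closedBall
  have e4 : H =ᵐ[volume.restrict U] fun _ => 0 := ae_restrict_of_ae_restrict_of_subset hUs e3
  have hcU : ContinuousOn H U := hc.mono fun y hy h => hy.2 (by
    rw [mem_singleton_iff] at h
    simp [h])
  refine Measure.eqOn_open_of_ae_eq e4 hU hcU continuousOn_const ⟨?_, ?_⟩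
  · simpa using h2
  · simpa using h1

/-- Membership would put the classical gradient in $L^2$. Its squared length is
`angularDeriv`$^2/R^2$, homogeneous of degree $-2$, so it would have to vanish on the annulus
$1/2<R<1$. -/
lemma not_memSobolev_two_angular {c α β : ℝ} (h : ¬ (α = 0 ∧ β = 0)) :
    ¬ MemSobolev 2 (angular c α β) := by
  intro hS
  -- Weak derivatives are unique, so the square integrable one must be the classical one, known to
  -- be a weak derivative from the case $q=1$.
  have hW : ∀ j, MemLp (fun x => angularDeriv α β x * (eT (angle x) j / ‖x‖)) 2 diskMeasure := by
    intro j
    have hw := memSobolev_angular c α β le_rfl (by norm_num : (1 : ℝ≥0∞) < 2)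
    have hm : MemLp (fun x => angularDeriv α β x * (eT (angle x) j / ‖x‖)) 1 diskMeasure := by
      simp only [← mul_div_assoc]
      refine memLp_div_norm le_rfl (by norm_num) ((measurable_angularDeriv α β).mul (by fun_prop))
        (C := 2 * |α| + |β|) fun x => ?_
      rw [abs_mul]
      exact (mul_le_of_le_one_right (abs_nonneg _) (abs_eT_le _ _)).trans
        (abs_angularDeriv_le α β x)
    have hwp : IsWeakPartial j (angular c α β)
        (fun x => angularDeriv α β x * (eT (angle x) j / ‖x‖)) :=
      isWeakPartial_of_hasGrad j (fun x hx => hasGrad_angular c α β hx)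
        (MemLp.locallyIntegrableOn_disk le_rfl hw.1) (MemLp.locallyIntegrableOn_disk le_rfl hm)
    exact (hS.memLp_weakPartial j).ae_eq hwp.weakPartial_ae_eq
  have hI : IntegrableOn (fun x => angularDeriv α β x ^ 2 / ‖x‖ ^ 2) disk := by
    refine ((hW 0).integrable_sq.add (hW 1).integrable_sq).congr (Eventually.of_forall fun x => ?_)
    have := eR_sq (angle x)
    simp only [Pi.add_apply, eT_zero, eT_one, mul_pow, div_pow, neg_sq]
    rw [← mul_add, ← add_div, add_comm (eR (angle x) 1 ^ 2), this]
    ring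
  have key : ∀ x : Plane, 1 / 2 < ‖x‖ → ‖x‖ < 1 → angularDeriv α β x = 0 := by
    intro x h1 h2
    have hx : ‖x‖ ≠ 0 := by linarith
    have := eq_zero_of_integrableOn_of_homogeneous
      (H := fun x => angularDeriv α β x ^ 2 / ‖x‖ ^ 2) (fun y => by positivity) (fun y => ?_)
      (fun y hy => ?_) hI h1 h2
    · simpa [hx] using this
    · by_cases hy : y = 0
      · simp [hy]
      · simp only [angularDeriv, eR_angle_smul hy two_pos, norm_smul, Real.norm_ofNat, mul_pow]
        have : ‖y‖ ≠ 0 := by simpa using hy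
        field_simp
        ring
    · have hy' : y ≠ 0 := hy
      have c0 := (hasGrad_eR_angle hy' 0).continuousAt
      have c1 := (hasGrad_eR_angle hy' 1).continuousAt
      have hn : ‖y‖ ^ 2 ≠ 0 := by simpa using hy'
      unfold angularDeriv
      have hN : ContinuousAt (fun z : Plane => ‖z‖ ^ 2) y := by fun_prop
      exact (ContinuousAt.div (by fun_prop) hN hn).continuousWithinAt
  -- Two points of the annulus: on the axis the angular derivative is $\beta$, on the diagonal it is
  -- $-\alpha$.
  have n1 : ‖pt (3 / 4) 0‖ = 3 / 4 := by
    rw [← sq_eq_sq₀ (norm_nonneg _) (by norm_num), norm_pt_sq]; norm_num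
  have n2 := norm_pt_sq (3 / 5) (3 / 5)
  have k1 := key (pt (3 / 4) 0) (by rw [n1]; norm_num) (by rw [n1]; norm_num)
  have k2 := key (pt (3 / 5) (3 / 5))
    (by nlinarith [norm_nonneg (pt (3 / 5) (3 / 5))])
    (by nlinarith [norm_nonneg (pt (3 / 5) (3 / 5))])
  rw [angularDeriv, eR_mul_eR_angle_pt (by norm_num), eR_mul_eR_angle_pt (by norm_num),
    eR_mul_eR_angle_pt (by norm_num)] at k1 k2
  simp [pt] at k1 k2
  exact h ⟨by tauto, by tauto⟩

/-! ### The covering map is Lipschitz but not continuously differentiable -/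

lemma eR_zero_eq_re_pow (n : ℕ) (t : ℝ) :
    eR (n * t) 0 = (Complex.exp (t * Complex.I) ^ n).re := by
  rw [← Complex.exp_nat_mul, ← mul_assoc]
  have : ((n : ℂ) * t) * Complex.I = ((n * t : ℝ) : ℂ) * Complex.I := by push_cast; ring
  rw [this, Complex.exp_ofReal_mul_I_re]
  simp [eR]

lemma eR_one_eq_im_pow (n : ℕ) (t : ℝ) :
    eR (n * t) 1 = (Complex.exp (t * Complex.I) ^ n).im := by
  rw [← Complex.exp_nat_mul, ← mul_assoc]
  have : ((n : ℂ) * t) * Complex.I = ((n * t : ℝ) : ℂ) * Complex.I := by push_cast; ring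
  rw [this, Complex.exp_ofReal_mul_I_im]
  simp [eR]

lemma norm_pow_sub_pow_le_of_norm_eq_one {z w : ℂ} (hz : ‖z‖ = 1) (hw : ‖w‖ = 1) (n : ℕ) :
    ‖z ^ n - w ^ n‖ ≤ n * ‖z - w‖ := by
  induction n with
  | zero => simp
  | succ n ih =>
    have e : z ^ (n + 1) - w ^ (n + 1) = z ^ n * (z - w) + (z ^ n - w ^ n) * w := by ring
    rw [e]
    refine (norm_add_le _ _).trans ?_
    rw [norm_mul, norm_mul, norm_pow, hz, hw, one_pow, one_mul, mul_one]
    push_cast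
    linarith

/-- The difference splits into a radial part $(r-s)z^n$ and an angular part $s(z^n-w^n)$. Each of
$|r-s|$ and $s|z-w|$ is controlled by $|rz-sw|$. -/
lemma norm_smul_pow_sub_le {z w : ℂ} (hz : ‖z‖ = 1) (hw : ‖w‖ = 1) (n : ℕ) {r s : ℝ}
    (hr : 0 ≤ r) (hs : 0 ≤ s) :
    ‖r * z ^ n - s * w ^ n‖ ≤ (1 + 2 * n) * ‖r * z - s * w‖ := by
  have h1 : |r - s| ≤ ‖(r : ℂ) * z - s * w‖ := by
    have := abs_norm_sub_norm_le ((r : ℂ) * z) (s * w)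
    rwa [norm_mul, norm_mul, hz, hw, mul_one, mul_one, Complex.norm_of_nonneg hr,
      Complex.norm_of_nonneg hs] at this
  have hrs : ‖(r : ℂ) - s‖ = |r - s| := by
    rw [← Complex.ofReal_sub, Complex.norm_real, Real.norm_eq_abs]
  have h2 : s * ‖z - w‖ ≤ 2 * ‖(r : ℂ) * z - s * w‖ := by
    have e : (s : ℂ) * (z - w) = (r * z - s * w) - ((r : ℂ) - s) * z := by ring
    have := norm_sub_le ((r : ℂ) * z - s * w) (((r : ℂ) - s) * z)
    rw [← e, norm_mul, Complex.norm_of_nonneg hs, norm_mul, hz, mul_one, hrs] at this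
    linarith
  have e : (r : ℂ) * z ^ n - s * w ^ n = ((r : ℂ) - s) * z ^ n + s * (z ^ n - w ^ n) := by ring
  rw [e]
  refine (norm_add_le _ _).trans ?_
  rw [norm_mul, norm_mul, norm_pow, hz, one_pow, mul_one, hrs, Complex.norm_of_nonneg hs]
  have h3 : s * ‖z ^ n - w ^ n‖ ≤ s * (n * ‖z - w‖) :=
    mul_le_mul_of_nonneg_left (norm_pow_sub_pow_le_of_norm_eq_one hz hw n) hs
  have h4 : (n : ℝ) * (s * ‖z - w‖) ≤ n * (2 * ‖(r : ℂ) * z - s * w‖) :=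
    mul_le_mul_of_nonneg_left h2 (Nat.cast_nonneg n)
  linarith

lemma norm_mul_exp_sub (x y : Plane) :
    ‖(‖x‖ : ℂ) * Complex.exp (angle x * Complex.I)
      - (‖y‖ : ℂ) * Complex.exp (angle y * Complex.I)‖ = ‖x - y‖ := by
  have e : ∀ z : Plane, (‖z‖ : ℂ) * Complex.exp (angle z * Complex.I) = ⟨z 0, z 1⟩ := by
    intro z
    have h0 := eR_zero_eq_re_pow 1 (angle z)
    have h1 := eR_one_eq_im_pow 1 (angle z)
    simp only [Nat.cast_one, one_mul, pow_one] at h0 h1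
    apply Complex.ext
    · rw [Complex.re_ofReal_mul, ← h0, norm_smul_eR_angle]
    · rw [Complex.im_ofReal_mul, ← h1, norm_smul_eR_angle]
  rw [e, e, ← norm_complex_eq]
  congr 1

lemma abs_coverMap_sub_le (N : ℕ) (x y : Plane) (i : Fin 2) :
    |coverMap N x i - coverMap N y i| ≤ (1 + 2 * N) / √N * ‖x - y‖ := by
  have h := norm_smul_pow_sub_le (Complex.norm_exp_ofReal_mul_I (angle x))
    (Complex.norm_exp_ofReal_mul_I (angle y)) N (norm_nonneg x) (norm_nonneg y)
  rw [norm_mul_exp_sub] at h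
  have e : |‖x‖ * eR (N * angle x) i - ‖y‖ * eR (N * angle y) i| ≤ (1 + 2 * N) * ‖x - y‖ := by
    refine le_trans ?_ h
    fin_cases i
    · refine le_trans (le_of_eq ?_) (Complex.abs_re_le_norm _)
      rw [Complex.sub_re, Complex.re_ofReal_mul, Complex.re_ofReal_mul, ← eR_zero_eq_re_pow,
        ← eR_zero_eq_re_pow]
      rfl
    · refine le_trans (le_of_eq ?_) (Complex.abs_im_le_norm _)
      rw [Complex.sub_im, Complex.im_ofReal_mul, Complex.im_ofReal_mul, ← eR_one_eq_im_pow,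
        ← eR_one_eq_im_pow]
      rfl
  have e2 : coverMap N x i - coverMap N y i
      = (‖x‖ * eR (N * angle x) i - ‖y‖ * eR (N * angle y) i) / √N := by
    rw [coverMap_apply, coverMap_apply]; ring
  rw [e2, abs_div, abs_of_nonneg (Real.sqrt_nonneg _), div_mul_eq_mul_div]
  gcongr

lemma lipschitzWith_coverMap (N : ℕ) : ∃ K, LipschitzWith K (coverMap N) := by
  refine ⟨Real.toNNReal (2 * ((1 + 2 * N) / √N)), LipschitzWith.of_dist_le_mul fun x y => ?_⟩
  rw [Real.coe_toNNReal _ (by positivity), dist_eq_norm, dist_eq_norm]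
  have h0 := abs_coverMap_sub_le N x y 0
  have h1 := abs_coverMap_sub_le N x y 1
  have h := norm_sq_plane (coverMap N x - coverMap N y)
  simp only [PiLp.sub_apply] at h
  rw [← sq_abs (_ - _), ← sq_abs (coverMap N x 1 - _)] at h
  have h2 : ‖coverMap N x - coverMap N y‖
      ≤ |coverMap N x 0 - coverMap N y 0| + |coverMap N x 1 - coverMap N y 1| := by
    rw [← sq_le_sq₀ (norm_nonneg _) (by positivity), h]
    nlinarith [abs_nonneg (coverMap N x 0 - coverMap N y 0),
      abs_nonneg (coverMap N x 1 - coverMap N y 1)]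
  linarith

lemma angle_smul (x : Plane) {t : ℝ} (ht : 0 < t) : angle (t • x) = angle x := by
  have : (⟨(t • x) 0, (t • x) 1⟩ : ℂ) = t * ⟨x 0, x 1⟩ := by
    apply Complex.ext <;> simp
  rw [angle, this, Complex.arg_real_mul _ ht, angle]

lemma coverMap_smul (N : ℕ) (x : Plane) {t : ℝ} (ht : 0 < t) (i : Fin 2) :
    coverMap N (t • x) i = t * coverMap N x i := by
  rw [coverMap_apply, coverMap_apply, angle_smul x ht, norm_smul, Real.norm_of_nonneg ht.le]
  ring

lemma angle_pt_cos_sin {t : ℝ} (ht : t ∈ Ioc (-Real.pi) Real.pi) :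
    angle (pt (Real.cos t) (Real.sin t)) = t := by
  have : (⟨pt (Real.cos t) (Real.sin t) 0, pt (Real.cos t) (Real.sin t) 1⟩ : ℂ)
      = Complex.cos t + Complex.sin t * Complex.I := by
    apply Complex.ext <;> simp [pt, ← Complex.ofReal_cos, ← Complex.ofReal_sin]
  rw [angle, this, Complex.arg_cos_add_sin_mul_I ht]

lemma coverMap_pt_cos_sin (N : ℕ) {t : ℝ} (ht : t ∈ Ioc (-Real.pi) Real.pi) :
    coverMap N (pt (Real.cos t) (Real.sin t)) 0 = Real.cos (N * t) / √N := by
  have hn : ‖pt (Real.cos t) (Real.sin t)‖ = 1 := by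
    rw [← sq_eq_sq₀ (norm_nonneg _) one_pos.le, norm_pt_sq]; simp
  rw [coverMap_apply, angle_pt_cos_sin ht, hn]
  simp [eR]
  ring

lemma not_differentiableAt_coverMap {N : ℕ} (hN : 2 ≤ N) :
    ¬ DifferentiableAt ℝ (fun x => coverMap N x 0) 0 := by
  intro h
  set L := fderiv ℝ (fun x => coverMap N x 0) 0
  -- A positively 1-homogeneous function that is differentiable at 0 equals its derivative there, as
  -- one-sided difference quotients along rays show.
  have hL : ∀ p, L p = coverMap N p 0 := by
    intro p
    have h1 : HasDerivAt (fun t : ℝ => coverMap N (0 + t • p) 0) (L p) 0 :=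
      h.hasFDerivAt.hasLineDerivAt p
    have h2 : HasDerivWithinAt (fun t : ℝ => coverMap N (0 + t • p) 0) (coverMap N p 0)
        (Ioi 0) 0 := by
      have h3 : HasDerivWithinAt (fun t : ℝ => t * coverMap N p 0) (coverMap N p 0) (Ioi 0) 0 := by
        simpa using ((hasDerivAt_id (0 : ℝ)).mul_const (coverMap N p 0)).hasDerivWithinAt
      refine h3.congr (fun t ht => ?_) ?_
      · rw [zero_add, coverMap_smul N p ht]
      · simp [coverMap_apply]
    exact (uniqueDiffWithinAt_Ioi 0).eq_deriv _ h1.hasDerivWithinAt h2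
  have hN' : (2 : ℝ) ≤ N := by exact_mod_cast hN
  have hs : √(N : ℝ) ≠ 0 := by positivity
  have hpos : 0 < Real.pi / N := by positivity
  have hlt : Real.pi / N < Real.pi := div_lt_self Real.pi_pos (by linarith)
  have e0 := coverMap_pt_cos_sin N (t := 0) ⟨by linarith [Real.pi_pos], Real.pi_pos.le⟩
  have e1 := coverMap_pt_cos_sin N (t := Real.pi / N) ⟨by linarith, hlt.le⟩
  have e2 := coverMap_pt_cos_sin N (t := -(Real.pi / N)) ⟨by linarith, by linarith⟩
  have hm : (N : ℝ) * (Real.pi / N) = Real.pi := by field_simp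
  rw [mul_neg, Real.cos_neg, Real.cos_neg, Real.sin_neg] at e2
  rw [hm, Real.cos_pi, ← hL] at e1
  rw [hm, Real.cos_pi, ← hL] at e2
  rw [mul_zero, Real.cos_zero, Real.sin_zero, ← hL] at e0
  -- Additivity fails on the unit vectors at angles $\pm\pi/N$: both have value $-1/\sqrt N$, while
  -- their sum is $2\cos(\pi/N)(1,0)$, of value $2\cos(\pi/N)/\sqrt N$. Linearity would force
  -- $\cos(\pi/N)=-1$, impossible for $N\ge2$.
  have hsum : pt (Real.cos (Real.pi / N)) (Real.sin (Real.pi / N))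
      + pt (Real.cos (Real.pi / N)) (-Real.sin (Real.pi / N))
      = (2 * Real.cos (Real.pi / N)) • pt 1 0 := by
    ext j
    fin_cases j <;> simp [pt]
    ring
  have hc := congrArg L hsum
  rw [map_add, map_smul, e0, e1, e2, smul_eq_mul] at hc
  field_simp at hc
  have : Real.cos Real.pi < Real.cos (Real.pi / N) :=
    Real.cos_lt_cos_of_nonneg_of_le_pi hpos.le le_rfl hlt
  rw [Real.cos_pi] at this
  linarith

lemma not_contDiffOn_coverMap {N : ℕ} (hN : 2 ≤ N) : ¬ ContDiffOn ℝ 1 (coverMap N) disk := by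
  intro h
  have h0 : disk ∈ 𝓝 (0 : Plane) := Metric.ball_mem_nhds _ one_pos
  have h1 : DifferentiableAt ℝ (coverMap N) 0 :=
    ((h.differentiableOn one_ne_zero) 0 (mem_of_mem_nhds h0)).differentiableAt h0
  exact not_differentiableAt_coverMap hN
    ((EuclideanSpace.proj (𝕜 := ℝ) (0 : Fin 2)).differentiableAt.comp (0 : Plane) h1)

/-! ### Bounded measurable functions -/

/-- `f` is measurable and bounded. -/
def IsBddMeas (f : Plane → ℝ) : Prop := Measurable f ∧ ∃ C, ∀ x, |f x| ≤ C

namespace IsBddMeas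

variable {f g : Plane → ℝ}

lemma const (c : ℝ) : IsBddMeas fun _ => c := ⟨measurable_const, |c|, fun _ => le_rfl⟩

lemma add (hf : IsBddMeas f) (hg : IsBddMeas g) : IsBddMeas fun x => f x + g x := by
  obtain ⟨C, hC⟩ := hf.2
  obtain ⟨D, hD⟩ := hg.2
  exact ⟨hf.1.add hg.1, C + D, fun x => (abs_add_le _ _).trans (add_le_add (hC x) (hD x))⟩

lemma mul (hf : IsBddMeas f) (hg : IsBddMeas g) : IsBddMeas fun x => f x * g x := by
  obtain ⟨C, hC⟩ := hf.2
  obtain ⟨D, hD⟩ := hg.2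
  refine ⟨hf.1.mul hg.1, C * D, fun x => ?_⟩
  rw [abs_mul]
  exact mul_le_mul (hC x) (hD x) (abs_nonneg _) ((abs_nonneg _).trans (hC x))

lemma neg (hf : IsBddMeas f) : IsBddMeas fun x => -f x := by
  simpa using (const (-1)).mul hf

lemma sub (hf : IsBddMeas f) (hg : IsBddMeas g) : IsBddMeas fun x => f x - g x := by
  simpa [sub_eq_add_neg] using hf.add hg.neg

lemma eR (n : ℝ) (i : Fin 2) : IsBddMeas fun x => eR (n * angle x) i :=
  ⟨by fun_prop, 1, fun _ => abs_eR_le _ _⟩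

lemma eT (n : ℝ) (i : Fin 2) : IsBddMeas fun x => eT (n * angle x) i :=
  ⟨by fun_prop, 1, fun _ => abs_eT_le _ _⟩

lemma eR_angle (i : Fin 2) : IsBddMeas fun x => NCover.eR (angle x) i :=
  ⟨by fun_prop, 1, fun _ => abs_eR_le _ _⟩

lemma eT_angle (i : Fin 2) : IsBddMeas fun x => NCover.eT (angle x) i :=
  ⟨by fun_prop, 1, fun _ => abs_eT_le _ _⟩

lemma of_isTest (hf : IsTest f) : IsBddMeas f := ⟨hf.1.continuous.measurable, hf.bounded⟩

lemma coverGrad (N : ℕ) (i j : Fin 2) : IsBddMeas fun x => coverGrad N x i j :=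
  ⟨by fun_prop, _, fun x => abs_coverGrad_le N x i j⟩

lemma memLp_mul (hf : IsBddMeas f) {w : Plane → ℝ} {p : ℝ≥0∞} (hw : MemLp w p diskMeasure) :
    MemLp (fun x => f x * w x) p diskMeasure := by
  obtain ⟨C, hC⟩ := hf.2
  refine (hw.norm.const_mul C).mono' (hf.1.aestronglyMeasurable.mul hw.1)
    (Eventually.of_forall fun x => ?_)
  rw [norm_mul]
  exact mul_le_mul_of_nonneg_right (hC x) (norm_nonneg _)

lemma memLp (hf : IsBddMeas f) (p : ℝ≥0∞) : MemLp f p diskMeasure := by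
  obtain ⟨C, hC⟩ := hf.2
  exact memLp_of_bounded hf.1 hC

lemma integrable_mul (hf : IsBddMeas f) {w : Plane → ℝ} (hw : Integrable w diskMeasure) :
    Integrable (fun x => f x * w x) diskMeasure :=
  memLp_one_iff_integrable.1 (hf.memLp_mul (memLp_one_iff_integrable.2 hw))

end IsBddMeas

/-! ### The weak gradient of the covering map -/

lemma memSobolev_coverMap (N : ℕ) (i : Fin 2) {q : ℝ≥0∞} (hq : 1 ≤ q) :
    MemSobolev q (fun x => coverMap N x i) := by
  refine memSobolev_of_hasGrad hq (fun x hx => hasGrad_coverMap N hx i) ?_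
    fun j => (IsBddMeas.coverGrad N i j).memLp q
  have hm : Measurable fun x => coverMap N x i := by
    simp only [coverMap_apply]
    fun_prop
  refine MemLp.of_bound hm.aestronglyMeasurable (1 / √N) ?_
  filter_upwards [ae_diskMeasure_mem] with x hx
  rw [coverMap_apply, Real.norm_eq_abs, abs_mul, abs_div, abs_of_nonneg (Real.sqrt_nonneg _),
    abs_norm]
  refine (mul_le_of_le_one_right (by positivity) (abs_eR_le _ _)).trans ?_
  gcongr
  exact (norm_lt_one_of_mem_disk hx).le

lemma weakPartial_coverMap (N : ℕ) (i j : Fin 2) :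
    weakPartial j (fun y => coverMap N y i) =ᵐ[diskMeasure] fun x => coverGrad N x i j :=
  (isWeakPartial_of_hasGrad j (fun _ hx => hasGrad_coverMap N hx i)
    (MemLp.locallyIntegrableOn_disk le_rfl (memSobolev_coverMap N i le_rfl).1)
    (MemLp.locallyIntegrableOn_disk le_rfl
      ((IsBddMeas.coverGrad N i j).memLp 1))).weakPartial_ae_eq

lemma weakGrad_coverMap (N : ℕ) :
    ∀ᵐ x ∂diskMeasure, weakGrad (coverMap N) x = coverGrad N x := by
  filter_upwards [weakPartial_coverMap N 0 0, weakPartial_coverMap N 0 1,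
    weakPartial_coverMap N 1 0, weakPartial_coverMap N 1 1] with x h1 h2 h3 h4
  ext i j
  fin_cases i <;> fin_cases j <;> assumption

/-! ### Divergence-free fields of covering type -/

/-- The row `i` of the matrix field `A e_R(Nθ) ⊗ e_R + B e_θ(Nθ) ⊗ e_θ`. -/
def frameField (N : ℕ) (A B : ℝ) (x : Plane) (i j : Fin 2) : ℝ :=
  A * (eR (N * angle x) i * eR (angle x) j) + B * (eT (N * angle x) i * eT (angle x) j)

/-- The gradient is sorted into bounded functions times $1/R$ and times $\ln R/R$, so that its
integrability can be read off. -/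
lemma hasGrad_frameField (N : ℕ) (α₀ α₁ β₀ β₁ : ℝ) (i j : Fin 2) {x : Plane} (hx : x ≠ 0) :
    HasGrad (fun y => frameField N (α₀ + α₁ * Real.log ‖y‖) (β₀ + β₁ * Real.log ‖y‖) y i j)
      (fun m => (α₁ * (eR (N * angle x) i * eR (angle x) j * eR (angle x) m)
        + β₁ * (eT (N * angle x) i * eT (angle x) j * eR (angle x) m)
        + α₀ * (eR (N * angle x) i * (eT (angle x) j * eT (angle x) m)
          + N * (eR (angle x) j * (eT (N * angle x) i * eT (angle x) m)))
        - β₀ * (eT (N * angle x) i * (eR (angle x) j * eT (angle x) m)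
          + N * (eT (angle x) j * (eR (N * angle x) i * eT (angle x) m)))) * (1 / ‖x‖)
        + (α₁ * (eR (N * angle x) i * (eT (angle x) j * eT (angle x) m)
          + N * (eR (angle x) j * (eT (N * angle x) i * eT (angle x) m)))
        - β₁ * (eT (N * angle x) i * (eR (angle x) j * eT (angle x) m)
          + N * (eT (angle x) j * (eR (N * angle x) i * eT (angle x) m))))
            * (Real.log ‖x‖ / ‖x‖)) x := by
  have hn : ‖x‖ ≠ 0 := by simpa using hx
  have hl := (hasGrad_norm hx).comp (Real.hasDerivAt_log hn)
  have hA := (hasGrad_const α₀ x).add (hl.const_mul α₁)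
  have hB := (hasGrad_const β₀ x).add (hl.const_mul β₁)
  have h1 := ((hasGrad_eR_eT_mul_angle hx N).1 i).mul (hasGrad_eR_angle hx j)
  have h2 := ((hasGrad_eR_eT_mul_angle hx N).2 i).mul (hasGrad_eT_angle hx j)
  refine ((hA.mul h1).add (hB.mul h2)).congr_grad fun m => ?_
  rw [← eR_angle hx m]
  field_simp
  ring

lemma memLp_frameField (N : ℕ) (α₀ α₁ β₀ β₁ : ℝ) (i j : Fin 2) :
    MemLp (fun y => frameField N (α₀ + α₁ * Real.log ‖y‖) (β₀ + β₁ * Real.log ‖y‖) y i j) 2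
      diskMeasure := by
  have h1 := (IsBddMeas.eR N i).mul (IsBddMeas.eR_angle j)
  have h2 := (IsBddMeas.eT N i).mul (IsBddMeas.eT_angle j)
  have hl := memLp_log_norm (q := 2) le_rfl
  have h3 := ((memLp_const (μ := diskMeasure) (p := 2) α₀).add (hl.const_mul α₁))
  have h4 := ((memLp_const (μ := diskMeasure) (p := 2) β₀).add (hl.const_mul β₁))
  refine ((h1.memLp_mul h3).add (h2.memLp_mul h4)).ae_eq (Eventually.of_forall fun x => ?_)
  simp only [frameField, Pi.add_apply]
  ring

lemma integrable_one_div_norm : Integrable (fun x : Plane => 1 / ‖x‖) diskMeasure :=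
  memLp_one_iff_integrable.1 (memLp_div_norm le_rfl (by norm_num) measurable_const
    (C := 1) (by simp))

lemma integrable_log_div_norm :
    Integrable (fun x : Plane => Real.log ‖x‖ / ‖x‖) diskMeasure := by
  refine memLp_one_iff_integrable.1 (memLp_of_le_norm_rpow (s := 3 / 2) (C := 2) one_ne_zero
    ENNReal.one_ne_top (by norm_num) (measurable_norm.log.div measurable_norm) fun x hx hx0 => ?_)
  have h0 : 0 < ‖x‖ := by simpa using hx0
  rw [abs_div, abs_norm, div_le_iff₀ h0, mul_assoc]
  nth_rewrite 3 [← Real.rpow_one ‖x‖]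
  rw [← Real.rpow_add h0]
  norm_num
  have := abs_log_norm_le hx hx0
  norm_num at this
  exact this

/-- A field of covering type is weakly divergence free on the disk if it is so off the origin. -/
lemma integral_frameField_eq_zero (N : ℕ) {α₀ α₁ β₀ β₁ : ℝ} (h0 : α₁ + α₀ = N * β₀)
    (h1 : α₁ = N * β₁) (i : Fin 2) {φ : Plane → ℝ} (hφ : IsTest φ) :
    ∫ x in disk, ∑ j, frameField N (α₀ + α₁ * Real.log ‖x‖) (β₀ + β₁ * Real.log ‖x‖) x i j
      * partialDeriv j φ x = 0 := by
  have hF := fun j => MemLp.locallyIntegrableOn_disk one_le_two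
    (memLp_frameField N α₀ α₁ β₀ β₁ i j)
  have hW := fun j : Fin 2 => isWeakPartial_of_hasGrad j
    (fun x hx => hasGrad_frameField N α₀ α₁ β₀ β₁ i j hx) (hF j) (by
      have r := IsBddMeas.eR_angle j
      have t := IsBddMeas.eT_angle j
      have p := IsBddMeas.eR N i
      have q := IsBddMeas.eT N i
      have c := fun c : ℝ => IsBddMeas.const c
      have b1 := ((((c α₁).mul ((p.mul r).mul r)).add ((c β₁).mul ((q.mul t).mul r))).add
        ((c α₀).mul ((p.mul (t.mul t)).add ((c N).mul (r.mul (q.mul t)))))).sub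
        ((c β₀).mul ((q.mul (r.mul t)).add ((c N).mul (t.mul (p.mul t)))))
      have b2 := ((c α₁).mul ((p.mul (t.mul t)).add ((c N).mul (r.mul (q.mul t))))).sub
        ((c β₁).mul ((q.mul (r.mul t)).add ((c N).mul (t.mul (p.mul t)))))
      exact MemLp.locallyIntegrableOn_disk le_rfl (memLp_one_iff_integrable.2
        ((b1.integrable_mul integrable_one_div_norm).add
          (b2.integrable_mul integrable_log_div_norm))))
  have i1 := fun j => ((hφ.partialDeriv j).integrable_mul (hF j)).integrableOn (s := disk)
  have i2 := fun j => (hφ.integrable_mul (hW j).2.1).integrableOn (s := disk)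
  rw [integral_finsetSum _ fun j _ => i1 j, Finset.sum_congr rfl fun j _ => (hW j).2.2 φ hφ,
    Finset.sum_neg_distrib, ← integral_finsetSum _ fun j _ => i2 j, neg_eq_zero]
  refine integral_eq_zero_of_ae (Eventually.of_forall fun x => ?_)
  simp only [Fin.sum_univ_two, eT_zero (angle x), eT_one (angle x), Pi.zero_apply]
  have e := eR_sq (angle x)
  generalize Real.log ‖x‖ / ‖x‖ = l
  generalize 1 / ‖x‖ = r
  -- The divergence is $(A'+A/R-NB/R)\,e_R(N\theta)$. For logarithmic $A,B$ its $1/R$ and $\ln R/R$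
  -- parts are proportional to $\alpha_1+\alpha_0-N\beta_0$ and $\alpha_1-N\beta_1$.
  have key : ∀ p q c s : ℝ, c ^ 2 + s ^ 2 = 1 →
      ((α₁ * (p * c * c) + β₁ * (q * -s * c) + α₀ * (p * (-s * -s) + N * (c * (q * -s)))
          - β₀ * (q * (c * -s) + N * (-s * (p * -s)))) * r
        + (α₁ * (p * (-s * -s) + N * (c * (q * -s)))
          - β₁ * (q * (c * -s) + N * (-s * (p * -s)))) * l) * φ x
      + ((α₁ * (p * s * s) + β₁ * (q * c * s) + α₀ * (p * (c * c) + N * (s * (q * c)))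
          - β₀ * (q * (s * c) + N * (c * (p * c)))) * r
        + (α₁ * (p * (c * c) + N * (s * (q * c)))
          - β₁ * (q * (s * c) + N * (c * (p * c)))) * l) * φ x = 0 := by
    intro p q c s h
    linear_combination p * r * φ x * (α₁ + α₀ - N * β₀) * h + p * r * φ x * h0
      + p * l * φ x * (α₁ - N * β₁) * h + p * l * φ x * h1
  exact key _ _ _ _ e

/-! ### Pressures of the covering map -/

lemma IsTestMap.isTest {η : Plane → Plane} (h : IsTestMap η) (i : Fin 2) :
    IsTest fun x => η x i := by
  have hs : tsupport (fun x => η x i) ⊆ tsupport η := by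
    refine closure_mono fun x hx h0 => hx ?_
    simp [h0]
  exact ⟨contDiff_euclidean.1 h.1 i, h.2.1.mono' (subset_closure.trans hs), hs.trans h.2.2⟩

/-- The derivative of the integrand multiplies the $e_R$ column by $2\nu a$ and the $e_\theta$
column by $2\nu$. -/
lemma gradXi_coverGrad (ν a : ℝ) (N : ℕ) (x : Plane) (i j : Fin 2) :
    gradXi (integrand ν a) x (coverGrad N x) i j
      = frameField N (2 * ν * a / √N) (2 * ν * N / √N) x i j := by
  have key : ∀ p q c s w t : ℝ, c ^ 2 + s ^ 2 = 1 →
      2 * ν * ((a - 1) * (((p * c + N * (q * -s)) / √N * c + (p * s + N * (q * c)) / √N * s) * w)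
        + (p * w + N * (q * t)) / √N) = 2 * ν * a / √N * (p * w) + 2 * ν * N / √N * (q * t) := by
    intro p q c s w t h
    linear_combination 2 * ν * (a - 1) * p * w / √N * h
  rw [gradXi_integrand, frameField]
  simp only [coverGrad_apply, eT_zero (angle x), eT_one (angle x)]
  exact key _ _ _ _ _ _ (eR_sq _)

lemma frob_coverGrad (ν a : ℝ) (N : ℕ) (x : Plane) (l : ℝ) (B : Mat) :
    frob (gradXi (integrand ν a) x (coverGrad N x) + (2 * l) • cof (coverGrad N x)) B
      = ∑ i, ∑ j, frameField N ((2 * ν * a + 2 * l * N) / √N) ((2 * ν * N + 2 * l) / √N) x i j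
        * B i j := by
  simp only [frob, Matrix.add_apply, Matrix.smul_apply, gradXi_coverGrad, cof_coverGrad,
    smul_eq_mul, frameField]
  refine Finset.sum_congr rfl fun i _ => Finset.sum_congr rfl fun j _ => ?_
  ring

lemma memSobolev_pressure (c k : ℝ) {q : ℝ≥0∞} (hq0 : 1 ≤ q) (hq : q < 2) :
    MemSobolev q (fun x => c + k * Real.log ‖x‖) := by
  refine memSobolev_of_hasGrad (d := fun x j => k * eR (angle x) j / ‖x‖) hq0
    (fun x hx => ?_) ?_ fun j => ?_
  · have hn : ‖x‖ ≠ 0 := by simpa using hx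
    refine ((hasGrad_const c x).add (((hasGrad_norm hx).comp
      (Real.hasDerivAt_log hn)).const_mul k)).congr_grad fun j => ?_
    rw [eR_angle hx]
    field_simp
    ring
  · exact (memLp_const c).add ((memLp_log_norm hq.le).const_mul k)
  · refine memLp_div_norm hq0 hq (by fun_prop) (C := |k|) fun x => ?_
    rw [abs_mul]
    exact mul_le_of_le_one_right (abs_nonneg _) (abs_eR_le _ _)

/-- The coefficients of the stationarity field of `u_N` with a logarithmic pressure. -/
lemma frameField_pressure (N : ℕ) (ν a c k : ℝ) (x : Plane) (i j : Fin 2) :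
    frameField N ((2 * ν * a + 2 * (c + k * Real.log ‖x‖) * N) / √N)
      ((2 * ν * N + 2 * (c + k * Real.log ‖x‖)) / √N) x i j
    = frameField N ((2 * ν * a + 2 * c * N) / √N + (2 * k * N / √N) * Real.log ‖x‖)
      ((2 * ν * N + 2 * c) / √N + (2 * k / √N) * Real.log ‖x‖) x i j := by
  congr 1 <;> ring

/-- For the pressure $c+k\ln R$ the condition on the $\ln R/R$ part holds for every $k$, and the
other one reads $k=\nu(N-a/N)$; $c$ drops out. -/
lemma integral_frameField_pressure {N : ℕ} (hN : N ≠ 0) (ν a c : ℝ) (i : Fin 2) {φ : Plane → ℝ}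
    (hφ : IsTest φ) :
    ∫ x in disk, ∑ j, frameField N
      ((2 * ν * a + 2 * (c + ν * (N - a / N) * Real.log ‖x‖) * N) / √N)
      ((2 * ν * N + 2 * (c + ν * (N - a / N) * Real.log ‖x‖)) / √N) x i j
        * partialDeriv j φ x = 0 := by
  simp only [frameField_pressure]
  have h0 : (N : ℝ) ≠ 0 := by exact_mod_cast hN
  refine integral_frameField_eq_zero N ?_ ?_ i hφ
  · field_simp
    ring
  · field_simp

lemma memLp_frameField_pressure (N : ℕ) (ν a c k : ℝ) (i j : Fin 2) :
    MemLp (fun x => frameField N ((2 * ν * a + 2 * (c + k * Real.log ‖x‖) * N) / √N)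
      ((2 * ν * N + 2 * (c + k * Real.log ‖x‖)) / √N) x i j) 2 diskMeasure := by
  simp only [frameField_pressure]
  exact memLp_frameField N _ _ _ _ i j

lemma isPressure_of_ae_eq {N : ℕ} (hN : N ≠ 0) (ν a c : ℝ) {p : Plane → ℝ}
    (hp : ∀ᵐ x ∂diskMeasure, p x = c + ν * (N - a / N) * Real.log ‖x‖) :
    IsPressure (integrand ν a) (coverMap N) p := by
  refine ⟨fun i => memSobolev_coverMap N i one_le_two, ?_, fun η hη => ?_⟩
  · exact (memSobolev_pressure c _ le_rfl (by norm_num)).congr_ae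
      (hp.mono fun x hx => hx.symm)
  · have e : ∫ x in disk, frob (gradXi (integrand ν a) x (weakGrad (coverMap N) x)
        + (2 * p x) • cof (weakGrad (coverMap N) x)) (grad η x)
        = ∫ x in disk, ∑ i, ∑ j, frameField N
          ((2 * ν * a + 2 * (c + ν * (N - a / N) * Real.log ‖x‖) * N) / √N)
          ((2 * ν * N + 2 * (c + ν * (N - a / N) * Real.log ‖x‖)) / √N) x i j
            * partialDeriv j (fun y => η y i) x := by
      refine integral_congr_ae ?_
      filter_upwards [weakGrad_coverMap N, hp] with x h1 h2
      rw [h1, h2, frob_coverGrad]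
      rfl
    rw [e, integral_finsetSum]
    · exact Finset.sum_eq_zero fun i _ => integral_frameField_pressure hN ν a c i (hη.isTest i)
    · intro i _
      refine integrable_finsetSum _ fun j _ => ?_
      exact (((hη.isTest i).partialDeriv j).integrable_mul
        (MemLp.locallyIntegrableOn_disk one_le_two
          (memLp_frameField_pressure N ν a c _ i j))).integrableOn

/-- $\nabla u_N$ depends on $\theta$ only. In its $\theta$-derivative the two
$e_\theta(N\theta)\otimes e_R$ terms cancel, leaving $(1-N^2)\,e_R(N\theta)\otimes e_\theta/\sqrt
N$. -/
lemma hasGrad_coverGrad (N : ℕ) (i k : Fin 2) {x : Plane} (hx : x ≠ 0) :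
    HasGrad (fun y => coverGrad N y i k)
      (fun m => (1 - (N : ℝ) ^ 2) / √N * (eT (angle x) k * eR (N * angle x) i
        * eT (angle x) m / ‖x‖)) x := by
  have h1 := ((hasGrad_eR_eT_mul_angle hx N).1 i).mul (hasGrad_eR_angle hx k)
  have h2 := ((hasGrad_eR_eT_mul_angle hx N).2 i).mul (hasGrad_eT_angle hx k)
  have h3 := (h1.add (h2.const_mul N)).const_mul (1 / √(N : ℝ))
  have e : (fun y => coverGrad N y i k) = fun y => 1 / √(N : ℝ) *
      (eR (N * angle y) i * eR (angle y) k + N * (eT (N * angle y) i * eT (angle y) k)) := by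
    funext y
    rw [coverGrad_apply]; ring
  rw [e]
  refine h3.congr_grad fun m => ?_
  ring

lemma contDiffAt_coverGrad (N : ℕ) (i k : Fin 2) {x : Plane} (hx : x ≠ 0) :
    ContDiffAt ℝ ∞ (fun y => coverGrad N y i k) x := by
  simp only [coverGrad_apply]
  exact ((((contDiffAt_eR_eT_mul_angle hx N).1 i).mul (contDiffAt_eR_angle hx k)).add
    (contDiffAt_const.mul (((contDiffAt_eR_eT_mul_angle hx N).2 i).mul
      (contDiffAt_eT_angle hx k)))).div_const _

lemma contDiff_mul_of_zero_notMem_tsupport {φ g : Plane → ℝ} (hφ : ContDiff ℝ ∞ φ)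
    (h0 : (0 : Plane) ∉ tsupport φ) (hg : ∀ x ≠ 0, ContDiffAt ℝ ∞ g x) :
    ContDiff ℝ ∞ (fun x => φ x * g x) := by
  rw [contDiff_iff_contDiffAt]
  intro x
  by_cases hx : x = 0
  · subst hx
    have : (fun y => φ y * g y) =ᶠ[𝓝 0] fun _ => 0 := by
      filter_upwards [notMem_tsupport_iff_eventuallyEq.1 h0] with y hy
      simp [hy]
    exact contDiffAt_const.congr_of_eventuallyEq this
  · exact hφ.contDiffAt.mul (hg x hx)

/-- The test map `φ ∂ₖ u_N`. -/
lemma isTestMap_mul_coverGrad (N : ℕ) (k : Fin 2) {φ : Plane → ℝ} (hφ : IsTest φ)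
    (h0 : (0 : Plane) ∉ tsupport φ) :
    IsTestMap fun x => WithLp.toLp 2 fun i => φ x * coverGrad N x i k := by
  have hs : tsupport (fun x => (WithLp.toLp 2 fun i => φ x * coverGrad N x i k : Plane))
      ⊆ tsupport φ := by
    refine closure_mono fun x hx h => hx ?_
    ext i
    simp [h]
  refine ⟨contDiff_euclidean.2 fun i => ?_, hφ.2.1.mono' (subset_closure.trans hs),
    hs.trans hφ.2.2⟩
  exact contDiff_mul_of_zero_notMem_tsupport hφ.1 h0 fun x hx => contDiffAt_coverGrad N i k hx

/-- By the product rule the sum is $\varphi\,\partial_k\det\nabla u_N+\det\nabla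
u_N\,\partial_k\varphi$. The first term is zero, visible in `e1` as the orthogonality of the
cofactor to $e_R(N\theta)\otimes e_\theta$. -/
lemma sum_cof_coverGrad_mul {N : ℕ} (hN : N ≠ 0) (k : Fin 2) {φ : Plane → ℝ}
    (hφ : IsTest φ) {x : Plane} (hx : x ≠ 0) :
    ∑ i, ∑ j, cof (coverGrad N x) i j * partialDeriv j (fun y => φ y * coverGrad N y i k) x
      = partialDeriv k φ x := by
  have hd := det_coverGrad hN x
  rw [Matrix.det_fin_two] at hd
  have hp : ∀ i j, partialDeriv j (fun y => φ y * coverGrad N y i k) x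
      = φ x * ((1 - (N : ℝ) ^ 2) / √N * (eT (angle x) k * eR (N * angle x) i
        * eT (angle x) j / ‖x‖)) + coverGrad N x i k * partialDeriv j φ x := fun i j =>
    ((hφ.hasGrad x).mul (hasGrad_coverGrad N i k hx)).partialDeriv_eq j
  simp only [hp, mul_add, Finset.sum_add_distrib]
  have e1 : ∑ i, ∑ j, cof (coverGrad N x) i j * (φ x * ((1 - (N : ℝ) ^ 2) / √N
      * (eT (angle x) k * eR (N * angle x) i * eT (angle x) j / ‖x‖))) = 0 := by
    simp only [cof_coverGrad, Fin.sum_univ_two, eT_zero, eT_one]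
    have key : ∀ p q c s t : ℝ,
        (N * (p * c) + -q * -s) / √N * (φ x * ((1 - (N : ℝ) ^ 2) / √N * (t * p * -s / ‖x‖)))
        + (N * (p * s) + -q * c) / √N * (φ x * ((1 - (N : ℝ) ^ 2) / √N * (t * p * c / ‖x‖)))
        + ((N * (q * c) + p * -s) / √N * (φ x * ((1 - (N : ℝ) ^ 2) / √N * (t * q * -s / ‖x‖)))
        + (N * (q * s) + p * c) / √N * (φ x * ((1 - (N : ℝ) ^ 2) / √N * (t * q * c / ‖x‖)))) = 0 := by
      intros
      ring
    exact key _ _ _ _ _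
  rw [e1, zero_add]
  fin_cases k
  · simp [Fin.sum_univ_two, cof]
    linear_combination partialDeriv 0 φ x * hd
  · simp [Fin.sum_univ_two, cof]
    linear_combination partialDeriv 1 φ x * hd

/-- Two pressures of the covering map differ by a constant. -/
lemma pressure_sub_const {N : ℕ} (hN : N ≠ 0) {ν a : ℝ} {p p' : Plane → ℝ}
    (hp : IsPressure (integrand ν a) (coverMap N) p)
    (hp' : IsPressure (integrand ν a) (coverMap N) p') :
    ∃ c, ∀ᵐ x ∂diskMeasure, p x - p' x = c := by
  have hm := hp.2.1.sub hp'.2.1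
  have hi : Integrable p diskMeasure := memLp_one_iff_integrable.1 hp.2.1.1
  have hi' : Integrable p' diskMeasure := memLp_one_iff_integrable.1 hp'.2.1.1
  refine ae_const_of_weakPartial_eq_zero (memLp_one_iff_integrable.1 hm.1) fun k => ?_
  -- The support must avoid the origin, where $\partial_ku_N$ is not smooth. This loses nothing,
  -- since the weak gradient is a function and a point is a null set.
  have key : ∀ φ, IsTest φ → (0 : Plane) ∉ tsupport φ →
      ∫ x in disk, (p x - p' x) * partialDeriv k φ x = 0 := by
    intro φ hφ h0
    set η : Plane → Plane := fun x => WithLp.toLp 2 fun i => φ x * coverGrad N x i k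
    have hη : IsTestMap η := isTestMap_mul_coverGrad N k hφ h0
    let Y : Plane → ℝ := fun x => ∑ i, ∑ j, frameField N (2 * ν * a / √N) (2 * ν * N / √N) x i j
      * partialDeriv j (fun y => η y i) x
    let X : Plane → ℝ := fun x => ∑ i, ∑ j, cof (coverGrad N x) i j
      * partialDeriv j (fun y => η y i) x
    have hbF : ∀ A B i j, IsBddMeas fun x => frameField N A B x i j := fun A B i j =>
      ((IsBddMeas.const A).mul ((IsBddMeas.eR N i).mul (IsBddMeas.eR_angle j))).add
        ((IsBddMeas.const B).mul ((IsBddMeas.eT N i).mul (IsBddMeas.eT_angle j)))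
    have hbη : ∀ i j, IsBddMeas fun x => partialDeriv j (fun y => η y i) x := fun i j =>
      IsBddMeas.of_isTest ((hη.isTest i).partialDeriv j)
    have hbc : ∀ i j, IsBddMeas fun x => cof (coverGrad N x) i j := fun i j => by
      have := hbF (N / √N) (1 / √N) i j
      refine ⟨?_, this.2.imp fun C hC x => ?_⟩
      · simp only [cof_coverGrad]
        fun_prop
      · refine le_trans (le_of_eq ?_) (hC x)
        simp only [cof_coverGrad, frameField]
        congr 1
        ring
    have hY : IsBddMeas Y := by
      simp only [Y, Fin.sum_univ_two]
      exact (((hbF _ _ 0 0).mul (hbη 0 0)).add ((hbF _ _ 0 1).mul (hbη 0 1))).add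
        (((hbF _ _ 1 0).mul (hbη 1 0)).add ((hbF _ _ 1 1).mul (hbη 1 1)))
    have hX : IsBddMeas X := by
      simp only [X, Fin.sum_univ_two]
      exact (((hbc 0 0).mul (hbη 0 0)).add ((hbc 0 1).mul (hbη 0 1))).add
        (((hbc 1 0).mul (hbη 1 0)).add ((hbc 1 1).mul (hbη 1 1)))
    have hYi : Integrable Y diskMeasure := memLp_one_iff_integrable.1 (hY.memLp 1)
    have aux : ∀ r : Plane → ℝ, Integrable r diskMeasure →
        IsPressure (integrand ν a) (coverMap N) r →
        -- The right side does not mention $r$, so subtracting the identities for two pressures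
        -- removes the contribution of $\nabla_\xi f$.
        ∫ x in disk, X x * r x = -(∫ x in disk, Y x) / 2 := by
      intro r hri hr
      have e := hr.2.2 η hη
      have e' : ∫ x in disk, frob (gradXi (integrand ν a) x (weakGrad (coverMap N) x)
          + (2 * r x) • cof (weakGrad (coverMap N) x)) (grad η x)
          = ∫ x in disk, (Y x + 2 * (X x * r x)) := by
        refine integral_congr_ae ?_
        filter_upwards [weakGrad_coverMap N] with x hx
        rw [hx]
        simp only [frob, Matrix.add_apply, Matrix.smul_apply, gradXi_coverGrad, smul_eq_mul, Y, X,
          Fin.sum_univ_two, grad, Matrix.of_apply]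
        ring
      have e2 := integral_add hYi ((hX.integrable_mul hri).const_mul 2)
      rw [integral_const_mul] at e2
      change ∫ x in disk, (Y x + 2 * (X x * r x)) = _ + 2 * ∫ x in disk, X x * r x at e2
      rw [e', e2] at e
      change (∫ x in disk, Y x) + _ = 0 at e
      linarith
    have e1 := aux p hi hp
    have e2 := aux p' hi' hp'
    have e3 : ∫ x in disk, (p x - p' x) * partialDeriv k φ x
        = ∫ x in disk, (X x * p x - X x * p' x) := by
      refine integral_congr_ae ?_
      filter_upwards [ae_diskMeasure_ne_zero] with x hx
      have : X x = partialDeriv k φ x := sum_cof_coverGrad_mul hN k hφ hx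
      rw [this]
      ring
    rw [e3]
    refine (integral_sub (hX.integrable_mul hi) (hX.integrable_mul hi')).trans ?_
    exact sub_eq_zero.2 (e1.trans e2.symm)
  have hW := hm.isWeakPartial k
  refine hW.congr_ae ae_eq_rfl ?_
  have hU : IsOpen (disk \ {(0 : Plane)}) := isOpen_disk.sdiff isClosed_singleton
  have hz := hU.ae_eq_zero_of_integral_contDiff_smul_eq_zero (hW.2.1.mono_set sdiff_subset)
    fun φ h1 h2 h3 => ?_
  · rw [EventuallyEq, diskMeasure, ae_restrict_iff' measurableSet_disk]
    filter_upwards [hz, Measure.ae_ne volume (0 : Plane)] with x hx hx0 hxd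
    exact hx ⟨hxd, hx0⟩
  · have hφ : IsTest φ := ⟨h1, h2, h3.trans sdiff_subset⟩
    have h0 : (0 : Plane) ∉ tsupport φ := fun h => (h3 h).2 rfl
    have e := hW.2.2 φ hφ
    rw [key φ hφ h0, hφ.setIntegral_mul, eq_comm, neg_eq_zero] at e
    simpa only [smul_eq_mul, mul_comm] using e

lemma isPressure_iff {N : ℕ} (hN : N ≠ 0) (ν a : ℝ) (p : Plane → ℝ) :
    IsPressure (integrand ν a) (coverMap N) p ↔
      ∃ c : ℝ, ∀ᵐ x ∂diskMeasure, p x = c + ν * (N - a / N) * Real.log ‖x‖ := by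
  constructor
  · intro hp
    have h0 : IsPressure (integrand ν a) (coverMap N)
        (fun x => 0 + ν * (N - a / N) * Real.log ‖x‖) :=
      isPressure_of_ae_eq hN ν a 0 (Eventually.of_forall fun _ => rfl)
    obtain ⟨c, hc⟩ := pressure_sub_const hN hp h0
    refine ⟨c, hc.mono fun x hx => ?_⟩
    rw [zero_add] at hx
    linarith
  · rintro ⟨c, hc⟩
    exact isPressure_of_ae_eq hN ν a c hc

/-! ### Wirtinger's inequality -/

/-- Wirtinger's inequality for periodic functions. -/
lemma wirtinger {f f' : ℝ → ℝ} (hf : ∀ t, HasDerivAt f (f' t) t) (hf' : Continuous f')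
    (hper : f (-Real.pi) = f Real.pi) :
    ∃ m : ℝ, ∫ t in (-Real.pi)..Real.pi, (f t - m) ^ 2 ≤ ∫ t in (-Real.pi)..Real.pi, f' t ^ 2 := by
  have hab : -Real.pi < Real.pi := by linarith [Real.pi_pos]
  have hfc : Continuous f := continuous_iff_continuousAt.2 fun t => (hf t).continuousAt
  set m : ℝ := (∫ t in (-Real.pi)..Real.pi, f t) / (2 * Real.pi) with hm
  refine ⟨m, ?_⟩
  let G : ℝ → ℂ := fun t => ((f t - m : ℝ) : ℂ)
  let G' : ℝ → ℂ := fun t => (f' t : ℂ)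
  have hG : ∀ t, HasDerivAt G (G' t) t := fun t => ((hf t).sub_const m).ofReal_comp
  have hGc : Continuous G := Complex.continuous_ofReal.comp (hfc.sub continuous_const)
  have hGc' : Continuous G' := Complex.continuous_ofReal.comp hf'
  have hL2 : ∀ H : ℝ → ℂ, Continuous H →
      MemLp H 2 (volume.restrict (Ioc (-Real.pi) Real.pi)) := by
    intro H hH
    obtain ⟨C, hC⟩ := (isCompact_Icc (a := -Real.pi) (b := Real.pi)).exists_bound_of_continuousOn
      hH.continuousOn
    refine MemLp.of_bound hH.aestronglyMeasurable C ?_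
    exact (ae_restrict_mem measurableSet_Ioc).mono fun t ht => hC t (Ioc_subset_Icc_self ht)
  have s1 := hasSum_sq_fourierCoeffOn hab (hL2 G hGc)
  have s2 := hasSum_sq_fourierCoeffOn hab (hL2 G' hGc')
  -- Subtracting the mean removes the zeroth coefficient. For $n\ne0$ periodicity kills the boundary
  -- term, so the coefficients of $G$ and $G'$ differ by a factor of modulus $|n|\ge1$; Parseval
  -- concludes.
  have hle : ∀ n : ℤ, ‖fourierCoeffOn hab G n‖ ^ 2 ≤ ‖fourierCoeffOn hab G' n‖ ^ 2 := by
    intro n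
    by_cases hn : n = 0
    · have h0 : fourierCoeffOn hab G n = 0 := by
        have hz : ∫ t in (-Real.pi)..Real.pi, (f t - m) = 0 := by
          rw [intervalIntegral.integral_sub (hfc.intervalIntegrable _ _) (by simp),
            intervalIntegral.integral_const, hm, smul_eq_mul]
          have := Real.pi_pos
          field_simp
          ring
        rw [fourierCoeffOn_eq_integral, hn]
        have hz' : ∫ t in (-Real.pi)..Real.pi, G t = 0 := by
          simp only [G, intervalIntegral.integral_ofReal, hz, Complex.ofReal_zero]
        simp [hz']
      rw [h0, norm_zero, zero_pow two_ne_zero]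
      positivity
    · have h := fourierCoeffOn_of_hasDerivAt hab hn (fun t _ => hG t)
        (hGc'.intervalIntegrable _ _)
      have hGper : G Real.pi - G (-Real.pi) = 0 := by simp [G, hper]
      rw [hGper, mul_zero, zero_sub] at h
      have hn1 : (1 : ℝ) ≤ |(n : ℝ)| := by
        rw [← Int.cast_abs]
        exact_mod_cast Int.one_le_abs hn
      have hnorm : ‖fourierCoeffOn hab G n‖ = ‖fourierCoeffOn hab G' n‖ / |(n : ℝ)| := by
        have e1 : (((Real.pi : ℝ) : ℂ) - ((-Real.pi : ℝ) : ℂ)) = ((2 * Real.pi : ℝ) : ℂ) := by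
          push_cast; ring
        rw [h, e1, norm_mul, norm_neg, norm_mul, norm_div, norm_mul, norm_mul, norm_mul, norm_neg,
          Complex.norm_I, Complex.norm_real, Complex.norm_intCast, Complex.norm_real, norm_one,
          Real.norm_of_nonneg Real.pi_pos.le, Real.norm_of_nonneg (by positivity),
          Complex.norm_ofNat]
        have := Real.pi_pos
        field_simp
      rw [hnorm]
      gcongr
      exact div_le_self (norm_nonneg _) hn1
  have hsum := hasSum_le hle s1 s2
  have hpos : 0 < (Real.pi - -Real.pi)⁻¹ := inv_pos.2 (by linarith)
  simp only [smul_eq_mul] at hsum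
  have h3 := le_of_mul_le_mul_left hsum hpos
  simpa [G, G', ← Complex.ofReal_sub, Complex.norm_real, sq_abs] using h3

/-- The area enclosed by a closed curve is controlled by its Dirichlet energy. -/
lemma two_mul_abs_integral_mul_deriv_le {f g f' g' : ℝ → ℝ} (hf : ∀ t, HasDerivAt f (f' t) t)
    (hg : ∀ t, HasDerivAt g (g' t) t) (hf' : Continuous f') (hg' : Continuous g')
    (hfp : f (-Real.pi) = f Real.pi) (hgp : g (-Real.pi) = g Real.pi) :
    2 * |∫ t in (-Real.pi)..Real.pi, f t * g' t|
      ≤ ∫ t in (-Real.pi)..Real.pi, (f' t ^ 2 + g' t ^ 2) := by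
  have hab : -Real.pi ≤ Real.pi := by linarith [Real.pi_pos]
  have hfc : Continuous f := continuous_iff_continuousAt.2 fun t => (hf t).continuousAt
  obtain ⟨m, hm⟩ := wirtinger hf hf' hfp
  have e0 : ∫ t in (-Real.pi)..Real.pi, g' t = 0 := by
    rw [intervalIntegral.integral_eq_sub_of_hasDerivAt (fun t _ => hg t)
      (hg'.intervalIntegrable _ _), hgp, sub_self]
  -- As $g'$ has mean zero, $f$ may be replaced by $f-m$. Young's inequality and Wirtinger's
  -- inequality for $f$ then give the bound.
  have e1 : ∫ t in (-Real.pi)..Real.pi, f t * g' t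
      = ∫ t in (-Real.pi)..Real.pi, (f t - m) * g' t := by
    simp only [sub_mul]
    have j1 : IntervalIntegrable (fun t => f t * g' t) volume (-Real.pi) Real.pi :=
      (hfc.mul hg').intervalIntegrable _ _
    have j2 : IntervalIntegrable (fun t => m * g' t) volume (-Real.pi) Real.pi :=
      (continuous_const.mul hg').intervalIntegrable _ _
    rw [intervalIntegral.integral_sub j1 j2, intervalIntegral.integral_const_mul, e0]
    ring
  have i1 : IntervalIntegrable (fun t => (f t - m) ^ 2) volume (-Real.pi) Real.pi :=
    ((hfc.sub continuous_const).pow 2).intervalIntegrable _ _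
  have i2 : IntervalIntegrable (fun t => g' t ^ 2) volume (-Real.pi) Real.pi :=
    (hg'.pow 2).intervalIntegrable _ _
  have i3 : IntervalIntegrable (fun t => f' t ^ 2) volume (-Real.pi) Real.pi :=
    (hf'.pow 2).intervalIntegrable _ _
  have i4 : IntervalIntegrable (fun t => (f t - m) * g' t) volume (-Real.pi) Real.pi :=
    ((hfc.sub continuous_const).mul hg').intervalIntegrable _ _
  rw [e1, intervalIntegral.integral_add i3 i2]
  have h1 : 2 * ∫ t in (-Real.pi)..Real.pi, (f t - m) * g' t
      ≤ (∫ t in (-Real.pi)..Real.pi, (f t - m) ^ 2) + ∫ t in (-Real.pi)..Real.pi, g' t ^ 2 := by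
    rw [← intervalIntegral.integral_const_mul, ← intervalIntegral.integral_add i1 i2]
    exact intervalIntegral.integral_mono_on hab (i4.const_mul 2) (i1.add i2)
      fun t _ => by nlinarith [sq_nonneg (f t - m - g' t)]
  have h2 : -(2 * ∫ t in (-Real.pi)..Real.pi, (f t - m) * g' t)
      ≤ (∫ t in (-Real.pi)..Real.pi, (f t - m) ^ 2) + ∫ t in (-Real.pi)..Real.pi, g' t ^ 2 := by
    rw [← intervalIntegral.integral_const_mul, ← intervalIntegral.integral_neg,
      ← intervalIntegral.integral_add i1 i2]
    exact intervalIntegral.integral_mono_on hab (i4.const_mul 2).neg (i1.add i2)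
      fun t _ => by nlinarith [sq_nonneg (f t - m + g' t)]
  rcases abs_cases (∫ t in (-Real.pi)..Real.pi, (f t - m) * g' t) with h | h <;>
    rw [h.1] <;> linarith

/-! ### Polar coordinates -/

/-- A function on the plane has nonnegative integral if its integrals over circles are so. -/
lemma integral_nonneg_of_circles {h : Plane → ℝ}
    (hr : ∀ r : ℝ, 0 < r →
      0 ≤ ∫ t in Ioo (-Real.pi) Real.pi, h (pt (r * Real.cos t) (r * Real.sin t))) :
    0 ≤ ∫ x, h x := by
  let e : ℝ × ℝ ≃ᵐ Plane :=
    (MeasurableEquiv.finTwoArrow (α := ℝ)).symm.trans (MeasurableEquiv.toLp 2 _)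
  have he : MeasurePreserving e :=
    (PiLp.volume_preserving_toLp (Fin 2)).comp (volume_preserving_finTwoArrow ℝ).symm
  have hes : ∀ s t, e (s, t) = pt s t := fun s t => rfl
  rw [← he.integral_comp e.measurableEmbedding, ← integral_comp_polarCoord_symm]
  by_cases hi : IntegrableOn
      (fun p : ℝ × ℝ => p.1 • h (e (polarCoord.symm p))) polarCoord.target (volume.prod volume)
  · rw [Measure.volume_eq_prod]
    change 0 ≤ ∫ p in Ioi (0 : ℝ) ×ˢ Ioo (-Real.pi) Real.pi, _ ∂(volume.prod volume)
    rw [setIntegral_prod _ hi]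
    refine setIntegral_nonneg measurableSet_Ioi fun r hr0 => ?_
    simp only [polarCoord_symm_apply, hes, smul_eq_mul]
    rw [integral_const_mul]
    exact mul_nonneg (le_of_lt hr0) (hr r hr0)
  -- A function that is not integrable has integral 0 by convention, so no integrability hypothesis
  -- is needed.
  · exact (integral_undef hi).ge

/-- The derivative of `f` along `e_θ`. -/
def angularPartial (f : Plane → ℝ) (x : Plane) : ℝ :=
  eT (angle x) 0 * partialDeriv 0 f x + eT (angle x) 1 * partialDeriv 1 f x

lemma norm_pt_polar {r : ℝ} (hr : 0 < r) (t : ℝ) :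
    ‖pt (r * Real.cos t) (r * Real.sin t)‖ = r := by
  rw [← sq_eq_sq₀ (norm_nonneg _) hr.le, norm_pt_sq]
  linear_combination r ^ 2 * Real.cos_sq_add_sin_sq t

lemma eR_angle_pt_polar {r : ℝ} (hr : 0 < r) (t : ℝ) (j : Fin 2) :
    eR (angle (pt (r * Real.cos t) (r * Real.sin t))) j = eR t j := by
  have hn := norm_pt_polar hr t
  have h0 : pt (r * Real.cos t) (r * Real.sin t) ≠ 0 := by
    rw [← norm_pos_iff, hn]
    exact hr
  rw [eR_angle h0, hn]
  fin_cases j <;> simp [pt, eR] <;> field_simp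

lemma continuous_pt_polar (r : ℝ) :
    Continuous fun t : ℝ => pt (r * Real.cos t) (r * Real.sin t) := by
  refine (PiLp.continuous_toLp 2 _).comp (continuous_pi fun j => ?_)
  fin_cases j <;> simp <;> fun_prop

lemma hasDerivAt_comp_polar {f : Plane → ℝ} (hf : Differentiable ℝ f) {r : ℝ} (hr : 0 < r)
    (t : ℝ) :
    HasDerivAt (fun t => f (pt (r * Real.cos t) (r * Real.sin t)))
      (r * angularPartial f (pt (r * Real.cos t) (r * Real.sin t))) t := by
  have hp : HasDerivAt (fun t : ℝ => pt (r * Real.cos t) (r * Real.sin t))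
      (pt (r * -Real.sin t) (r * Real.cos t)) t := by
    have h : HasDerivAt (fun t : ℝ => ![r * Real.cos t, r * Real.sin t])
        ![r * -Real.sin t, r * Real.cos t] t := by
      refine hasDerivAt_pi.2 fun j => ?_
      fin_cases j
      · exact (Real.hasDerivAt_cos t).const_mul r
      · exact (Real.hasDerivAt_sin t).const_mul r
    exact (PiLp.continuousLinearEquiv 2 ℝ
      (fun _ : Fin 2 => ℝ)).symm.toContinuousLinearMap.hasFDerivAt.comp_hasDerivAt t h
  have hg := HasFDerivAt.comp_hasDerivAt t
    (hasGrad_partialDeriv (hf (pt (r * Real.cos t) (r * Real.sin t)))) hp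
  refine hg.congr_deriv ?_
  rw [gradForm_apply, angularPartial, eT_zero, eT_one, eR_angle_pt_polar hr, eR_angle_pt_polar hr]
  simp [pt, eR]
  ring

lemma continuous_angularPartial_polar {f : Plane → ℝ} (hf : ContDiff ℝ ∞ f) {r : ℝ} (hr : 0 < r) :
    Continuous fun t => angularPartial f (pt (r * Real.cos t) (r * Real.sin t)) := by
  have hc : ∀ j, Continuous (partialDeriv j f) := fun j =>
    (hf.continuous_fderiv (by simp)).clm_apply continuous_const
  have h0 := (hc 0).comp (continuous_pt_polar r)
  have h1 := (hc 1).comp (continuous_pt_polar r)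
  simp only [angularPartial, eT_zero, eT_one, eR_angle_pt_polar hr]
  have c0 : Continuous fun t => eR t 0 := by simp [eR]; fun_prop
  have c1 : Continuous fun t => eR t 1 := by simp [eR]; fun_prop
  exact (c1.neg.mul h0).add (c0.mul h1)

/-- On the circle of radius $r$ the polar derivative is $r$ times the derivative along $e_\theta$,
so the area inequality gives $2|\int f\,\partial_\tau g|\le r\int(|\partial_\tau f|^2+|\partial_\tau
g|^2)$, and the weight is at most $1/r$. The signs $\sigma=\pm1$ later produce an absolute value. -/
lemma integral_angularPartial_nonneg {f g : Plane → ℝ} (hf : ContDiff ℝ ∞ f)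
    (hg : ContDiff ℝ ∞ g) {σ ε : ℝ} (hσ : |σ| = 1) :
    0 ≤ ∫ x, (angularPartial f x ^ 2 + angularPartial g x ^ 2
      + 2 * σ * (f x * (‖x‖ / (‖x‖ ^ 2 + ε ^ 2) * angularPartial g x))) := by
  refine integral_nonneg_of_circles fun r hr => ?_
  have hab : -Real.pi ≤ Real.pi := by linarith [Real.pi_pos]
  rw [← integral_Ioc_eq_integral_Ioo, ← intervalIntegral.integral_of_le hab]
  simp only [norm_pt_polar hr]
  have cf := continuous_angularPartial_polar hf hr
  have cg := continuous_angularPartial_polar hg hr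
  have hper : ∀ u : Plane → ℝ, u (pt (r * Real.cos (-Real.pi)) (r * Real.sin (-Real.pi)))
      = u (pt (r * Real.cos Real.pi) (r * Real.sin Real.pi)) := fun u => by simp
  have key := two_mul_abs_integral_mul_deriv_le
    (hasDerivAt_comp_polar (hf.differentiable (by simp)) hr)
    (hasDerivAt_comp_polar (hg.differentiable (by simp)) hr)
    (continuous_const.mul cf) (continuous_const.mul cg) (hper f) (hper g)
  have cF := hf.continuous.comp (continuous_pt_polar r)
  set F := fun t : ℝ => f (pt (r * Real.cos t) (r * Real.sin t))
  set u := fun t : ℝ => angularPartial f (pt (r * Real.cos t) (r * Real.sin t))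
  set v := fun t : ℝ => angularPartial g (pt (r * Real.cos t) (r * Real.sin t))
  change 0 ≤ ∫ t in (-Real.pi)..Real.pi, (u t ^ 2 + v t ^ 2
    + 2 * σ * (F t * (r / (r ^ 2 + ε ^ 2) * v t)))
  change 2 * |∫ t in (-Real.pi)..Real.pi, F t * (r * v t)|
    ≤ ∫ t in (-Real.pi)..Real.pi, ((r * u t) ^ 2 + (r * v t) ^ 2) at key
  have k1 : ∫ t in (-Real.pi)..Real.pi, F t * (r * v t)
      = r * ∫ t in (-Real.pi)..Real.pi, F t * v t := by
    rw [← intervalIntegral.integral_const_mul]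
    congr 1
    funext t
    ring
  have k2 : ∫ t in (-Real.pi)..Real.pi, ((r * u t) ^ 2 + (r * v t) ^ 2)
      = r ^ 2 * ∫ t in (-Real.pi)..Real.pi, (u t ^ 2 + v t ^ 2) := by
    rw [← intervalIntegral.integral_const_mul]
    congr 1
    funext t
    ring
  have k3 : ∫ t in (-Real.pi)..Real.pi, (u t ^ 2 + v t ^ 2
        + 2 * σ * (F t * (r / (r ^ 2 + ε ^ 2) * v t)))
      = (∫ t in (-Real.pi)..Real.pi, (u t ^ 2 + v t ^ 2))
        + 2 * σ * (r / (r ^ 2 + ε ^ 2)) * ∫ t in (-Real.pi)..Real.pi, F t * v t := by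
    have j1 : IntervalIntegrable (fun t => u t ^ 2 + v t ^ 2) volume (-Real.pi) Real.pi :=
      ((cf.pow 2).add (cg.pow 2)).intervalIntegrable _ _
    have j2 : IntervalIntegrable (fun t => 2 * σ * (r / (r ^ 2 + ε ^ 2)) * (F t * v t)) volume
        (-Real.pi) Real.pi :=
      (continuous_const.mul (cF.mul cg)).intervalIntegrable _ _
    rw [← intervalIntegral.integral_const_mul, ← intervalIntegral.integral_add j1 j2]
    congr 1
    funext t
    ring
  rw [k1, k2, abs_mul, abs_of_pos hr] at key
  rw [k3]
  set I := ∫ t in (-Real.pi)..Real.pi, F t * v t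
  set A := ∫ t in (-Real.pi)..Real.pi, (u t ^ 2 + v t ^ 2)
  have hk : 2 * |I| ≤ r * A := by
    have : r * (2 * |I|) ≤ r * (r * A) := by linarith
    exact le_of_mul_le_mul_left this hr
  have hA : 0 ≤ A := intervalIntegral.integral_nonneg hab fun t _ => by positivity
  have hq : 0 ≤ r / (r ^ 2 + ε ^ 2) := by positivity
  have hq1 : r / (r ^ 2 + ε ^ 2) * r ≤ 1 := by
    rw [div_mul_eq_mul_div, div_le_one (by positivity)]
    nlinarith [sq_nonneg ε]
  have h1 : |2 * σ * (r / (r ^ 2 + ε ^ 2)) * I| ≤ A := by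
    rw [abs_mul, abs_mul, abs_mul, hσ, abs_of_nonneg hq, abs_two]
    calc 2 * 1 * (r / (r ^ 2 + ε ^ 2)) * |I| = r / (r ^ 2 + ε ^ 2) * (2 * |I|) := by ring
      _ ≤ r / (r ^ 2 + ε ^ 2) * (r * A) := mul_le_mul_of_nonneg_left hk hq
      _ = r / (r ^ 2 + ε ^ 2) * r * A := by ring
      _ ≤ 1 * A := mul_le_mul_of_nonneg_right hq1 hA
      _ = A := one_mul A
  linarith [(abs_le.1 h1).1]

/-! ### The weighted determinant of test maps -/

/-- A smooth approximation of `log ‖x‖`. -/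
def regLog (ε : ℝ) (x : Plane) : ℝ := Real.log (‖x‖ ^ 2 + ε ^ 2) / 2

lemma hasGrad_regLog {ε : ℝ} (hε : 0 < ε) {x : Plane} (hx : x ≠ 0) :
    HasGrad (regLog ε) (fun j => x j / (‖x‖ ^ 2 + ε ^ 2)) x := by
  have hn : ‖x‖ ≠ 0 := by simpa using hx
  have hp : ‖x‖ ^ 2 + ε ^ 2 ≠ 0 := by positivity
  have h1 : HasDerivAt (fun r : ℝ => Real.log (r ^ 2 + ε ^ 2) / 2)
      ((2 * ‖x‖ / (‖x‖ ^ 2 + ε ^ 2)) / 2) ‖x‖ := by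
    have := (((hasDerivAt_pow 2 ‖x‖).add_const (ε ^ 2)).log hp).div_const 2
    simpa using this
  refine ((hasGrad_norm hx).comp h1).congr_grad fun j => ?_
  field_simp

lemma continuous_regLog {ε : ℝ} (hε : 0 < ε) : Continuous (regLog ε) := by
  unfold regLog
  refine (Continuous.log (by fun_prop) fun x => ?_).div_const 2
  positivity

lemma partialDeriv_comm {f : Plane → ℝ} (hf : ContDiff ℝ ∞ f) (i j : Fin 2) (x : Plane) :
    partialDeriv i (partialDeriv j f) x = partialDeriv j (partialDeriv i f) x := by
  have hs : IsSymmSndFDerivAt ℝ f x := (contDiff_infty.1 hf 2).contDiffAt.isSymmSndFDerivAt (by simp)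
  have hd : DifferentiableAt ℝ (fderiv ℝ f) x :=
    (hf.fderiv_right (m := ∞) (by simp)).differentiable (by simp) x
  have e : ∀ i j, partialDeriv i (partialDeriv j f) x
      = fderiv ℝ (fderiv ℝ f) x (EuclideanSpace.single i 1) (EuclideanSpace.single j 1) := by
    intro i j
    have := (hd.hasFDerivAt.clm_apply (hasFDerivAt_const (EuclideanSpace.single j (1 : ℝ)) x)).fderiv
    change fderiv ℝ (fun y => fderiv ℝ f y (EuclideanSpace.single j 1)) x _ = _
    rw [this]
    simp
  rw [e, e, hs]

/-- The determinant of the gradient of the map `(f, g)`. -/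
def jac (f g : Plane → ℝ) (x : Plane) : ℝ :=
  partialDeriv 0 f x * partialDeriv 1 g x - partialDeriv 1 f x * partialDeriv 0 g x

/-- The Jacobian is the divergence $\partial_0(f\partial_1g)-\partial_1(f\partial_0g)$. The weight
has radial gradient $x/(|x|^2+\varepsilon^2)$, so after integration by parts only the derivative of
$g$ along $e_\theta$ survives. -/
lemma integral_regLog_mul_jac {ε : ℝ} (hε : 0 < ε) {f g : Plane → ℝ} (hf : IsTest f)
    (hg : IsTest g) :
    ∫ x in disk, regLog ε x * jac f g x
      = -∫ x in disk, f x * (‖x‖ / (‖x‖ ^ 2 + ε ^ 2) * angularPartial g x) := by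
  have hL : LocallyIntegrableOn (regLog ε) disk :=
    (continuous_regLog hε).locallyIntegrable.locallyIntegrableOn _
  have hD : ∀ j : Fin 2, LocallyIntegrableOn (fun x : Plane => x j / (‖x‖ ^ 2 + ε ^ 2)) disk := by
    intro j
    have : Continuous (fun x : Plane => x j / (‖x‖ ^ 2 + ε ^ 2)) := by
      refine Continuous.div (by fun_prop) (by fun_prop) fun x => ?_
      positivity
    exact this.locallyIntegrable.locallyIntegrableOn _
  have hW := fun j : Fin 2 => isWeakPartial_of_hasGrad j
    (fun x hx => hasGrad_regLog hε hx) hL (hD j)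
  have t0 := hf.mul_left (hg.partialDeriv 1).1
  have t1 := hf.mul_left (hg.partialDeriv 0).1
  have e0 := (hW 0).2.2 _ t0
  have e1 := (hW 1).2.2 _ t1
  have p0 : ∀ x, jac f g x = partialDeriv 0 (fun x => f x * partialDeriv 1 g x) x
      - partialDeriv 1 (fun x => f x * partialDeriv 0 g x) x := by
    intro x
    rw [((hf.hasGrad x).mul ((hg.partialDeriv 1).hasGrad x)).partialDeriv_eq,
      ((hf.hasGrad x).mul ((hg.partialDeriv 0).hasGrad x)).partialDeriv_eq,
      partialDeriv_comm hg.1 0 1, jac]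
    ring
  simp only [p0, mul_sub]
  rw [integral_sub ((t0.partialDeriv 0).integrable_mul hL).integrableOn
    ((t1.partialDeriv 1).integrable_mul hL).integrableOn, e0, e1, neg_sub_neg, ← neg_sub,
    ← integral_sub (t0.integrable_mul (hD 0)).integrableOn (t1.integrable_mul (hD 1)).integrableOn]
  congr 2
  funext x
  rw [angularPartial, eT_zero, eT_one]
  have h0 := norm_smul_eR_angle x 0
  have h1 := norm_smul_eR_angle x 1
  rw [← h0, ← h1]
  ring

lemma angularPartial_eq_zero {f : Plane → ℝ} (hf : IsTest f) {x : Plane} (hx : x ∉ disk) :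
    angularPartial f x = 0 := by
  rw [angularPartial, (hf.partialDeriv 0).eq_zero hx, (hf.partialDeriv 1).eq_zero hx]
  ring

lemma IsBddMeas.angularPartial {f : Plane → ℝ} (hf : IsTest f) : IsBddMeas (angularPartial f) :=
  ((IsBddMeas.eT_angle 0).mul (IsBddMeas.of_isTest (hf.partialDeriv 0))).add
    ((IsBddMeas.eT_angle 1).mul (IsBddMeas.of_isTest (hf.partialDeriv 1)))

lemma IsBddMeas.norm_div {ε : ℝ} (hε : 0 < ε) :
    IsBddMeas fun x : Plane => ‖x‖ / (‖x‖ ^ 2 + ε ^ 2) := by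
  refine ⟨by fun_prop, 1 / ε, fun x => ?_⟩
  rw [abs_of_nonneg (by positivity), div_le_div_iff₀ (by positivity) hε]
  nlinarith [sq_nonneg (‖x‖ - ε), norm_nonneg x, sq_nonneg ‖x‖]

/-- The determinant of a test map, weighted by the regularized logarithm, is controlled by the
energy in angular direction. -/
lemma two_mul_abs_integral_regLog_mul_jac_le {ε : ℝ} (hε : 0 < ε) {f g : Plane → ℝ}
    (hf : IsTest f) (hg : IsTest g) :
    2 * |∫ x in disk, regLog ε x * jac f g x|
      ≤ ∫ x in disk, (angularPartial f x ^ 2 + angularPartial g x ^ 2) := by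
  have key : ∀ σ : ℝ, |σ| = 1 → 0 ≤ (∫ x in disk, (angularPartial f x ^ 2
      + angularPartial g x ^ 2))
      + 2 * σ * ∫ x in disk, f x * (‖x‖ / (‖x‖ ^ 2 + ε ^ 2) * angularPartial g x) := by
    intro σ hσ
    have h := integral_angularPartial_nonneg hf.1 hg.1 (ε := ε) hσ
    rw [← setIntegral_disk_eq fun x hx => by
      rw [angularPartial_eq_zero hf hx, angularPartial_eq_zero hg hx]; ring] at h
    have b1 : IsBddMeas fun x => angularPartial f x ^ 2 + angularPartial g x ^ 2 := by
      simp only [sq]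
      exact ((IsBddMeas.angularPartial hf).mul (IsBddMeas.angularPartial hf)).add
        ((IsBddMeas.angularPartial hg).mul (IsBddMeas.angularPartial hg))
    have b2 := (IsBddMeas.const (2 * σ)).mul ((IsBddMeas.of_isTest hf).mul
      ((IsBddMeas.norm_div hε).mul (IsBddMeas.angularPartial hg)))
    have e := integral_add (memLp_one_iff_integrable.1 (b1.memLp 1))
      (memLp_one_iff_integrable.1 (b2.memLp 1))
    rw [integral_const_mul] at e
    exact h.trans_eq e
  have k1 := key 1 (by simp)
  have k2 := key (-1) (by simp)
  rw [integral_regLog_mul_jac hε hf hg, abs_neg]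
  rcases abs_cases (∫ x in disk, f x * (‖x‖ / (‖x‖ ^ 2 + ε ^ 2) * angularPartial g x)) with h | h <;>
    rw [h.1] <;> linarith

/-! ### Passing to the limit in products -/

lemma tendsto_integral_mul {α : Type*} [MeasurableSpace α] {μ : Measure α} {f g : α → ℝ}
    {F G : ℕ → α → ℝ} (hf : MemLp f 2 μ) (hg : MemLp g 2 μ) (hF : ∀ n, MemLp (F n) 2 μ)
    (hG : ∀ n, MemLp (G n) 2 μ) (hFf : Tendsto (fun n => eLpNorm (F n - f) 2 μ) atTop (𝓝 0))
    (hGg : Tendsto (fun n => eLpNorm (G n - g) 2 μ) atTop (𝓝 0)) :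
    Tendsto (fun n => ∫ x, F n x * G n x ∂μ) atTop (𝓝 (∫ x, f x * g x ∂μ)) := by
  have t1 := (Lp.tendsto_Lp_iff_tendsto_eLpNorm'' F hF f hf).2 hFf
  have t2 := (Lp.tendsto_Lp_iff_tendsto_eLpNorm'' G hG g hg).2 hGg
  have e : ∀ (u v : α → ℝ) (hu : MemLp u 2 μ) (hv : MemLp v 2 μ),
      inner ℝ (hu.toLp u) (hv.toLp v) = ∫ x, u x * v x ∂μ := by
    intro u v hu hv
    rw [L2.inner_def]
    refine integral_congr_ae ?_
    filter_upwards [hu.coeFn_toLp, hv.coeFn_toLp] with x h1 h2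
    rw [h1, h2]
    simp [mul_comm]
  have t := t1.inner (𝕜 := ℝ) t2
  simpa only [e] using t

lemma IsBddMeas.tendsto_eLpNorm_mul {b f : Plane → ℝ} {F : ℕ → Plane → ℝ} (hb : IsBddMeas b)
    (hFf : Tendsto (fun n => eLpNorm (F n - f) 2 diskMeasure) atTop (𝓝 0)) :
    Tendsto (fun n => eLpNorm ((fun x => b x * F n x) - fun x => b x * f x) 2 diskMeasure)
      atTop (𝓝 0) := by
  obtain ⟨C, hC⟩ := hb.2
  have h0 : Tendsto (fun n => ENNReal.ofReal C * eLpNorm (F n - f) 2 diskMeasure) atTop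
      (𝓝 (ENNReal.ofReal C * 0)) :=
    ENNReal.Tendsto.const_mul hFf (Or.inr ENNReal.ofReal_ne_top)
  rw [mul_zero] at h0
  refine tendsto_of_tendsto_of_tendsto_of_le_of_le tendsto_const_nhds h0 (fun _ => zero_le) ?_
  intro n
  refine eLpNorm_le_mul_eLpNorm_of_ae_le_mul (Eventually.of_forall fun x => ?_) 2
  simp only [Pi.sub_apply, ← mul_sub, norm_mul]
  exact mul_le_mul_of_nonneg_right (hC x) (norm_nonneg _)

lemma tendsto_eLpNorm_add {f g : Plane → ℝ} {F G : ℕ → Plane → ℝ}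
    (hf : MemLp f 2 diskMeasure) (hg : MemLp g 2 diskMeasure)
    (hF : ∀ n, MemLp (F n) 2 diskMeasure) (hG : ∀ n, MemLp (G n) 2 diskMeasure)
    (hFf : Tendsto (fun n => eLpNorm (F n - f) 2 diskMeasure) atTop (𝓝 0))
    (hGg : Tendsto (fun n => eLpNorm (G n - g) 2 diskMeasure) atTop (𝓝 0)) :
    Tendsto (fun n => eLpNorm ((fun x => F n x + G n x) - fun x => f x + g x) 2 diskMeasure)
      atTop (𝓝 0) := by
  have h0 := hFf.add hGg
  rw [add_zero] at h0
  refine tendsto_of_tendsto_of_tendsto_of_le_of_le tendsto_const_nhds h0 (fun _ => zero_le) ?_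
  intro n
  have e : ((fun x => F n x + G n x) - fun x => f x + g x) = (F n - f) + (G n - g) := by
    funext x
    simp only [Pi.sub_apply, Pi.add_apply]
    ring
  simp only [e]
  exact eLpNorm_add_le ((hF n).sub hf).1 ((hG n).sub hg).1 one_le_two

/-! ### Functions with zero boundary values -/

lemma MemSobolevZero.exists_seq {w : Plane → ℝ} (h : MemSobolevZero w) :
    ∃ ψ : ℕ → Plane → ℝ, (∀ n, IsTest (ψ n)) ∧
      Tendsto (fun n => eLpNorm (ψ n - w) 2 diskMeasure) atTop (𝓝 0) ∧
      ∀ j, Tendsto (fun n => eLpNorm (partialDeriv j (ψ n) - weakPartial j w) 2 diskMeasure)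
        atTop (𝓝 0) := by
  have hpos : ∀ n : ℕ, (0 : ℝ≥0∞) < ((n : ℝ≥0∞) + 1)⁻¹ := fun n =>
    ENNReal.inv_pos.2 (by finiteness)
  choose ψ h1 h2 h3 using fun n : ℕ => h.2 _ (hpos n)
  have hlim : Tendsto (fun n : ℕ => ((n : ℝ≥0∞) + 1)⁻¹) atTop (𝓝 0) := by
    have := (tendsto_add_atTop_iff_nat (f := fun n : ℕ => (n : ℝ≥0∞)⁻¹) 1).2
      ENNReal.tendsto_inv_nat_nhds_zero
    simpa using this
  refine ⟨ψ, h1, ?_, fun j => ?_⟩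
  · refine tendsto_of_tendsto_of_tendsto_of_le_of_le tendsto_const_nhds hlim
      (fun _ => zero_le) fun n => ?_
    rw [eLpNorm_sub_comm]
    exact (h2 n).le
  · refine tendsto_of_tendsto_of_tendsto_of_le_of_le tendsto_const_nhds hlim
      (fun _ => zero_le) fun n => ?_
    rw [eLpNorm_sub_comm]
    exact (h3 n j).le

lemma tendsto_eLpNorm_self {f : Plane → ℝ} :
    Tendsto (fun _ : ℕ => eLpNorm (f - f) 2 diskMeasure) atTop (𝓝 0) := by
  simp

/-- Weak divergence-freeness extends from test functions to `W_0^{1,2}`. -/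
lemma integral_field_mul_weakPartial_eq_zero {F : Fin 2 → Plane → ℝ}
    (hF : ∀ j, MemLp (F j) 2 diskMeasure)
    (h : ∀ φ, IsTest φ → ∫ x in disk, ∑ j, F j x * partialDeriv j φ x = 0) {w : Plane → ℝ}
    (hw : MemSobolevZero w) : ∫ x in disk, ∑ j, F j x * weakPartial j w x = 0 := by
  obtain ⟨ψ, hψ, -, h2⟩ := hw.exists_seq
  have hp : ∀ j n, MemLp (partialDeriv j (ψ n)) 2 diskMeasure := fun j n =>
    ((hψ n).partialDeriv j).memLp 2
  have t := fun j => tendsto_integral_mul (hF j) (hw.1.memLp_weakPartial j) (fun _ => hF j)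
    (hp j) tendsto_eLpNorm_self (h2 j)
  have ts := tendsto_finsetSum Finset.univ fun j _ => t j
  have e1 : ∫ x in disk, ∑ j, F j x * weakPartial j w x
      = ∑ j, ∫ x in disk, F j x * weakPartial j w x :=
    integral_finsetSum _ fun j _ => (hF j).integrable_mul (hw.1.memLp_weakPartial j)
  have e2 : ∀ n, ∑ j, ∫ x in disk, F j x * partialDeriv j (ψ n) x = 0 := fun n => by
    rw [← h (ψ n) (hψ n)]
    exact (integral_finsetSum _ fun j _ => (hF j).integrable_mul (hp j n)).symm
  rw [e1]
  refine tendsto_nhds_unique ts ?_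
  change Tendsto (fun n => ∑ j, ∫ x in disk, F j x * partialDeriv j (ψ n) x) _ _
  simp only [e2]
  exact tendsto_const_nhds

/-- A function in `W_0^{1,2}` with vanishing weak gradient vanishes. -/
lemma MemSobolevZero.ae_eq_zero {w : Plane → ℝ} (h : MemSobolevZero w)
    (hz : ∀ j, weakPartial j w =ᵐ[diskMeasure] 0) : ∀ᵐ x ∂diskMeasure, w x = 0 := by
  obtain ⟨c, hc⟩ := ae_const_of_weakPartial_eq_zero (h.1.1.integrable one_le_two)
    fun j => (h.1.isWeakPartial j).congr_ae ae_eq_rfl (hz j)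
  obtain ⟨ψ, hψ, h1, h2⟩ := h.exists_seq
  have hx0 : MemLp (fun x : Plane => x 0) 2 diskMeasure := by
    refine MemLp.of_bound (by fun_prop) 1 ?_
    filter_upwards [ae_diskMeasure_mem] with x hx
    exact (abs_coord_le_norm x 0).trans (norm_lt_one_of_mem_disk hx).le
  have h1c : MemLp (fun _ : Plane => (1 : ℝ)) 2 diskMeasure := memLp_const 1
  have t1 := tendsto_integral_mul h1c h.1.1 (fun _ => h1c) (fun n => (hψ n).memLp 2)
    tendsto_eLpNorm_self h1
  have t2 := tendsto_integral_mul hx0 (h.1.memLp_weakPartial 0) (fun _ => hx0)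
    (fun n => ((hψ n).partialDeriv 0).memLp 2) tendsto_eLpNorm_self (h2 0)
  have hW := isWeakPartial_of_hasGrad 0 (fun x _ => hasGrad_coord 0 x)
    (MemLp.locallyIntegrableOn_disk one_le_two hx0) (by
      simpa using MemLp.locallyIntegrableOn_disk one_le_two h1c)
  -- Since $\partial_0x_0=1$, the mean of a test function is minus the pairing of $x_0$ with its
  -- derivative. In the limit the mean of $w$ is zero, so the constant is zero.
  have e : ∀ n, ∫ x, (1 : ℝ) * ψ n x ∂diskMeasure
      = -∫ x, x 0 * partialDeriv 0 (ψ n) x ∂diskMeasure := by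
    intro n
    have := hW.2.2 _ (hψ n)
    simp only [if_true] at this
    change _ = -∫ x in disk, x 0 * partialDeriv 0 (ψ n) x
    rw [this, neg_neg]
    rfl
  have t3 := t2.neg
  simp only [← e] at t3
  have e3 := tendsto_nhds_unique t1 t3
  have e4 : ∫ x, x 0 * weakPartial 0 w x ∂diskMeasure = 0 := by
    refine integral_eq_zero_of_ae ?_
    filter_upwards [hz 0] with x hx
    simp [hx]
  have e5 : ∫ x, (1 : ℝ) * w x ∂diskMeasure = diskMeasure.real univ * c := by
    rw [← smul_eq_mul, ← integral_const]
    refine integral_congr_ae ?_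
    filter_upwards [hc] with x hx
    rw [hx, one_mul]
  rw [e4, neg_zero, e5] at e3
  have hv : diskMeasure.real univ ≠ 0 := by
    rw [measureReal_def, diskMeasure, Measure.restrict_apply_univ, ENNReal.toReal_ne_zero]
    exact ⟨(Metric.measure_ball_pos volume _ one_pos).ne', Metric.isBounded_ball.measure_lt_top.ne⟩
  have hc0 : c = 0 := (mul_eq_zero.1 e3).resolve_left hv
  exact hc.mono fun x hx => hx.trans hc0

lemma memSobolevZero_zero : MemSobolevZero fun _ => 0 := by
  have hW : ∀ j, IsWeakPartial j (fun _ : Plane => (0 : ℝ)) (fun _ => 0) := fun j =>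
    ⟨locallyIntegrableOn_zero, locallyIntegrableOn_zero, fun φ _ => by simp⟩
  refine ⟨⟨MemLp.zero', fun j => ⟨_, hW j, MemLp.zero'⟩⟩, fun ε hε => ⟨fun _ => 0, ?_, ?_, ?_⟩⟩
  · refine ⟨contDiff_const, HasCompactSupport.zero, ?_⟩
    have : tsupport (fun _ : Plane => (0 : ℝ)) = ∅ := by simp [tsupport]
    rw [this]
    exact empty_subset _
  · simpa using hε
  · intro j
    have : (fun x => weakPartial j (fun _ => 0) x - partialDeriv j (fun _ => 0) x)
        =ᵐ[diskMeasure] 0 := by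
      filter_upwards [(hW j).weakPartial_ae_eq] with x hx
      simp [hx, partialDeriv]
    rw [eLpNorm_congr_ae this]
    simpa using hε

/-! ### The logarithmically weighted determinant -/

/-- The derivative of `w` along `e_θ`, in the weak sense. -/
def weakAngularPartial (w : Plane → ℝ) (x : Plane) : ℝ :=
  eT (angle x) 0 * weakPartial 0 w x + eT (angle x) 1 * weakPartial 1 w x

/-- The determinant of the weak gradient of the map `(v, w)`. -/
def weakJac (v w : Plane → ℝ) (x : Plane) : ℝ :=
  weakPartial 0 v x * weakPartial 1 w x - weakPartial 1 v x * weakPartial 0 w x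

lemma MemSobolev.memLp_weakAngularPartial {w : Plane → ℝ} (h : MemSobolev 2 w) :
    MemLp (weakAngularPartial w) 2 diskMeasure :=
  ((IsBddMeas.eT_angle 0).memLp_mul (h.memLp_weakPartial 0)).add
    ((IsBddMeas.eT_angle 1).memLp_mul (h.memLp_weakPartial 1))

lemma abs_regLog_le {ε : ℝ} (hε : 0 < ε) {x : Plane} (hx : x ∈ disk) :
    |regLog ε x| ≤ (1 + ε ^ 2) + (ε ^ 2)⁻¹ := by
  have h1 := norm_lt_one_of_mem_disk hx
  have h0 := norm_nonneg x
  have hy : 0 < ‖x‖ ^ 2 + ε ^ 2 := by positivity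
  have hy1 : ‖x‖ ^ 2 + ε ^ 2 ≤ 1 + ε ^ 2 := by nlinarith
  have hle : Real.log (‖x‖ ^ 2 + ε ^ 2) ≤ ‖x‖ ^ 2 + ε ^ 2 - 1 := Real.log_le_sub_one_of_pos hy
  have hge : 1 - (‖x‖ ^ 2 + ε ^ 2)⁻¹ ≤ Real.log (‖x‖ ^ 2 + ε ^ 2) := Real.one_sub_inv_le_log_of_pos hy
  have hinv : (‖x‖ ^ 2 + ε ^ 2)⁻¹ ≤ (ε ^ 2)⁻¹ := by
    gcongr
    nlinarith
  have hp : 0 < (ε ^ 2)⁻¹ := by positivity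
  have hp2 : 0 < ε ^ 2 := by positivity
  rw [regLog, abs_le]
  constructor <;> linarith

lemma isBddMeas_indicator_regLog {ε : ℝ} (hε : 0 < ε) :
    IsBddMeas (disk.indicator (regLog ε)) := by
  refine ⟨(continuous_regLog hε).measurable.indicator measurableSet_disk,
    (1 + ε ^ 2) + (ε ^ 2)⁻¹, fun x => ?_⟩
  by_cases hx : x ∈ disk
  · rw [indicator_of_mem hx]
    exact abs_regLog_le hε hx
  · rw [indicator_of_notMem hx, abs_zero]
    positivity

/-- For fixed $\varepsilon$ the weight is bounded on the disk, so both sides are continuous under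
$L^2$ convergence of gradients and the inequality passes from test functions to the closure. -/
lemma two_mul_abs_integral_regLog_mul_weakJac_le {ε : ℝ} (hε : 0 < ε) {v w : Plane → ℝ}
    (hv : MemSobolevZero v) (hw : MemSobolevZero w) :
    2 * |∫ x in disk, regLog ε x * weakJac v w x|
      ≤ ∫ x in disk, (weakAngularPartial v x ^ 2 + weakAngularPartial w x ^ 2) := by
  obtain ⟨φ, hφ, -, hφ'⟩ := hv.exists_seq
  obtain ⟨ψ, hψ, -, hψ'⟩ := hw.exists_seq
  set b := disk.indicator (regLog ε) with hb
  have hbm : IsBddMeas b := isBddMeas_indicator_regLog hε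
  have mφ := fun j n => ((hφ n).partialDeriv j).memLp 2
  have mψ := fun j n => ((hψ n).partialDeriv j).memLp 2
  have mv := hv.1.memLp_weakPartial
  have mw := hw.1.memLp_weakPartial
  have tJ := fun i j => tendsto_integral_mul (hbm.memLp_mul (mv i)) (mw j)
    (fun n => hbm.memLp_mul (mφ i n)) (mψ j) (hbm.tendsto_eLpNorm_mul (hφ' i)) (hψ' j)
  have eJ : ∀ f g f' g' : Plane → ℝ, MemLp f 2 diskMeasure → MemLp g 2 diskMeasure →
      MemLp f' 2 diskMeasure → MemLp g' 2 diskMeasure →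
      ∫ x in disk, regLog ε x * (f x * g' x - f' x * g x)
        = (∫ x, b x * f x * g' x ∂diskMeasure) - ∫ x, b x * f' x * g x ∂diskMeasure := by
    intro f g f' g' hf hg hf' hg'
    have hs := integral_sub ((hbm.memLp_mul hf).integrable_mul hg')
      ((hbm.memLp_mul hf').integrable_mul hg)
    simp only [Pi.mul_apply] at hs
    rw [← hs]
    refine integral_congr_ae ?_
    filter_upwards [ae_diskMeasure_mem] with x hx
    rw [hb, indicator_of_mem hx]
    ring
  have t1 : Tendsto (fun n => ∫ x in disk, regLog ε x * jac (φ n) (ψ n) x) atTop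
      (𝓝 (∫ x in disk, regLog ε x * weakJac v w x)) := by
    have := (tJ 0 1).sub (tJ 1 0)
    simp only [jac, weakJac]
    rw [eJ _ _ _ _ (mv 0) (mw 0) (mv 1) (mw 1)]
    refine this.congr fun n => ?_
    rw [eJ _ _ _ _ (mφ 0 n) (mψ 0 n) (mφ 1 n) (mψ 1 n)]
  have tA : ∀ (u : Plane → ℝ) (χ : ℕ → Plane → ℝ), MemSobolev 2 u → (∀ n, IsTest (χ n)) →
      (∀ j, Tendsto (fun n => eLpNorm (partialDeriv j (χ n) - weakPartial j u) 2 diskMeasure)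
        atTop (𝓝 0)) →
      Tendsto (fun n => ∫ x in disk, angularPartial (χ n) x ^ 2) atTop
        (𝓝 (∫ x in disk, weakAngularPartial u x ^ 2)) := by
    intro u χ hu hχ hlim
    have c0 := IsBddMeas.eT_angle 0
    have c1 := IsBddMeas.eT_angle 1
    have l := tendsto_eLpNorm_add (c0.memLp_mul (hu.memLp_weakPartial 0))
      (c1.memLp_mul (hu.memLp_weakPartial 1))
      (fun n => c0.memLp_mul (((hχ n).partialDeriv 0).memLp 2))
      (fun n => c1.memLp_mul (((hχ n).partialDeriv 1).memLp 2))
      (c0.tendsto_eLpNorm_mul (hlim 0)) (c1.tendsto_eLpNorm_mul (hlim 1))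
    have hm := fun n => (IsBddMeas.angularPartial (hχ n)).memLp 2
    have := tendsto_integral_mul hu.memLp_weakAngularPartial hu.memLp_weakAngularPartial hm hm l l
    simp only [sq]
    exact this
  have t2 := (tA v φ hv.1 hφ hφ').add (tA w ψ hw.1 hψ hψ')
  have eA : ∀ f g : Plane → ℝ, MemLp f 2 diskMeasure → MemLp g 2 diskMeasure →
      ∫ x in disk, (f x ^ 2 + g x ^ 2) = (∫ x in disk, f x ^ 2) + ∫ x in disk, g x ^ 2 :=
    fun f g hf hg => integral_add hf.integrable_sq hg.integrable_sq
  rw [eA _ _ hv.1.memLp_weakAngularPartial hw.1.memLp_weakAngularPartial]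
  refine le_of_tendsto_of_tendsto' (t1.abs.const_mul 2) t2 fun n => ?_
  rw [← eA _ _ ((IsBddMeas.angularPartial (hφ n)).memLp 2)
    ((IsBddMeas.angularPartial (hψ n)).memLp 2)]
  exact two_mul_abs_integral_regLog_mul_jac_le hε (hφ n) (hψ n)

/-- A majorant independent of $\varepsilon$, for dominated convergence as $\varepsilon\to0$. -/
lemma abs_regLog_le_abs_log {ε : ℝ} (hε : 0 < ε) (hε1 : ε ≤ 1) {x : Plane} (hx : x ∈ disk)
    (hx0 : x ≠ 0) : |regLog ε x| ≤ |Real.log ‖x‖| + 1 := by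
  have h0 : 0 < ‖x‖ := by simpa using hx0
  have h1 := norm_lt_one_of_mem_disk hx
  have hl : Real.log ‖x‖ < 0 := Real.log_neg h0 h1
  have hy : 0 < ‖x‖ ^ 2 + ε ^ 2 := by positivity
  have hle : Real.log (‖x‖ ^ 2 + ε ^ 2) ≤ ‖x‖ ^ 2 + ε ^ 2 - 1 := Real.log_le_sub_one_of_pos hy
  have hge : Real.log (‖x‖ ^ 2) ≤ Real.log (‖x‖ ^ 2 + ε ^ 2) :=
    Real.log_le_log (by positivity) (by nlinarith)
  rw [Real.log_pow] at hge
  push_cast at hge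
  rw [regLog, abs_of_neg hl, abs_le]
  constructor
  · linarith
  · nlinarith

lemma tendsto_regLog {x : Plane} (hx0 : x ≠ 0) :
    Tendsto (fun n : ℕ => regLog (1 / ((n : ℝ) + 1)) x) atTop (𝓝 (Real.log ‖x‖)) := by
  have h0 : 0 < ‖x‖ := by simpa using hx0
  have h1 : Tendsto (fun n : ℕ => ‖x‖ ^ 2 + (1 / ((n : ℝ) + 1)) ^ 2) atTop
      (𝓝 (‖x‖ ^ 2 + 0 ^ 2)) :=
    tendsto_const_nhds.add ((tendsto_one_div_add_atTop_nhds_zero_nat (𝕜 := ℝ)).pow 2)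
  have h2 := (h1.log (by positivity)).div_const 2
  have e : Real.log (‖x‖ ^ 2 + 0 ^ 2) / 2 = Real.log ‖x‖ := by
    rw [zero_pow two_ne_zero, add_zero, Real.log_pow]
    push_cast
    ring
  rw [e] at h2
  exact h2

/-- The Jacobian of a general $W^{1,2}$ map is only in $L^1$, not enough against the unbounded
logarithm. Square integrability of the Jacobian makes the product integrable and permits
$\varepsilon\to0$. -/
lemma two_mul_abs_integral_log_mul_weakJac_le {v w : Plane → ℝ}
    (hv : MemSobolevZero v) (hw : MemSobolevZero w) (hJ : MemLp (weakJac v w) 2 diskMeasure) :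
    2 * |∫ x in disk, Real.log ‖x‖ * weakJac v w x|
      ≤ ∫ x in disk, (weakAngularPartial v x ^ 2 + weakAngularPartial w x ^ 2) := by
  have hl := memLp_log_norm (q := 2) le_rfl
  have hbound : Integrable (fun x => (|Real.log ‖x‖| + 1) * |weakJac v w x|) diskMeasure :=
    (hl.abs.add (memLp_const 1)).integrable_mul hJ.abs
  have t : Tendsto (fun n : ℕ => ∫ x in disk, regLog (1 / ((n : ℝ) + 1)) x * weakJac v w x) atTop
      (𝓝 (∫ x in disk, Real.log ‖x‖ * weakJac v w x)) := by
    refine tendsto_integral_of_dominated_convergence _ (fun n => ?_) hbound (fun n => ?_) ?_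
    · exact (continuous_regLog (by positivity)).aestronglyMeasurable.mul hJ.1
    · filter_upwards [show ∀ᵐ x ∂volume.restrict disk, x ∈ disk from ae_diskMeasure_mem,
        show ∀ᵐ x ∂volume.restrict disk, x ≠ 0 from ae_diskMeasure_ne_zero] with x hx hx0
      rw [norm_mul]
      refine mul_le_mul_of_nonneg_right (abs_regLog_le_abs_log (by positivity) ?_ hx hx0)
        (norm_nonneg _)
      rw [div_le_one (by positivity)]
      linarith [(Nat.cast_nonneg n : (0 : ℝ) ≤ n)]
    · filter_upwards [show ∀ᵐ x ∂volume.restrict disk, x ≠ 0 from ae_diskMeasure_ne_zero]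
        with x hx0
      exact (tendsto_regLog hx0).mul_const _
  refine le_of_tendsto' (t.abs.const_mul 2) fun n => ?_
  exact two_mul_abs_integral_regLog_mul_weakJac_le (by positivity) hv hw

/-! ### Minimality of the covering map -/

lemma weakGrad_apply (u : Plane → Plane) (x : Plane) (i j : Fin 2) :
    weakGrad u x i j = weakPartial j (fun y => u y i) x := rfl

lemma memLp_weakGrad {u : Plane → Plane} (hu : ∀ i, MemSobolev 2 fun x => u x i) (i j : Fin 2) :
    MemLp (fun x => weakGrad u x i j) 2 diskMeasure :=
  (hu i).memLp_weakPartial j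

lemma integrand_add (ν a : ℝ) (x : Plane) (A B : Mat) :
    integrand ν a x (A + B) = integrand ν a x A + integrand ν a x B
      + frob (gradXi (integrand ν a) x A) B := by
  rw [integrand_eq, integrand_eq, integrand_eq]
  simp only [frob, gradXi_integrand, Fin.sum_univ_two, Matrix.add_apply]
  ring

lemma det_add_eq (A B : Mat) : (A + B).det = A.det + frob (cof A) B + B.det := by
  simp [Matrix.det_fin_two, frob, cof, Fin.sum_univ_two]
  ring

/-- The columns $\nabla u_N\,e_R$ and $\nabla u_N\,e_\theta$ have squared lengths $1/N$ and $N$, so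
the energy density is constant. -/
lemma integrand_coverGrad {N : ℕ} (hN : N ≠ 0) (ν a : ℝ) (x : Plane) :
    integrand ν a x (coverGrad N x) = ν * (N + a / N) := by
  have h0 : (N : ℝ) ≠ 0 := by exact_mod_cast hN
  have hs2 : (1 / √(N : ℝ)) ^ 2 = 1 / N := by
    rw [div_pow, one_pow, Real.sq_sqrt (Nat.cast_nonneg N)]
  have key : ∀ p q c s r : ℝ, p ^ 2 + q ^ 2 = 1 → c ^ 2 + s ^ 2 = 1 → r ^ 2 = 1 / N →
      ν * ((a - 1) * (((p * c + N * (-q * -s)) * r * c + (p * s + N * (-q * c)) * r * s) ^ 2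
        + ((q * c + N * (p * -s)) * r * c + (q * s + N * (p * c)) * r * s) ^ 2)
      + (((p * c + N * (-q * -s)) * r * ((p * c + N * (-q * -s)) * r)
        + (p * s + N * (-q * c)) * r * ((p * s + N * (-q * c)) * r))
        + ((q * c + N * (p * -s)) * r * ((q * c + N * (p * -s)) * r)
        + (q * s + N * (p * c)) * r * ((q * s + N * (p * c)) * r)))) = ν * (N + a / N) := by
    intro p q c s r h1 h2 h3
    have e1 : ((p * c + N * (-q * -s)) * r * c + (p * s + N * (-q * c)) * r * s) ^ 2
        + ((q * c + N * (p * -s)) * r * c + (q * s + N * (p * c)) * r * s) ^ 2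
        = (p ^ 2 + q ^ 2) * (c ^ 2 + s ^ 2) ^ 2 * r ^ 2 := by ring
    have e2 : (((p * c + N * (-q * -s)) * r * ((p * c + N * (-q * -s)) * r)
        + (p * s + N * (-q * c)) * r * ((p * s + N * (-q * c)) * r))
        + ((q * c + N * (p * -s)) * r * ((q * c + N * (p * -s)) * r)
        + (q * s + N * (p * c)) * r * ((q * s + N * (p * c)) * r)))
        = (1 + (N : ℝ) ^ 2) * ((p ^ 2 + q ^ 2) * (c ^ 2 + s ^ 2)) * r ^ 2 := by ring
    rw [e1, e2, h1, h2, h3]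
    field_simp
    ring
  have hc : ∀ i j, coverGrad N x i j = (eR (N * angle x) i * eR (angle x) j
      + N * (eT (N * angle x) i * eT (angle x) j)) * (1 / √(N : ℝ)) := fun i j => by
    rw [coverGrad_apply, mul_one_div]
  rw [integrand_eq]
  simp only [frob, Fin.sum_univ_two, hc, eT_zero, eT_one]
  exact key _ _ _ _ _ (eR_sq _) (eR_sq _) hs2

lemma coverMap_mem_admissible {N : ℕ} (hN : N ≠ 0) : coverMap N ∈ admissible (coverMap N) := by
  refine ⟨fun i => memSobolev_coverMap N i one_le_two, ?_, fun i => ?_⟩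
  · filter_upwards [weakGrad_coverMap N] with x hx
    rw [hx, det_coverGrad hN]
  · simpa using memSobolevZero_zero

lemma energy_coverMap {N : ℕ} (hN : N ≠ 0) (ν a : ℝ) :
    energy (integrand ν a) (coverMap N) = ν * Real.pi * (N + a / N) := by
  have e : energy (integrand ν a) (coverMap N) = ∫ _ in disk, ν * (N + a / N) := by
    refine integral_congr_ae ?_
    filter_upwards [show ∀ᵐ x ∂volume.restrict disk, weakGrad (coverMap N) x = coverGrad N x from
      weakGrad_coverMap N] with x hx
    rw [hx, integrand_coverGrad hN]
  have hv : (volume.restrict disk).real univ = Real.pi := by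
    rw [measureReal_def, Measure.restrict_apply_univ, disk, EuclideanSpace.volume_ball_fin_two]
    simp [Real.pi_pos.le]
  rw [e, integral_const, hv, smul_eq_mul]
  ring

/-- The integrand in the polar frame. -/
lemma integrand_eq_frame (ν a : ℝ) (x : Plane) (ξ : Mat) :
    integrand ν a x ξ = ν * (a * ((ξ 0 0 * eR (angle x) 0 + ξ 0 1 * eR (angle x) 1) ^ 2
        + (ξ 1 0 * eR (angle x) 0 + ξ 1 1 * eR (angle x) 1) ^ 2)
      + ((eT (angle x) 0 * ξ 0 0 + eT (angle x) 1 * ξ 0 1) ^ 2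
        + (eT (angle x) 0 * ξ 1 0 + eT (angle x) 1 * ξ 1 1) ^ 2)) := by
  rw [integrand_eq, eT_zero, eT_one]
  simp only [frob, Fin.sum_univ_two]
  linear_combination -ν * (ξ 0 0 ^ 2 + ξ 0 1 ^ 2 + ξ 1 0 ^ 2 + ξ 1 1 ^ 2) * eR_sq (angle x)

/-- Coercivity of the excess density, after the pressure term has been absorbed. -/
lemma excess_density_ge {ν a k κ : ℝ} (hν : 0 < ν) (h1 : κ ≤ a) (h2 : κ + k ≤ 1)
    (x : Plane) (ξ : Mat) :
    ν * κ * frob ξ ξ ≤ integrand ν a x ξ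
      - ν * k * ((eT (angle x) 0 * ξ 0 0 + eT (angle x) 1 * ξ 0 1) ^ 2
        + (eT (angle x) 0 * ξ 1 0 + eT (angle x) 1 * ξ 1 1) ^ 2) := by
  -- For $a=1$ the integrand is $\nu|\xi|^2$, so this is Pythagoras in the polar frame:
  -- $|\xi|^2=P+Q$.
  have e := integrand_eq_frame ν 1 x ξ
  have e' : integrand ν 1 x ξ = ν * frob ξ ξ := by rw [integrand_eq]; ring
  rw [e'] at e
  rw [integrand_eq_frame]
  set P := (ξ 0 0 * eR (angle x) 0 + ξ 0 1 * eR (angle x) 1) ^ 2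
        + (ξ 1 0 * eR (angle x) 0 + ξ 1 1 * eR (angle x) 1) ^ 2
  set Q := (eT (angle x) 0 * ξ 0 0 + eT (angle x) 1 * ξ 0 1) ^ 2
        + (eT (angle x) 0 * ξ 1 0 + eT (angle x) 1 * ξ 1 1) ^ 2
  have hP : 0 ≤ P := by positivity
  have hQ : 0 ≤ Q := by positivity
  have e2 : ν * κ * frob ξ ξ = ν * (κ * P + κ * Q) := by linear_combination κ * e
  have e3 : ν * (a * P + Q) - ν * k * Q = ν * (a * P + (1 - k) * Q) := by ring
  rw [e2, e3]
  gcongr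
  linarith

lemma integrable_integrand {ν a : ℝ} {G : Plane → Mat}
    (hG : ∀ i j, MemLp (fun x => G x i j) 2 diskMeasure) :
    Integrable (fun x => integrand ν a x (G x)) diskMeasure := by
  have r0 := IsBddMeas.eR_angle 0
  have r1 := IsBddMeas.eR_angle 1
  have t0 := IsBddMeas.eT_angle 0
  have t1 := IsBddMeas.eT_angle 1
  have h1 := ((r0.memLp_mul (hG 0 0)).add (r1.memLp_mul (hG 0 1))).integrable_sq
  have h2 := ((r0.memLp_mul (hG 1 0)).add (r1.memLp_mul (hG 1 1))).integrable_sq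
  have h3 := ((t0.memLp_mul (hG 0 0)).add (t1.memLp_mul (hG 0 1))).integrable_sq
  have h4 := ((t0.memLp_mul (hG 1 0)).add (t1.memLp_mul (hG 1 1))).integrable_sq
  refine ((((h1.add h2).const_mul a).add (h3.add h4)).const_mul ν).congr
    (Eventually.of_forall fun x => ?_)
  simp only [integrand_eq_frame, Pi.add_apply]
  ring

/-- The energy of an admissible map exceeds that of the covering map by a multiple of the squared
norm of the gradient of the difference. -/
lemma energy_ge {N : ℕ} (hN : N ≠ 0) {ν a κ : ℝ} (hν : 0 < ν) (h1 : κ ≤ a)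
    (h2 : κ + |(N : ℝ) - a / N| ≤ 1) {v : Plane → Plane} (hv : v ∈ admissible (coverMap N)) :
    energy (integrand ν a) (coverMap N)
        + ν * κ * ∫ x in disk, frob (weakGrad (fun y => v y - coverMap N y) x)
          (weakGrad (fun y => v y - coverMap N y) x)
      ≤ energy (integrand ν a) v := by
  obtain ⟨hvS, hvd, hv0⟩ := hv
  set K : ℝ := N - a / N with hK
  set w : Plane → Plane := fun y => v y - coverMap N y with hw
  have hw0 : ∀ i, MemSobolevZero fun x => w x i := hv0
  have hD : ∀ i j, MemLp (fun x => weakGrad w x i j) 2 diskMeasure :=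
    memLp_weakGrad fun i => (hw0 i).1
  have hsum : ∀ᵐ x ∂diskMeasure, weakGrad v x = coverGrad N x + weakGrad w x := by
    have hij : ∀ i j, ∀ᵐ x ∂diskMeasure, weakGrad w x i j
        = weakGrad v x i j - weakGrad (coverMap N) x i j := fun i j =>
      (((hvS i).isWeakPartial j).sub
        ((memSobolev_coverMap N i one_le_two).isWeakPartial j)).weakPartial_ae_eq
    filter_upwards [hij 0 0, hij 0 1, hij 1 0, hij 1 1, weakGrad_coverMap N]
      with x h1 h2 h3 h4 h5
    rw [← h5]
    ext i j
    rw [Matrix.add_apply]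
    fin_cases i <;> fin_cases j <;> simp only [Fin.zero_eta, Fin.mk_one] <;> linarith
  -- Both determinants equal 1, so in the expansion of $\det(\nabla u_N+\nabla w)$ the linear term
  -- cancels the quadratic one.
  have hcof : ∀ᵐ x ∂diskMeasure, frob (cof (coverGrad N x)) (weakGrad w x)
      = -weakJac (fun x => w x 0) (fun x => w x 1) x := by
    filter_upwards [hsum, hvd] with x h1 h2
    have h3 := det_add_eq (coverGrad N x) (weakGrad w x)
    rw [← h1, h2, det_coverGrad hN, Matrix.det_fin_two] at h3
    simp only [weakGrad_apply] at h3
    rw [weakJac]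
    linarith
  -- The constraint makes the Jacobian a linear expression in $\nabla w$ with bounded coefficients,
  -- hence square integrable.
  have hJ : MemLp (weakJac (fun x => w x 0) (fun x => w x 1)) 2 diskMeasure := by
    have hb : ∀ i j, IsBddMeas fun x => -cof (coverGrad N x) i j := fun i j => by
      fin_cases i <;> fin_cases j <;> simp [cof]
      · exact (IsBddMeas.coverGrad N 1 1).neg
      · exact IsBddMeas.coverGrad N 1 0
      · exact IsBddMeas.coverGrad N 0 1
      · exact (IsBddMeas.coverGrad N 0 0).neg
    refine MemLp.ae_eq ?_ ((((hb 0 0).memLp_mul (hD 0 0)).add ((hb 0 1).memLp_mul (hD 0 1))).add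
      (((hb 1 0).memLp_mul (hD 1 0)).add ((hb 1 1).memLp_mul (hD 1 1))))
    filter_upwards [hcof] with x hx
    rw [frob] at hx
    simp only [Fin.sum_univ_two] at hx
    simp only [Pi.add_apply]
    linarith
  -- The stationarity field with the pressure normalized by $c=0$; it is square integrable, so it
  -- may be tested with $w\in W^{1,2}_0$.
  let F : Fin 2 → Fin 2 → Plane → ℝ := fun i j x =>
    frameField N ((2 * ν * a + 2 * (0 + ν * K * Real.log ‖x‖) * N) / √N)
      ((2 * ν * N + 2 * (0 + ν * K * Real.log ‖x‖)) / √N) x i j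
  have hF : ∀ i j, MemLp (F i j) 2 diskMeasure := fun i j =>
    memLp_frameField_pressure N ν a 0 (ν * K) i j
  have hFz : ∀ i, ∫ x in disk, ∑ j, F i j x * weakGrad w x i j = 0 := fun i =>
    integral_field_mul_weakPartial_eq_zero (hF i)
      (fun φ hφ => integral_frameField_pressure hN ν a 0 i hφ) (hw0 i)
  have hFi : ∀ i, Integrable (fun x => ∑ j, F i j x * weakGrad w x i j) diskMeasure := fun i =>
    integrable_finsetSum _ fun j _ => (hF i j).integrable_mul (hD i j)
  have hlJ : Integrable (fun x => 2 * (ν * K)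
      * (Real.log ‖x‖ * weakJac (fun x => w x 0) (fun x => w x 1) x)) diskMeasure :=
    ((memLp_log_norm le_rfl).integrable_mul hJ).const_mul _
  have hexp : ∀ᵐ x ∂diskMeasure, integrand ν a x (weakGrad v x)
      = integrand ν a x (weakGrad (coverMap N) x) + integrand ν a x (weakGrad w x)
        + ((∑ j, F 0 j x * weakGrad w x 0 j) + (∑ j, F 1 j x * weakGrad w x 1 j))
        + 2 * (ν * K) * (Real.log ‖x‖ * weakJac (fun x => w x 0) (fun x => w x 1) x) := by
    filter_upwards [hsum, hcof, weakGrad_coverMap N] with x e1 e2 e3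
    have e4 := frob_coverGrad ν a N x (0 + ν * K * Real.log ‖x‖) (weakGrad w x)
    have e5 : frob (gradXi (integrand ν a) x (coverGrad N x)
        + (2 * (0 + ν * K * Real.log ‖x‖)) • cof (coverGrad N x)) (weakGrad w x)
        = frob (gradXi (integrand ν a) x (coverGrad N x)) (weakGrad w x)
          + 2 * (ν * K * Real.log ‖x‖) * frob (cof (coverGrad N x)) (weakGrad w x) := by
      simp only [frob, Fin.sum_univ_two, Matrix.add_apply, Matrix.smul_apply, smul_eq_mul]
      ring
    rw [e5, e2, Fin.sum_univ_two] at e4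
    rw [e1, integrand_add, e3]
    linarith
  have hI1 : Integrable (fun x => integrand ν a x (weakGrad (coverMap N) x)) diskMeasure :=
    integrable_integrand (memLp_weakGrad fun i => memSobolev_coverMap N i one_le_two)
  have hI2 : Integrable (fun x => integrand ν a x (weakGrad w x)) diskMeasure :=
    integrable_integrand hD
  have hE : energy (integrand ν a) v = energy (integrand ν a) (coverMap N)
      + (∫ x in disk, integrand ν a x (weakGrad w x))
      + 2 * (ν * K) * ∫ x in disk, Real.log ‖x‖
        * weakJac (fun x => w x 0) (fun x => w x 1) x := by
    have e1 := integral_add ((hI1.add hI2).add ((hFi 0).add (hFi 1))) hlJ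
    have e2 := integral_add (hI1.add hI2) ((hFi 0).add (hFi 1))
    have e3 := integral_add hI1 hI2
    have e4 := integral_add (hFi 0) (hFi 1)
    have e5 := integral_congr_ae hexp
    rw [integral_const_mul] at e1
    have z0 := hFz 0
    have z1 := hFz 1
    simp only [Pi.add_apply] at e1 e2 e3 e4 e5
    simp only [energy]
    simp only [diskMeasure] at e1 e2 e3 e4 e5
    linarith
  have hA := two_mul_abs_integral_log_mul_weakJac_le (hw0 0) (hw0 1) hJ
  set A := ∫ x in disk, (weakAngularPartial (fun x => w x 0) x ^ 2
    + weakAngularPartial (fun x => w x 1) x ^ 2)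
  set J := ∫ x in disk, Real.log ‖x‖ * weakJac (fun x => w x 0) (fun x => w x 1) x
  -- The sign of $K$ is immaterial, since the determinant estimate bounds the absolute value.
  have hJle : -(ν * |K| * A) ≤ 2 * (ν * K) * J := by
    have h3 : |2 * (ν * K) * J| ≤ ν * |K| * A := by
      rw [abs_mul, abs_mul, abs_mul, abs_of_pos hν, abs_two]
      calc 2 * (ν * |K|) * |J| = ν * |K| * (2 * |J|) := by ring
        _ ≤ ν * |K| * A := by gcongr
    exact (abs_le.1 h3).1
  have hlow : ν * κ * ∫ x in disk, frob (weakGrad w x) (weakGrad w x)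
      ≤ (∫ x in disk, integrand ν a x (weakGrad w x)) - ν * |K| * A := by
    have hAi : Integrable (fun x => weakAngularPartial (fun x => w x 0) x ^ 2
        + weakAngularPartial (fun x => w x 1) x ^ 2) diskMeasure :=
      (hw0 0).1.memLp_weakAngularPartial.integrable_sq.add
        (hw0 1).1.memLp_weakAngularPartial.integrable_sq
    have hfr : Integrable (fun x => frob (weakGrad w x) (weakGrad w x)) diskMeasure :=
      integrable_finsetSum _ fun i _ => integrable_finsetSum _ fun j _ =>
        (hD i j).integrable_mul (hD i j)
    have hs := integral_sub hI2 (hAi.const_mul (ν * |K|))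
    rw [integral_const_mul] at hs
    rw [← integral_const_mul]
    refine le_trans ?_ (le_of_eq hs)
    exact integral_mono (hfr.const_mul _) (hI2.sub (hAi.const_mul _)) fun x =>
      excess_density_ge hν h1 h2 x (weakGrad w x)
  rw [hE]
  linarith

lemma frob_self_eq_zero_iff (A : Mat) : frob A A = 0 ↔ ∀ i j, A i j = 0 := by
  simp only [frob, Fin.sum_univ_two, Fin.forall_fin_two]
  constructor
  · intro h
    refine ⟨⟨?_, ?_⟩, ?_, ?_⟩ <;>
      nlinarith [mul_self_nonneg (A 0 0), mul_self_nonneg (A 0 1), mul_self_nonneg (A 1 0),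
        mul_self_nonneg (A 1 1)]
  · rintro ⟨⟨h1, h2⟩, h3, h4⟩
    simp [h1, h2, h3, h4]

lemma frob_self_nonneg (A : Mat) : 0 ≤ frob A A :=
  Finset.sum_nonneg fun _ _ => Finset.sum_nonneg fun _ _ => mul_self_nonneg _

/-- The constant of coercivity. -/
lemma exists_coercivity {N : ℕ} (hN : 2 ≤ N) {a : ℝ} (ha₁ : (N : ℝ) ^ 2 - N < a)
    (ha₂ : a < (N : ℝ) ^ 2 + N) : ∃ κ : ℝ, 0 < κ ∧ κ ≤ a ∧ κ + |(N : ℝ) - a / N| ≤ 1 := by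
  have hN' : (2 : ℝ) ≤ N := by exact_mod_cast hN
  have hN0 : (0 : ℝ) < N := by linarith
  have ha : 1 < a := by nlinarith
  have hlt : |(N : ℝ) - a / N| < 1 := by
    rw [abs_lt]
    constructor
    · have : a / N < N + 1 := by rw [div_lt_iff₀ hN0]; nlinarith
      linarith
    · have : (N : ℝ) - 1 < a / N := by rw [lt_div_iff₀ hN0]; nlinarith
      linarith
  -- The largest value allowed by the angular condition; it is at most 1, hence below $a$, so the
  -- radial condition is free.
  refine ⟨1 - |(N : ℝ) - a / N|, by linarith, ?_, by linarith⟩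
  linarith [abs_nonneg ((N : ℝ) - a / N)]

lemma energy_coverMap_le {N : ℕ} (hN : 2 ≤ N) {a ν : ℝ} (hν : 0 < ν)
    (ha₁ : (N : ℝ) ^ 2 - N < a) (ha₂ : a < (N : ℝ) ^ 2 + N) {v : Plane → Plane}
    (hv : v ∈ admissible (coverMap N)) :
    energy (integrand ν a) (coverMap N) ≤ energy (integrand ν a) v := by
  obtain ⟨κ, h0, h1, h2⟩ := exists_coercivity hN ha₁ ha₂
  refine le_trans ?_ (energy_ge (by omega) hν h1 h2 hv)
  refine le_add_of_nonneg_right (mul_nonneg (by positivity) ?_)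
  exact integral_nonneg fun x => frob_self_nonneg _

lemma ae_eq_coverMap_of_energy_le {N : ℕ} (hN : 2 ≤ N) {a ν : ℝ} (hν : 0 < ν)
    (ha₁ : (N : ℝ) ^ 2 - N < a) (ha₂ : a < (N : ℝ) ^ 2 + N) {v : Plane → Plane}
    (hv : v ∈ admissible (coverMap N))
    (hle : energy (integrand ν a) v ≤ energy (integrand ν a) (coverMap N)) :
    v =ᵐ[diskMeasure] coverMap N := by
  obtain ⟨κ, h0, h1, h2⟩ := exists_coercivity hN ha₁ ha₂
  have hge := energy_ge (by omega) hν h1 h2 hv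
  set w : Plane → Plane := fun y => v y - coverMap N y
  have hw0 : ∀ i, MemSobolevZero fun x => w x i := hv.2.2
  have hD : ∀ i j, MemLp (fun x => weakGrad w x i j) 2 diskMeasure :=
    memLp_weakGrad fun i => (hw0 i).1
  have hfr : Integrable (fun x => frob (weakGrad w x) (weakGrad w x)) diskMeasure :=
    integrable_finsetSum _ fun i _ => integrable_finsetSum _ fun j _ =>
      (hD i j).integrable_mul (hD i j)
  have hz : ∫ x in disk, frob (weakGrad w x) (weakGrad w x) = 0 := by
    refine le_antisymm ?_ (integral_nonneg fun x => frob_self_nonneg _)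
    have h3 : ν * κ * ∫ x in disk, frob (weakGrad w x) (weakGrad w x) ≤ 0 := by linarith
    have h4 : 0 < ν * κ := by positivity
    exact nonpos_of_mul_nonpos_right h3 h4
  have hae := (integral_eq_zero_iff_of_nonneg (fun x => frob_self_nonneg _) hfr).1 hz
  have hwz : ∀ i, ∀ᵐ x ∂diskMeasure, w x i = 0 := fun i =>
    (hw0 i).ae_eq_zero fun j => hae.mono fun x hx => (frob_self_eq_zero_iff _).1 hx i j
  filter_upwards [hwz 0, hwz 1] with x e0 e1
  ext i
  have : w x i = 0 := by fin_cases i <;> assumption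
  simpa [w, sub_eq_zero] using this

end NCover

end

theorem theorem2 (N : ℕ) (hN : 2 ≤ N) (a ν : ℝ) (hν : 0 < ν)
    (ha₁ : (N : ℝ) ^ 2 - N < a) (ha₂ : a < (N : ℝ) ^ 2 + N) :
    -- (i) the coefficient tensor: bounded, symmetric, representing `f`; uniform convexity
    ((∀ i j k l, MemLp (fun x => NCover.coeff a x i j k l) ⊤ NCover.diskMeasure) ∧
      (∀ x i j k l, NCover.coeff a x i j k l = NCover.coeff a x k l i j) ∧
      (∀ x ∈ NCover.disk \ {0}, ∀ ξ : NCover.Mat,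
        NCover.integrand ν a x ξ = ν * NCover.quadForm (NCover.coeff a x) ξ ∧
        ν * NCover.frob ξ ξ ≤ ν * NCover.quadForm (NCover.coeff a x) ξ) ∧
      (∀ x ∈ NCover.disk \ {0},
        ConvexOn ℝ univ (fun ξ : NCover.Mat => NCover.integrand ν a x ξ - ν * NCover.frob ξ ξ))) ∧
    -- (ii) discontinuity at the origin, whatever value is given there
    ((¬ ∃ T, Tendsto (NCover.coeff a) (𝓝[≠] 0) (𝓝 T)) ∧
      (∀ ξ : NCover.Mat, ¬ NCover.IsConformal ξ →
        ¬ ∃ c, Tendsto (fun x => NCover.integrand ν a x ξ) (𝓝[≠] 0) (𝓝 c))) ∧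
    -- (iii) Sobolev regularity of the coefficients and of the integrand in `x`
    ((∀ q : ℝ≥0∞, 1 ≤ q → q < 2 →
        (∀ i j k l, NCover.MemSobolev q (fun x => NCover.coeff a x i j k l)) ∧
        (∀ ξ : NCover.Mat, NCover.MemSobolev q (fun x => NCover.integrand ν a x ξ))) ∧
      (¬ ∀ i j k l, NCover.MemSobolev 2 (fun x => NCover.coeff a x i j k l)) ∧
      (∀ ξ : NCover.Mat, ¬ NCover.IsConformal ξ →
        ¬ NCover.MemSobolev 2 (fun x => NCover.integrand ν a x ξ))) ∧
    -- (iv) the covering map is Lipschitz, not `C¹`, and stationary; its pressures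
    ((∃ K, LipschitzOnWith K (NCover.coverMap N) NCover.disk) ∧
      (¬ ContDiffOn ℝ 1 (NCover.coverMap N) NCover.disk) ∧
      NCover.IsStationary (NCover.integrand ν a) (NCover.coverMap N) ∧
      (∀ p : NCover.Plane → ℝ,
        NCover.IsPressure (NCover.integrand ν a) (NCover.coverMap N) p ↔
          ∃ c : ℝ, ∀ᵐ x ∂NCover.diskMeasure, p x = c + ν * (N - a / N) * Real.log ‖x‖) ∧
      (∀ c : ℝ, ∀ q : ℝ≥0∞, 1 ≤ q → q < 2 →
        NCover.MemSobolev q (fun x => c + ν * (N - a / N) * Real.log ‖x‖))) ∧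
    -- (v) the covering map is the unique global minimizer
    (NCover.IsGlobalMin (NCover.energy (NCover.integrand ν a))
        (NCover.admissible (NCover.coverMap N)) (NCover.coverMap N) ∧
      (∀ v, NCover.IsGlobalMin (NCover.energy (NCover.integrand ν a))
          (NCover.admissible (NCover.coverMap N)) v →
        v =ᵐ[NCover.diskMeasure] NCover.coverMap N)) ∧
    -- (vi) the minimum energy
    IsLeast (NCover.energy (NCover.integrand ν a) '' NCover.admissible (NCover.coverMap N))
      (ν * Real.pi * (N + a / N)) := by
  have hN0 : N ≠ 0 := by omega
  -- For $N\ge2$ the lower bound on $a$ is $N^2-N\ge2$.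
  have ha : 1 < a := by
    have hN' : (2 : ℝ) ≤ N := by exact_mod_cast hN
    nlinarith
  refine ⟨⟨fun i j k l => ?_, fun x i j k l => ?_, fun x _ ξ => ⟨?_, ?_⟩, fun x _ => ?_⟩,
    ⟨NCover.not_tendsto_coeff ha, fun ξ hξ => NCover.not_tendsto_integrand hν ha hξ⟩,
    ⟨fun q hq1 hq2 => ⟨fun i j k l => ?_, fun ξ => ?_⟩, fun h => ?_, fun ξ hξ => ?_⟩,
    ⟨(NCover.lipschitzWith_coverMap N).imp fun K hK => hK.lipschitzOnWith,
      NCover.not_contDiffOn_coverMap hN,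
      ⟨_, (NCover.isPressure_iff hN0 ν a _).2 ⟨0, Eventually.of_forall fun x => rfl⟩⟩,
      NCover.isPressure_iff hN0 ν a,
      fun c q hq1 hq2 => NCover.memSobolev_pressure c _ hq1 hq2⟩,
    ⟨⟨NCover.coverMap_mem_admissible hN0,
        fun v hv => NCover.energy_coverMap_le hN hν ha₁ ha₂ hv⟩,
      fun v hv => NCover.ae_eq_coverMap_of_energy_le hN hν ha₁ ha₂ hv.1
        (hv.2 _ (NCover.coverMap_mem_admissible hN0))⟩,
    ⟨NCover.coverMap N, NCover.coverMap_mem_admissible hN0, NCover.energy_coverMap hN0 ν a⟩, ?_⟩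
  · obtain ⟨c, α, β, h⟩ := NCover.exists_coeff_eq_angular a i j k l
    rw [h]
    exact NCover.memLp_of_bounded (NCover.measurable_angular c α β) (NCover.abs_angular_le c α β)
  · rw [NCover.coeff_eq, NCover.coeff_eq]
    simp only [eq_comm (a := k), eq_comm (a := l), mul_comm (NCover.eR _ l)]
  · exact NCover.quadForm_coeff ν a x ξ
  · rw [← NCover.quadForm_coeff]
    exact NCover.frob_le_integrand hν ha x ξ
  · exact NCover.convexOn_integrand_sub hν ha x
  · obtain ⟨c, α, β, h⟩ := NCover.exists_coeff_eq_angular a i j k l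
    rw [h]
    exact NCover.memSobolev_angular c α β hq1 hq2
  · simp only [NCover.integrand_eq_angular]
    exact NCover.memSobolev_angular _ _ _ hq1 hq2
  · have h0 := h 0 0 0 0
    rw [NCover.coeff_zero_zero_zero_zero] at h0
    exact NCover.not_memSobolev_two_angular (fun h' => by linarith [h'.1]) h0
  · simp only [NCover.integrand_eq_angular]
    exact NCover.not_memSobolev_two_angular (NCover.not_isConformal_angular hν ha hξ)
  · rintro _ ⟨v, hv, rfl⟩
    rw [← NCover.energy_coverMap hN0 ν a]
    exact NCover.energy_coverMap_le hN hν ha₁ ha₂ hv
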